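/- Let $n\ge 2$, let $\Omega\subset\mathbb R^n$ be a bounded domain with boundary of class $C^2$, let $\omega\subset\Omega$ be open, let $d>0$, and put $a=d\,\mathbb 1_\omega$. All functions are complex valued, and derivatives are taken in the weak sense. Let $\mathcal H=(H^2(\Omega)\cap H^1_0(\Omega))\times L^2(\Omega)$ with $$\langle (u_1,v_1),(u_2,v_2)\rangle=\int_\Omega \Delta u_1\,\overline{\Delta u_2}\,dx+\int_\Omega v_1\,\overline{v_2}\,dx ,$$ and define the operator $\mathcal A$ on $\mathcal H$ by $$\mathcal D(\mathcal A)=\{(u,v)\in\mathcal H:\ v\in H^2(\Omega)\cap H^1_0(\Omega),\ \Delta^2u-\operatorname{div}(a\nabla v)\in L^2(\Omega),\ \Delta u|_{\partial\Omega}=0\},\qquad \mathcal A(u,v)=(v,\,-\Delta^2u+\operatorname{div}(a\nabla v)),$$ where $\Delta^2u-\operatorname{div}(a\nabla v)$ is understood in the sense of distributions on $\Omega$ and $\Delta u|_{\partial\Omega}=0$ means $\Delta u\in H^1_0(\Omega)$. Then $\mathcal H$ with this inner product is a Hilbert space, and $\mathcal A$ is the infinitesimal generator of a $C_0$-semigroup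 of contractions on $\mathcal H$. -/

import Mathlib

open MeasureTheory Filter Topology TopologicalSpace
open scoped NNReal ENNReal Distributions

noncomputable section

namespace Plate

/-- Euclidean space of dimension `n`. -/
abbrev Rn (n : ℕ) : Type := EuclideanSpace ℝ (Fin n)

/-- The set `Ω` has a boundary of class `C²`: near each boundary point it is the sublevel set
`{ρ < 0}` of a `C²` function `ρ` whose derivative does not vanish at that point
(in particular `Ω` lies locally on one side of its boundary). -/
def HasC2Boundary {n : ℕ} (Ω : Set (Rn n)) : Prop :=
  ∀ x ∈ frontier Ω, ∃ (U : Set (Rn n)) (ρ : Rn n → ℝ),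
    IsOpen U ∧ x ∈ U ∧ ContDiffOn ℝ 2 ρ U ∧ ρ x = 0 ∧ fderiv ℝ ρ x ≠ 0 ∧
      ∀ y ∈ U, y ∈ Ω ↔ ρ y < 0

/-- Classical partial derivative `∂ᵢ f` of a function on `ℝⁿ`. -/
def pd {n : ℕ} (i : Fin n) (f : Rn n → ℂ) : Rn n → ℂ :=
  fun x => fderiv ℝ f x (EuclideanSpace.single i 1)

/-- Classical Laplacian `∑ᵢ ∂ᵢ∂ᵢ f`. -/
def classicalLaplacian {n : ℕ} (f : Rn n → ℂ) : Rn n → ℂ :=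
  fun x => ∑ i, pd i (pd i f) x

/-- The complex Hilbert space `L²(Ω)`. -/
abbrev L2 {n : ℕ} (Ω : Opens (Rn n)) : Type :=
  Lp ℂ 2 ((volume : Measure (Rn n)).restrict (Ω : Set (Rn n)))

variable {n : ℕ} {Ω : Opens (Rn n)}

/-! ### Integration of `L²` functions against square integrable functions -/

/-- The bilinear pairing `∫_Ω u ψ dx`. -/
def pair (u : L2 Ω) (ψ : Rn n → ℂ) : ℂ := ∫ x in (Ω : Set (Rn n)), u x * ψ x

/-- The property `ψ ∈ L²(Ω)` of a function `ψ`. -/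
abbrev SqInt (Ω : Opens (Rn n)) (ψ : Rn n → ℂ) : Prop :=
  MemLp ψ 2 ((volume : Measure (Rn n)).restrict (Ω : Set (Rn n)))

lemma integrable_pair (u : L2 Ω) {ψ : Rn n → ℂ} (hψ : SqInt Ω ψ) :
    Integrable (fun x => u x * ψ x) (volume.restrict (Ω : Set (Rn n))) :=
  (Lp.memLp u).integrable_mul hψ

lemma pair_add (u v : L2 Ω) {ψ : Rn n → ℂ} (hψ : SqInt Ω ψ) :
    pair (u + v) ψ = pair u ψ + pair v ψ := by
  rw [pair, pair, pair, ← integral_add (integrable_pair u hψ) (integrable_pair v hψ)]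
  apply integral_congr_ae
  filter_upwards [Lp.coeFn_add u v] with x hx
  rw [hx, Pi.add_apply, add_mul]

lemma pair_smul (c : ℂ) (u : L2 Ω) (ψ : Rn n → ℂ) :
    pair (c • u) ψ = c * pair u ψ := by
  rw [pair, pair, ← integral_const_mul]
  apply integral_congr_ae
  filter_upwards [Lp.coeFn_smul c u] with x hx
  rw [hx, Pi.smul_apply, smul_eq_mul, mul_assoc]

lemma pair_zero (ψ : Rn n → ℂ) : pair (0 : L2 Ω) ψ = 0 := by
  have := pair_smul 0 (0 : L2 Ω) ψ
  simpa using this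

lemma contDiff_pd {f : Rn n → ℂ} (hf : ContDiff ℝ ((⊤ : ℕ∞) : WithTop ℕ∞) f) (i : Fin n) : ContDiff ℝ ((⊤ : ℕ∞) : WithTop ℕ∞) (pd i f) :=
  (hf.fderiv_right (m := ((⊤ : ℕ∞) : WithTop ℕ∞)) (by simp)).clm_apply contDiff_const

lemma hasCompactSupport_pd {f : Rn n → ℂ} (hf : HasCompactSupport f) (i : Fin n) :
    HasCompactSupport (pd i f) :=
  hf.fderiv_apply (𝕜 := ℝ) _

lemma sqInt_of_smooth (Ω : Opens (Rn n)) {f : Rn n → ℂ} (hf : ContDiff ℝ ((⊤ : ℕ∞) : WithTop ℕ∞) f)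
    (hc : HasCompactSupport f) : SqInt Ω f :=
  (hf.continuous.memLp_of_hasCompactSupport hc).restrict _

lemma sqInt_test (φ : 𝓓(Ω, ℂ)) : SqInt Ω φ :=
  sqInt_of_smooth Ω φ.contDiff φ.hasCompactSupport

lemma sqInt_pd (φ : 𝓓(Ω, ℂ)) (i : Fin n) : SqInt Ω (pd i φ) :=
  sqInt_of_smooth Ω (contDiff_pd φ.contDiff i) (hasCompactSupport_pd φ.hasCompactSupport i)

lemma sqInt_classicalLaplacian (φ : 𝓓(Ω, ℂ)) : SqInt Ω (classicalLaplacian φ) :=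
  memLp_finsetSum _ fun i _ => sqInt_of_smooth Ω (contDiff_pd (contDiff_pd φ.contDiff i) i)
    (hasCompactSupport_pd (hasCompactSupport_pd φ.hasCompactSupport i) i)

lemma eq_zero_of_pair_test (u : L2 Ω) (h : ∀ φ : 𝓓(Ω, ℂ), pair u φ = 0) : u = 0 := by
  rw [Lp.eq_zero_iff_ae_eq_zero]
  have hint : LocallyIntegrable u (volume.restrict (Ω : Set (Rn n))) :=
    (Lp.memLp u).locallyIntegrable (by norm_num)
  have key := IsOpen.ae_eq_zero_of_integral_contDiff_smul_eq_zero (U := (Ω : Set (Rn n)))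
    (μ := volume.restrict (Ω : Set (Rn n))) (f := u) Ω.isOpen
    (hint.locallyIntegrableOn _) ?_
  · filter_upwards [key, ae_restrict_mem Ω.isOpen.measurableSet] with x hx hxΩ using hx hxΩ
  · intro g hg hgc hgs
    have hφ := h ⟨fun x => (g x : ℂ), Complex.ofRealCLM.contDiff.comp hg,
      hgc.comp_left (g := fun r : ℝ => (r : ℂ)) Complex.ofReal_zero,
      (closure_mono (Function.support_comp_subset Complex.ofReal_zero g)).trans hgs⟩
    rw [← hφ]
    apply integral_congr_ae
    filter_upwards with x
    change g x • u x = u x * (g x : ℂ)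
    rw [Complex.real_smul, mul_comm]

/-! ### Sobolev spaces -/

/-- `g ∈ L²(Ω)` is the weak partial derivative `∂ᵢ u` of `u ∈ L²(Ω)`:
`∫_Ω u ∂ᵢφ = - ∫_Ω g φ` for all test functions `φ ∈ C_c^∞(Ω)`. -/
def HasWeakPartial (i : Fin n) (u g : L2 Ω) : Prop :=
  ∀ φ : 𝓓(Ω, ℂ), pair u (pd i φ) = - pair g φ

lemma HasWeakPartial.add {i : Fin n} {u v g h : L2 Ω} (hu : HasWeakPartial i u g)
    (hv : HasWeakPartial i v h) : HasWeakPartial i (u + v) (g + h) := fun φ => by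
  rw [pair_add _ _ (sqInt_pd φ i), pair_add _ _ (sqInt_test φ), hu φ, hv φ]; ring

lemma HasWeakPartial.smul {i : Fin n} {u g : L2 Ω} (c : ℂ) (hu : HasWeakPartial i u g) :
    HasWeakPartial i (c • u) (c • g) := fun φ => by
  rw [pair_smul, pair_smul, hu φ]; ring

lemma HasWeakPartial.zero (i : Fin n) : HasWeakPartial i (0 : L2 Ω) 0 := fun φ => by
  rw [pair_zero, pair_zero, neg_zero]

lemma HasWeakPartial.unique {i : Fin n} {u g h : L2 Ω} (hg : HasWeakPartial i u g)
    (hh : HasWeakPartial i u h) : g = h := by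
  rw [← sub_eq_zero]
  refine eq_zero_of_pair_test _ fun φ => ?_
  have h1 := hg φ
  rw [hh φ] at h1
  rw [sub_eq_add_neg, ← neg_one_smul ℂ h, pair_add _ _ (sqInt_test φ), pair_smul]
  linear_combination h1

/-- `p` is the weak gradient of `u`, i.e. `u ∈ H¹(Ω)` and `∇u = p`. -/
def HasWeakGradient (u : L2 Ω) (p : Fin n → L2 Ω) : Prop :=
  ∀ i, HasWeakPartial i u (p i)

/-- `q` is the weak Hessian of `u` and `u ∈ H²(Ω)`: the first order weak derivatives of `u`
exist in `L²(Ω)`, and so do their weak derivatives, with `q i j = ∂ⱼ∂ᵢ u`. -/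
def HasWeakHessian (u : L2 Ω) (q : Fin n → Fin n → L2 Ω) : Prop :=
  ∃ p : Fin n → L2 Ω, HasWeakGradient u p ∧ ∀ i, HasWeakGradient (p i) (q i)

lemma HasWeakHessian.add {u v : L2 Ω} {q r : Fin n → Fin n → L2 Ω} (hu : HasWeakHessian u q)
    (hv : HasWeakHessian v r) : HasWeakHessian (u + v) (q + r) := by
  obtain ⟨p, hp, hpq⟩ := hu
  obtain ⟨p', hp', hpr⟩ := hv
  exact ⟨p + p', fun i => (hp i).add (hp' i), fun i j => (hpq i j).add (hpr i j)⟩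

lemma HasWeakHessian.smul {u : L2 Ω} {q : Fin n → Fin n → L2 Ω} (c : ℂ)
    (hu : HasWeakHessian u q) : HasWeakHessian (c • u) (c • q) := by
  obtain ⟨p, hp, hpq⟩ := hu
  exact ⟨c • p, fun i => (hp i).smul c, fun i j => (hpq i j).smul c⟩

lemma HasWeakHessian.unique {u : L2 Ω} {q r : Fin n → Fin n → L2 Ω} (hq : HasWeakHessian u q)
    (hr : HasWeakHessian u r) : q = r := by
  obtain ⟨p, hp, hpq⟩ := hq
  obtain ⟨p', hp', hpr⟩ := hr
  have : p = p' := funext fun i => (hp i).unique (hp' i)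
  subst this
  exact funext fun i => funext fun j => (hpq i j).unique (hpr i j)

/-- The Sobolev space `H²(Ω)`, as a subspace of `L²(Ω)`. -/
def H2 (Ω : Opens (Rn n)) : Submodule ℂ (L2 Ω) where
  carrier := {u | ∃ q, HasWeakHessian u q}
  add_mem' := by
    rintro u v ⟨q, hq⟩ ⟨r, hr⟩
    exact ⟨_, hq.add hr⟩
  zero_mem' := ⟨0, 0, fun i => .zero i, fun _ j => .zero j⟩
  smul_mem' := by
    rintro c u ⟨q, hq⟩
    exact ⟨_, hq.smul c⟩

/-- The Laplacian `Δ : H²(Ω) → L²(Ω)`, the trace of the weak Hessian. -/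
def lap : H2 Ω →ₗ[ℂ] L2 Ω where
  toFun u := ∑ i, u.2.choose i i
  map_add' u v := by
    rw [(u + v).2.choose_spec.unique (u.2.choose_spec.add v.2.choose_spec),
      ← Finset.sum_add_distrib]
    rfl
  map_smul' c u := by
    rw [(c • u).2.choose_spec.unique (u.2.choose_spec.smul c), RingHom.id_apply, Finset.smul_sum]
    rfl

lemma lap_eq (u : H2 Ω) {q : Fin n → Fin n → L2 Ω} (hq : HasWeakHessian (u : L2 Ω) q) :
    lap u = ∑ i, q i i := by
  change ∑ i, u.2.choose i i = _
  rw [u.2.choose_spec.unique hq]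

/-- The pairs `(φ, ∇φ)` for `φ ∈ C_c^∞(Ω)`, as a subspace of `L²(Ω) × L²(Ω)ⁿ`. -/
def testGradients (Ω : Opens (Rn n)) : Submodule ℂ (L2 Ω × (Fin n → L2 Ω)) where
  carrier := {z | ∃ φ : 𝓓(Ω, ℂ), z.1 =ᵐ[volume.restrict (Ω : Set (Rn n))] φ ∧
    ∀ i, z.2 i =ᵐ[volume.restrict (Ω : Set (Rn n))] pd i φ}
  add_mem' := by
    rintro z w ⟨φ, h1, h2⟩ ⟨ψ, h3, h4⟩
    refine ⟨φ + ψ, ?_, fun i => ?_⟩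
    · filter_upwards [Lp.coeFn_add z.1 w.1, h1, h3] with x hx hx1 hx3
      rw [Prod.fst_add, hx, Pi.add_apply, hx1, hx3]; rfl
    · filter_upwards [Lp.coeFn_add (z.2 i) (w.2 i), h2 i, h4 i] with x hx hx1 hx3
      have hd : fderiv ℝ (fun y => φ y + ψ y) x = fderiv ℝ φ x + fderiv ℝ ψ x :=
        fderiv_fun_add (φ.contDiff.differentiable (by simp) x)
          (ψ.contDiff.differentiable (by simp) x)
      rw [Prod.snd_add, Pi.add_apply, hx, Pi.add_apply, hx1, hx3]
      change pd i φ x + pd i ψ x = fderiv ℝ (fun y => φ y + ψ y) x _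
      rw [hd]; rfl
  zero_mem' := by
    refine ⟨0, ?_, fun i => ?_⟩
    · exact Lp.coeFn_zero _ _ _
    · filter_upwards [Lp.coeFn_zero ℂ 2 (volume.restrict (Ω : Set (Rn n)))] with x hx
      change (0 : L2 Ω) x = fderiv ℝ (fun _ => (0 : ℂ)) x _
      rw [hx]; simp
  smul_mem' := by
    rintro c z ⟨φ, h1, h2⟩
    refine ⟨c • φ, ?_, fun i => ?_⟩
    · filter_upwards [Lp.coeFn_smul c z.1, h1] with x hx hx1
      rw [Prod.smul_fst, hx, Pi.smul_apply, hx1]; rfl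
    · filter_upwards [Lp.coeFn_smul c (z.2 i), h2 i] with x hx hx1
      have hd : fderiv ℝ (fun y => c • φ y) x = c • fderiv ℝ φ x :=
        fderiv_fun_const_smul (φ.contDiff.differentiable (by simp) x) c
      rw [Prod.smul_snd, Pi.smul_apply, hx, Pi.smul_apply, hx1]
      change c • pd i φ x = fderiv ℝ (fun y => c • φ y) x _
      rw [hd]; rfl

/-- The Sobolev space `H₀¹(Ω)`, the closure of `C_c^∞(Ω)` in the `H¹` norm: the functions `u` for
which some `(u, p)` is a limit of pairs `(φ, ∇φ)` in `L²(Ω) × L²(Ω)ⁿ`. -/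
def H10 (Ω : Opens (Rn n)) : Submodule ℂ (L2 Ω) :=
  (testGradients Ω).topologicalClosure.map (LinearMap.fst ℂ (L2 Ω) (Fin n → L2 Ω))

/-- The space `H²(Ω) ∩ H₀¹(Ω)`. -/
abbrev H2H10 (Ω : Opens (Rn n)) : Submodule ℂ (L2 Ω) := H2 Ω ⊓ H10 Ω

/-! ### The energy space -/

/-- The energy space `(H²(Ω) ∩ H₀¹(Ω)) × L²(Ω)`. -/
def EnergySpace (Ω : Opens (Rn n)) : Type := ↥(H2H10 Ω) × L2 Ω

namespace EnergySpace

instance : AddCommGroup (EnergySpace Ω) := inferInstanceAs (AddCommGroup (↥(H2H10 Ω) × L2 Ω))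

instance : Module ℂ (EnergySpace Ω) := inferInstanceAs (Module ℂ (↥(H2H10 Ω) × L2 Ω))

/-- The first component `u ∈ H²(Ω) ∩ H₀¹(Ω)` of `(u, v)`, as an element of `L²(Ω)`. -/
def disp (z : EnergySpace Ω) : L2 Ω := (z.1 : L2 Ω)

/-- The second component `v ∈ L²(Ω)` of `(u, v)`. -/
def vel (z : EnergySpace Ω) : L2 Ω := z.2

/-- `Δu ∈ L²(Ω)` for `(u, v)` in the energy space. -/
def lapDisp (z : EnergySpace Ω) : L2 Ω := lap ⟨(z.1 : L2 Ω), z.1.2.1⟩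

lemma disp_add (z w : EnergySpace Ω) : (z + w).disp = z.disp + w.disp := rfl
lemma vel_add (z w : EnergySpace Ω) : (z + w).vel = z.vel + w.vel := rfl
lemma disp_smul (c : ℂ) (z : EnergySpace Ω) : (c • z).disp = c • z.disp := rfl
lemma vel_smul (c : ℂ) (z : EnergySpace Ω) : (c • z).vel = c • z.vel := rfl
lemma disp_zero : (0 : EnergySpace Ω).disp = 0 := rfl
lemma vel_zero : (0 : EnergySpace Ω).vel = 0 := rfl

lemma lapDisp_add (z w : EnergySpace Ω) : (z + w).lapDisp = z.lapDisp + w.lapDisp :=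
  lap.map_add ⟨(z.1 : L2 Ω), z.1.2.1⟩ ⟨(w.1 : L2 Ω), w.1.2.1⟩

lemma lapDisp_smul (c : ℂ) (z : EnergySpace Ω) : (c • z).lapDisp = c • z.lapDisp :=
  lap.map_smul c ⟨(z.1 : L2 Ω), z.1.2.1⟩

lemma lapDisp_zero : (0 : EnergySpace Ω).lapDisp = 0 := by
  simpa using lapDisp_smul 0 (0 : EnergySpace Ω)

lemma ext' {z w : EnergySpace Ω} (h1 : z.disp = w.disp) (h2 : z.vel = w.vel) : z = w :=
  Prod.ext (Subtype.ext h1) h2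

/-- The energy inner product `∫_Ω Δu₁ conj(Δu₂) + ∫_Ω v₁ conj(v₂)`, written with Mathlib's
convention that an inner product is conjugate linear in its first argument. -/
@[reducible] def core : PreInnerProductSpace.Core ℂ (EnergySpace Ω) where
  inner z w := inner ℂ z.lapDisp w.lapDisp + inner ℂ z.vel w.vel
  conj_inner_symm z w := by
    rw [map_add, inner_conj_symm, inner_conj_symm]
  re_inner_nonneg z := by
    rw [map_add]
    exact add_nonneg inner_self_nonneg inner_self_nonneg
  add_left x y z := by
    rw [lapDisp_add, vel_add, inner_add_left, inner_add_left]; ring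
  smul_left x y r := by
    rw [lapDisp_smul, vel_smul, inner_smul_left, inner_smul_left]; ring

instance : SeminormedAddCommGroup (EnergySpace Ω) :=
  @InnerProductSpace.Core.toSeminormedAddCommGroup ℂ (EnergySpace Ω) _ _ _ core

instance : InnerProductSpace ℂ (EnergySpace Ω) := InnerProductSpace.ofCore core

lemma inner_def (z w : EnergySpace Ω) :
    inner ℂ z w = inner ℂ z.lapDisp w.lapDisp + inner ℂ z.vel w.vel := rfl

lemma norm_sq (z : EnergySpace Ω) : ‖z‖ ^ 2 = ‖z.lapDisp‖ ^ 2 + ‖z.vel‖ ^ 2 := by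
  rw [InnerProductSpace.norm_sq_eq_re_inner (𝕜 := ℂ) z, inner_def, map_add,
    ← InnerProductSpace.norm_sq_eq_re_inner, ← InnerProductSpace.norm_sq_eq_re_inner]

end EnergySpace

/-! ### The plate operator -/

/-- The damping coefficient `a = d 1_ω`. -/
def damping (ω : Set (Rn n)) (d : ℝ) : Rn n → ℂ := ω.indicator fun _ => (d : ℂ)

lemma sqInt_damping_mul {ω : Set (Rn n)} (hω : MeasurableSet ω) (d : ℝ) {ψ : Rn n → ℂ}
    (hψ : SqInt Ω ψ) : SqInt Ω fun x => damping ω d x * ψ x := by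
  have : (fun x => damping ω d x * ψ x) = ω.indicator fun x => (d : ℂ) * ψ x := by
    funext x
    by_cases hx : x ∈ ω <;> simp [damping, hx]
  rw [this]
  exact (hψ.const_mul _).indicator hω

/-- `Δ(w) - div(a p) = h` in the sense of distributions on `Ω`, where `w, h ∈ L²(Ω)`,
`p ∈ L²(Ω)ⁿ` and `a = d 1_ω`: for every test function `φ`,
`∫_Ω w Δφ + ∑ᵢ ∫_Ω a pᵢ ∂ᵢφ = ∫_Ω h φ`. -/
def IsForce (ω : Opens (Rn n)) (d : ℝ) (w : L2 Ω) (p : Fin n → L2 Ω) (h : L2 Ω) : Prop :=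
  ∀ φ : 𝓓(Ω, ℂ),
    pair w (classicalLaplacian φ) +
      ∑ i, pair (p i) (fun x => damping (ω : Set (Rn n)) d x * pd i φ x) = pair h φ

/-- The graph of the plate operator: the pairs `((u, v), (f, g))` in the energy space with
`Δu|_{∂Ω} = 0`, that is `Δu ∈ H₀¹(Ω)`; `f = v`, so that `v ∈ H²(Ω) ∩ H₀¹(Ω)`; and
`Δ²u - div(a∇v) = -g ∈ L²(Ω)` in the sense of distributions. -/
def plateGraph (Ω ω : Opens (Rn n)) (d : ℝ) :
    Submodule ℂ (EnergySpace Ω × EnergySpace Ω) where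
  carrier := {z | z.1.lapDisp ∈ H10 Ω ∧ z.2.disp = z.1.vel ∧
    ∃ p, HasWeakGradient z.1.vel p ∧ IsForce ω d z.1.lapDisp p (-z.2.vel)}
  add_mem' := by
    rintro z w ⟨h1, h2, p, hp, h3⟩ ⟨k1, k2, r, hr, k3⟩
    refine ⟨?_, ?_, p + r, fun i => (hp i).add (hr i), fun φ => ?_⟩
    · rw [Prod.fst_add, EnergySpace.lapDisp_add]
      exact add_mem h1 k1
    · rw [Prod.fst_add, Prod.snd_add, EnergySpace.disp_add, EnergySpace.vel_add, h2, k2]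
    · have hs : ∀ i, pair ((p + r) i) (fun x => damping (ω : Set (Rn n)) d x * pd i φ x)
          = pair (p i) (fun x => damping (ω : Set (Rn n)) d x * pd i φ x)
            + pair (r i) (fun x => damping (ω : Set (Rn n)) d x * pd i φ x) := fun i =>
        pair_add _ _ (sqInt_damping_mul ω.isOpen.measurableSet d (sqInt_pd φ i))
      rw [Prod.fst_add, Prod.snd_add, EnergySpace.lapDisp_add, EnergySpace.vel_add, neg_add,
        pair_add _ _ (sqInt_classicalLaplacian φ), pair_add _ _ (sqInt_test φ),
        ← h3 φ, ← k3 φ, Finset.sum_congr rfl fun i _ => hs i, Finset.sum_add_distrib]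
      ring
  zero_mem' := by
    refine ⟨?_, rfl, 0, fun i => .zero i, fun φ => ?_⟩
    · rw [Prod.fst_zero, EnergySpace.lapDisp_zero]
      exact zero_mem _
    · simp [EnergySpace.lapDisp_zero, EnergySpace.vel_zero, pair_zero]
  smul_mem' := by
    rintro c z ⟨h1, h2, p, hp, h3⟩
    refine ⟨?_, ?_, c • p, fun i => (hp i).smul c, fun φ => ?_⟩
    · rw [Prod.smul_fst, EnergySpace.lapDisp_smul]
      exact Submodule.smul_mem _ c h1
    · rw [Prod.smul_fst, Prod.smul_snd, EnergySpace.disp_smul, EnergySpace.vel_smul, h2]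
    · rw [Prod.smul_fst, Prod.smul_snd, EnergySpace.lapDisp_smul, EnergySpace.vel_smul,
        ← smul_neg, pair_smul, pair_smul, ← h3 φ, mul_add, Finset.mul_sum]
      congr 1
      exact Finset.sum_congr rfl fun i _ => pair_smul c (p i) _

/-- The plate operator `𝒜(u, v) = (v, -Δ²u + div(a∇v))` with `a = d 1_ω`, on the domain of all
`(u, v)` in the energy space with `v ∈ H²(Ω) ∩ H₀¹(Ω)`, `Δ²u - div(a∇v) ∈ L²(Ω)` and
`Δu|_{∂Ω} = 0`. -/
def plateOperator (Ω ω : Opens (Rn n)) (d : ℝ) : EnergySpace Ω →ₗ.[ℂ] EnergySpace Ω :=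
  (plateGraph Ω ω d).toLinearPMap

lemma plateGraph_functional (Ω ω : Opens (Rn n)) (d : ℝ) (z : EnergySpace Ω × EnergySpace Ω)
    (hz : z ∈ plateGraph Ω ω d) (h0 : z.1 = 0) : z.2 = 0 := by
  obtain ⟨-, h2, p, hp, h3⟩ := hz
  rw [h0] at h2 hp h3
  have hp0 : ∀ i, p i = 0 := fun i => (hp i).unique (HasWeakPartial.zero i)
  refine EnergySpace.ext' h2 ?_
  rw [EnergySpace.vel_zero, ← neg_eq_zero]
  refine eq_zero_of_pair_test _ fun φ => ?_
  rw [← h3 φ]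
  simp [EnergySpace.lapDisp_zero, hp0, pair_zero]

/-- The graph of `plateOperator` is `plateGraph`. -/
lemma graph_plateOperator (Ω ω : Opens (Rn n)) (d : ℝ) :
    (plateOperator Ω ω d).graph = plateGraph Ω ω d :=
  Submodule.toLinearPMap_graph_eq _ (plateGraph_functional Ω ω d)

/-- The domain of `plateOperator`. -/
lemma mem_domain_plateOperator (Ω ω : Opens (Rn n)) (d : ℝ) (z : EnergySpace Ω) :
    z ∈ (plateOperator Ω ω d).domain ↔
      z.vel ∈ H2H10 Ω ∧
      (∃ p h, HasWeakGradient z.vel p ∧ IsForce ω d z.lapDisp p h) ∧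
      z.lapDisp ∈ H10 Ω := by
  rw [LinearPMap.mem_domain_iff, graph_plateOperator]
  constructor
  · rintro ⟨w, h1, h2, p, hp, h3⟩
    have h2 : w.disp = z.vel := h2
    exact ⟨h2 ▸ w.1.2, ⟨p, _, hp, h3⟩, h1⟩
  · rintro ⟨hv, ⟨p, h, hp, hf⟩, h1⟩
    refine ⟨((⟨z.vel, hv⟩, -h) : ↥(H2H10 Ω) × L2 Ω), h1, rfl, p, hp, ?_⟩
    change IsForce ω d z.lapDisp p (- -h)
    rwa [neg_neg]

/-! ### Semigroups -/

/-- `T` is a `C₀`-semigroup of contractions on `X`. -/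
structure IsC0ContractionSemigroup {X : Type*} [SeminormedAddCommGroup X] [NormedSpace ℂ X]
    (T : ℝ≥0 → X →L[ℂ] X) : Prop where
  zero : T 0 = ContinuousLinearMap.id ℂ X
  add : ∀ s t, T (s + t) = (T s).comp (T t)
  strongly_continuous : ∀ x, Tendsto (fun t => T t x) (𝓝[>] 0) (𝓝 x)
  contraction : ∀ t x, ‖T t x‖ ≤ ‖x‖

/-- The operator `A` is the infinitesimal generator of `T`: `x ∈ D(A)` and `A x = y` if and only
if `(T(t) x - x) / t → y` as `t → 0⁺`. -/
def IsGenerator {X : Type*} [SeminormedAddCommGroup X] [NormedSpace ℂ X]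
    (A : X →ₗ.[ℂ] X) (T : ℝ≥0 → X →L[ℂ] X) : Prop :=
  ∀ x y, (x, y) ∈ A.graph ↔
    Tendsto (fun t : ℝ≥0 => (((t : ℝ)⁻¹ : ℝ) : ℂ) • (T t x - x)) (𝓝[>] 0) (𝓝 y)

end Plate

end

noncomputable section

namespace Plate

variable {n : ℕ}

/-! ### Semigroups generated by inverses of bounded dissipative operators -/

section Semigroup

variable {X : Type*} [NormedAddCommGroup X] [InnerProductSpace ℂ X] [CompleteSpace X]

/-! Everything rests on two facts: the plate operator is dissipative, and it maps its domain
bijectively onto the energy space. For `(u, v)` in the domain both `Δu` and `v` lie in `H₀¹`, so by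
Green's formula the cross terms of `Re ⟨z, 𝒜z⟩` cancel and `-∫ a|∇v|² ≤ 0` remains
(`re_inner_plateGraph_nonpos`). To solve `𝒜(u, v) = (f, g)`, put `v = f`, solve a weak Dirichlet
problem for `w = Δu` whose datum contains `div(a∇f)`, and then solve `Δu = w` (`exists_plateGraph`).
The inverse is an everywhere defined dissipative operator, hence bounded by the closed graph
theorem.

The semigroup is built from this inverse `B`. The operators `(B - ε)⁻¹` are the Yosida
approximations of `B⁻¹`. Their exponentials are contractions that converge on the dense range of
`B²`, hence everywhere, and an estimate uniform in `ε` identifies the generator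
(`exists_semigroup_of_dissipative_inverse`).

The analytic input is that `Δ` maps `H² ∩ H₀¹` bijectively onto `L²`. Injectivity, from the Poincaré
inequality, makes the energy norm definite; surjectivity makes it complete and finishes the
inversion. For surjectivity, Riesz representation gives a weak solution and `mem_H2_of_weak` its
`H²` regularity up to the boundary, by Nirenberg's difference quotients. The boundary is not
flattened: the quotients are taken along volume preserving shifts parallel to the graph that
describes the boundary locally (`exists_profile`). They bound the tangential derivatives of the
gradient (`norm_diffQuot_le`), the equation supplies the remaining one (`exists_hessian_of_tang`),
and cutoffs glue the local results. -/

lemma hasDerivAt_exp_smul_apply (A : X →L[ℂ] X) (x : X) (t : ℝ) :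
    HasDerivAt (fun s : ℝ => NormedSpace.exp (s • A) x) (A (NormedSpace.exp (t • A) x)) t :=
  (((ContinuousLinearMap.apply ℂ X x).restrictScalars ℝ).hasFDerivAt).comp_hasDerivAt t
    (hasDerivAt_exp_smul_const' (𝕂 := ℝ) A t)

/-- Along the orbit `f(s) = exp(sA) x` the derivative `2 Re ⟨A f, f⟩` of `‖f‖²` is nonpositive. -/
lemma norm_exp_smul_apply_le {A : X →L[ℂ] X} (hA : ∀ x, (inner ℂ (A x) x).re ≤ 0) {t : ℝ}
    (ht : 0 ≤ t) (x : X) : ‖NormedSpace.exp (t • A) x‖ ≤ ‖x‖ := by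
  set f : ℝ → X := fun s => NormedSpace.exp (s • A) x with hf
  have hd : ∀ s, HasDerivAt (fun s => ‖f s‖ ^ 2) (2 * (inner ℂ (A (f s)) (f s)).re) s := by
    intro s
    have h1 := (hasDerivAt_exp_smul_apply A x s).inner ℂ (hasDerivAt_exp_smul_apply A x s)
    have h2 := Complex.reCLM.hasFDerivAt.comp_hasDerivAt s h1
    refine (h2.congr_deriv ?_).congr_of_eventuallyEq (Eventually.of_forall fun r => ?_)
    · change (inner ℂ (f s) (A (f s)) + inner ℂ (A (f s)) (f s)).re = _
      rw [Complex.add_re, ← inner_conj_symm, Complex.conj_re]; ring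
    · change ‖f r‖ ^ 2 = (inner ℂ (f r) (f r)).re
      exact InnerProductSpace.norm_sq_eq_re_inner (𝕜 := ℂ) _
  have hanti : Antitone fun s => ‖f s‖ ^ 2 :=
    antitone_of_deriv_nonpos (fun s => (hd s).differentiableAt)
      fun s => by rw [(hd s).deriv]; linarith [hA (f s)]
  have h := hanti ht
  have h0 : f 0 = x := by simp [hf]
  simp only [h0] at h
  exact le_of_sq_le_sq h (norm_nonneg _)

/-- The path `s ↦ exp(tA') exp(s(A - A')) x` joins `exp(tA') x` to `exp(tA) x`. By commutativity its
derivative is `exp(sA) exp((t - s)A')` applied to `Ax - A'x`, and both exponentials are contractions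
for `0 ≤ s ≤ t`. Operator norms, which need not stay bounded for the Yosida approximations, do not
enter. -/
lemma norm_exp_smul_sub_exp_smul_le {A A' : X →L[ℂ] X} (hA : ∀ x, (inner ℂ (A x) x).re ≤ 0)
    (hA' : ∀ x, (inner ℂ (A' x) x).re ≤ 0) (hc : Commute A A') {t : ℝ} (ht : 0 ≤ t) (x : X) :
    ‖NormedSpace.exp (t • A) x - NormedSpace.exp (t • A') x‖ ≤ t * ‖A x - A' x‖ := by
  have hcomm : ∀ r s : ℝ, Commute (r • A) (s • A') := fun r s =>
    (hc.smul_left r).smul_right s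
  set g : ℝ → X := fun s => NormedSpace.exp (t • A') (NormedSpace.exp (s • (A - A')) x) with hg
  have hd : ∀ s, HasDerivAt g
      (NormedSpace.exp (t • A') (NormedSpace.exp (s • (A - A')) (A x - A' x))) s := by
    intro s
    have h1 := (((ContinuousLinearMap.apply ℂ X x).restrictScalars ℝ).hasFDerivAt).comp_hasDerivAt s
      (hasDerivAt_exp_smul_const (𝕂 := ℝ) (A - A') s)
    exact (((NormedSpace.exp (t • A')).restrictScalars ℝ).hasFDerivAt).comp_hasDerivAt s h1
  have hsplit : ∀ s : ℝ, NormedSpace.exp (t • A') * NormedSpace.exp (s • (A - A'))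
      = NormedSpace.exp (s • A) * NormedSpace.exp ((t - s) • A') := by
    intro s
    let _ : NormedAlgebra ℚ (X →L[ℂ] X) := .restrictScalars ℚ ℝ _
    rw [← NormedSpace.exp_add_of_commute (hcomm s (t - s)), ← NormedSpace.exp_add_of_commute]
    · congr 1; module
    · rw [smul_sub]
      exact ((hcomm s t).symm).sub_right ((Commute.refl A').smul_left t |>.smul_right s)
  have hb : ∀ s ∈ Set.Ico 0 t,
      ‖NormedSpace.exp (t • A') (NormedSpace.exp (s • (A - A')) (A x - A' x))‖
        ≤ ‖A x - A' x‖ := by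
    intro s hs
    have := congrArg (fun L : X →L[ℂ] X => L (A x - A' x)) (hsplit s)
    simp only [mul_apply_eq_comp] at this
    rw [this]
    exact (norm_exp_smul_apply_le hA hs.1 _).trans
      (norm_exp_smul_apply_le hA' (sub_nonneg.2 hs.2.le) _)
  have key := norm_image_sub_le_of_norm_deriv_le_segment'
    (fun s _ => (hd s).hasDerivWithinAt) hb t ⟨ht, le_rfl⟩
  have ht' := congrArg (fun L : X →L[ℂ] X => L x) (hsplit t)
  simp only [mul_apply_eq_comp, sub_self, zero_smul, NormedSpace.exp_zero,
    one_apply_eq_self] at ht'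
  simp only [hg, ht', zero_smul, NormedSpace.exp_zero, one_apply_eq_self,
    sub_zero] at key
  linarith

lemma re_eq_zero_of_forall_mul_add {a b : ℝ} (h : ∀ t : ℝ, t * a + t ^ 2 * b ≤ 0) : a = 0 := by
  by_contra ha
  -- At this `t` the linear term dominates.
  have h1 := h (a / (2 * (|b| + 1)))
  have hb : 0 < |b| + 1 := by positivity
  have h2 : a / (2 * (|b| + 1)) * a + (a / (2 * (|b| + 1))) ^ 2 * b
      = a ^ 2 / (4 * (|b| + 1) ^ 2) * (2 * (|b| + 1) + b) := by field_simp; ring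
  rw [h2] at h1
  have h3 : 0 < 2 * (|b| + 1) + b := by linarith [neg_abs_le b, abs_nonneg b]
  have : 0 < a ^ 2 / (4 * (|b| + 1) ^ 2) * (2 * (|b| + 1) + b) := by positivity
  linarith

/-- An everywhere defined dissipative operator on a Hilbert space is bounded. -/
lemma continuous_of_dissipative (B : X →ₗ[ℂ] X) (hB : ∀ x, (inner ℂ (B x) x).re ≤ 0) :
    Continuous B := by
  refine B.continuous_of_seq_closed_graph fun u x y hu hBu => ?_
  rw [← sub_eq_zero]
  set y' := y - B x with hy'
  have h1 : Tendsto (fun k => u k - x) atTop (𝓝 0) := by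
    simpa using hu.sub_const x
  have h2 : Tendsto (fun k => B (u k - x)) atTop (𝓝 y') := by
    simpa only [map_sub, Function.comp_apply] using hBu.sub_const (B x)
  -- Dissipativity at `u k - x + t z` survives the limit, where `u k - x` tends to `0` but its image
  -- tends to `y'`. The term linear in `t` must vanish; `z = y'` then gives `y' = 0`.
  have h3 : ∀ z : X, ∀ t : ℝ, t * (inner ℂ y' z).re + t ^ 2 * (inner ℂ (B z) z).re ≤ 0 := by
    intro z t
    have h4 : Tendsto (fun k => (inner ℂ (B (u k - x + (t : ℂ) • z)) (u k - x + (t : ℂ) • z)).re)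
        atTop (𝓝 (inner ℂ (y' + (t : ℂ) • B z) (0 + (t : ℂ) • z)).re) := by
      simp only [map_add, map_smul]
      exact (Complex.continuous_re.tendsto _).comp
        (((h2.add_const _).inner (h1.add_const _)))
    have h5 := le_of_tendsto' h4 fun k => hB _
    rw [zero_add, inner_add_left, inner_smul_right, inner_smul_right, inner_smul_left,
      Complex.conj_ofReal, ← mul_assoc, ← Complex.ofReal_mul, Complex.add_re,
      Complex.re_ofReal_mul, Complex.re_ofReal_mul] at h5
    linarith [sq t]
  have h6 := re_eq_zero_of_forall_mul_add (h3 y')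
  rw [← RCLike.re_to_complex, inner_self_eq_norm_sq] at h6
  simpa using h6

/-- For `y` orthogonal to the range, `⟨B(y + tz), y + tz⟩` reduces to `t⟨By, z⟩ + t²⟨Bz, z⟩`. The
sign of its real part for all real `t` forces `By = 0`, and injectivity gives `y = 0`. -/
lemma denseRange_of_dissipative (B : X →L[ℂ] X) (hB : ∀ x, (inner ℂ (B x) x).re ≤ 0)
    (hinj : ∀ x, B x = 0 → x = 0) : DenseRange B := by
  have h : (B.range).topologicalClosure = ⊤ := by
    rw [Submodule.topologicalClosure_eq_top_iff, Submodule.eq_bot_iff]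
    intro y hy
    have hy' : ∀ z, inner ℂ (B z) y = 0 := fun z => hy (B z) ⟨z, rfl⟩
    refine hinj y ?_
    have h3 : ∀ z : X, ∀ t : ℝ, t * (inner ℂ (B y) z).re + t ^ 2 * (inner ℂ (B z) z).re ≤ 0 := by
      intro z t
      have h5 := hB (y + (t : ℂ) • z)
      simp only [map_add, map_smul, inner_add_left, inner_add_right, inner_smul_left,
        inner_smul_right, hy', Complex.conj_ofReal, mul_zero, zero_add,
        Complex.add_re, Complex.re_ofReal_mul] at h5
      linarith [sq t]
    have h6 := re_eq_zero_of_forall_mul_add (h3 (B y))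
    rw [← RCLike.re_to_complex, inner_self_eq_norm_sq] at h6
    simpa using h6
  intro x
  have : x ∈ B.range.topologicalClosure := by rw [h]; trivial
  exact this

/-- The resolvent of a bounded dissipative operator. -/
lemma exists_inverse_sub_smul (B : X →L[ℂ] X) (hB : ∀ x, (inner ℂ (B x) x).re ≤ 0) {ε : ℝ}
    (hε : 0 < ε) : IsUnit (B - (ε : ℂ) • (1 : X →L[ℂ] X)) := by
  set L := B - (ε : ℂ) • (1 : X →L[ℂ] X) with hL
  -- Subtracting `ε` makes the form coercive. This gives injectivity and closed range, and a vector
  -- orthogonal to the range vanishes when tested with itself.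
  have hco : ∀ z, ε * ‖z‖ ^ 2 ≤ -(inner ℂ (L z) z).re := by
    intro z
    have : inner ℂ (L z) z = inner ℂ (B z) z - (ε : ℂ) * inner ℂ z z := by
      simp [hL]
    rw [this, Complex.sub_re, Complex.re_ofReal_mul, ← RCLike.re_to_complex (x := inner ℂ z z),
      inner_self_eq_norm_sq]
    linarith [hB z]
  have hbd : ∀ z, ε * ‖z‖ ≤ ‖L z‖ := by
    intro z
    rcases eq_or_ne z 0 with rfl | hz
    · simp
    have h1 : -(inner ℂ (L z) z).re ≤ ‖L z‖ * ‖z‖ :=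
      (neg_le_abs _).trans ((Complex.abs_re_le_norm _).trans (norm_inner_le_norm _ _))
    have h2 := (hco z).trans h1
    have h3 : 0 < ‖z‖ := norm_pos_iff.2 hz
    nlinarith
  rw [ContinuousLinearMap.isUnit_iff_bijective]
  constructor
  · rw [injective_iff_map_eq_zero]
    intro z hz
    have := hbd z
    rw [hz, norm_zero] at this
    exact norm_le_zero_iff.1 (by nlinarith)
  · have hanti : AntilipschitzWith (Real.toNNReal ε⁻¹) L := by
      refine AddMonoidHomClass.antilipschitz_of_bound L fun z => ?_
      rw [Real.coe_toNNReal _ (inv_nonneg.2 hε.le), inv_mul_eq_div, le_div_iff₀' hε]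
      exact hbd z
    have hcl := ContinuousLinearMap.closed_range_of_antilipschitz hanti
    have htop : L.range.topologicalClosure = ⊤ := by
      rw [Submodule.topologicalClosure_eq_top_iff, Submodule.eq_bot_iff]
      intro y hy
      have h1 := hco y
      have h2 : inner ℂ (L y) y = 0 := hy (L y) ⟨y, rfl⟩
      rw [h2] at h1
      simp only [Complex.zero_re, neg_zero] at h1
      have : ‖y‖ ^ 2 ≤ 0 := by nlinarith [sq_nonneg ‖y‖]
      simpa using le_antisymm this (sq_nonneg _)
    rw [hcl] at htop
    exact LinearMap.range_eq_top.1 htop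

/-! ### Yosida approximation and the limit semigroup -/

/-- Bounded approximations of the inverse of an injective bounded dissipative operator. -/
structure InverseApprox (B : X →L[ℂ] X) (A : ℕ → X →L[ℂ] X) (ε : ℕ → ℝ) : Prop where
  dissipative : ∀ m x, (inner ℂ (A m x) x).re ≤ 0
  commute : ∀ m k, Commute (A m) (A k)
  commute_right : ∀ m, Commute (A m) B
  apply_apply : ∀ m x, A m (B x) = x + (ε m : ℂ) • A m x
  norm_smul_le : ∀ m x, ‖(ε m : ℂ) • A m x‖ ≤ ‖x‖
  pos : ∀ m, 0 < ε m
  tendsto : Tendsto ε atTop (𝓝 0)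

/-- The choice is `A m = (B - ε_m)⁻¹` with `ε_m = 1/(m + 1)`; formally this is `A(1 - ε_m A)⁻¹` for
`A = B⁻¹`. -/
lemma exists_inverseApprox (B : X →L[ℂ] X) (hB : ∀ x, (inner ℂ (B x) x).re ≤ 0) :
    ∃ A ε, InverseApprox B A ε := by
  set ε : ℕ → ℝ := fun m => 1 / ((m : ℝ) + 1) with hεdef
  have hε : ∀ m, 0 < ε m := fun m => by positivity
  choose u hu using fun m => exists_inverse_sub_smul B hB (hε m)
  have hr : ∀ m x, B ((↑(u m)⁻¹ : X →L[ℂ] X) x) = x + (ε m : ℂ) • (↑(u m)⁻¹ : X →L[ℂ] X) x := by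
    intro m x
    have h := congrArg (fun L : X →L[ℂ] X => L x) ((u m).mul_inv)
    simp only [mul_apply_eq_comp, hu m, sub_apply,
      smul_apply, one_apply_eq_self] at h
    exact sub_eq_iff_eq_add.1 h
  have hcB : ∀ m, Commute (↑(u m)⁻¹ : X →L[ℂ] X) B := by
    intro m
    refine Commute.units_inv_left ?_
    rw [hu m]
    exact (Commute.refl B).sub_left ((Commute.one_left B).smul_left _)
  -- With `z = A m x` one has `x = Bz - εz`, so `Re ⟨z, x⟩ = Re ⟨z, Bz⟩ - ε‖z‖²`. This yields both
  -- dissipativity and, by Cauchy–Schwarz, `ε‖A m x‖ ≤ ‖x‖`.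
  have hd : ∀ m x, (inner ℂ ((↑(u m)⁻¹ : X →L[ℂ] X) x) x).re
      + ε m * ‖(↑(u m)⁻¹ : X →L[ℂ] X) x‖ ^ 2 ≤ 0 := by
    intro m x
    set z := (↑(u m)⁻¹ : X →L[ℂ] X) x with hz
    have hx : x = B z - (ε m : ℂ) • z := by rw [hr m x, hz]; abel
    have h1 : inner ℂ z x = inner ℂ z (B z) - (ε m : ℂ) * inner ℂ z z := by
      rw [hx, inner_sub_right, inner_smul_right]
    rw [h1, Complex.sub_re, Complex.re_ofReal_mul, ← RCLike.re_to_complex (x := inner ℂ z z),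
      inner_self_eq_norm_sq, ← inner_conj_symm, Complex.conj_re]
    linarith [hB z]
  refine ⟨fun m => ↑(u m)⁻¹, ε, ?_, ?_, hcB, ?_, ?_, hε, tendsto_one_div_add_atTop_nhds_zero_nat⟩
  · intro m x
    have := hε m
    nlinarith [hd m x, sq_nonneg ‖(↑(u m)⁻¹ : X →L[ℂ] X) x‖]
  · intro m k
    refine Commute.units_inv_right ?_
    rw [hu k]
    exact (hcB m).sub_right ((Commute.one_right _).smul_right _)
  · intro m x
    rw [← hr m x]
    exact congrArg (fun L : X →L[ℂ] X => L x) (hcB m).eq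
  · intro m x
    set z := (↑(u m)⁻¹ : X →L[ℂ] X) x with hz
    have h1 := hd m x
    rw [← hz] at h1
    have h2 : -(inner ℂ z x).re ≤ ‖z‖ * ‖x‖ :=
      (neg_le_abs _).trans ((Complex.abs_re_le_norm _).trans (norm_inner_le_norm _ _))
    rw [norm_smul, Complex.norm_real, Real.norm_of_nonneg (hε m).le]
    rcases eq_or_ne z 0 with h0 | h0
    · simp [h0]
    have h3 : 0 < ‖z‖ := norm_pos_iff.2 h0
    nlinarith

/-- Strong convergence of contractions tolerates a moving argument; the semigroup law passes to the
limit this way. -/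
lemma tendsto_apply_of_contraction {S : ℕ → X →L[ℂ] X} {S' : X →L[ℂ] X}
    (hS : ∀ m x, ‖S m x‖ ≤ ‖x‖) (hlim : ∀ x, Tendsto (fun m => S m x) atTop (𝓝 (S' x)))
    {x : ℕ → X} {y : X} (hx : Tendsto x atTop (𝓝 y)) :
    Tendsto (fun m => S m (x m)) atTop (𝓝 (S' y)) := by
  have h1 : Tendsto (fun m => S m (x m - y)) atTop (𝓝 0) :=
    squeeze_zero_norm (fun m => hS m _) (by simpa using (hx.sub_const y).norm)
  simpa using h1.add (hlim y)

lemma InverseApprox.norm_apply_le {B : X →L[ℂ] X} {A : ℕ → X →L[ℂ] X} {ε : ℕ → ℝ}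
    (h : InverseApprox B A ε) (m : ℕ) (w : X) : ‖A m (B w)‖ ≤ 2 * ‖w‖ := by
  rw [h.apply_apply]
  linarith [norm_add_le w ((ε m : ℂ) • A m w), h.norm_smul_le m w]

/-- On the range of `B` the vectors `A m (B w)` stay bounded by `2‖w‖`, so the factor `ε m` wins;
`norm_smul_le` carries the limit to the closure. -/
lemma InverseApprox.tendsto_smul {B : X →L[ℂ] X} {A : ℕ → X →L[ℂ] X} {ε : ℕ → ℝ}
    (h : InverseApprox B A ε) (hd : DenseRange B) (y : X) :
    Tendsto (fun m => (ε m : ℂ) • A m y) atTop (𝓝 0) := by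
  rw [Metric.tendsto_atTop]
  intro δ hδ
  obtain ⟨w, hw⟩ := hd.exists_dist_lt y (half_pos hδ)
  have hlim : Tendsto (fun m => ε m * (2 * ‖w‖)) atTop (𝓝 (0 * (2 * ‖w‖))) :=
    h.tendsto.mul_const _
  rw [zero_mul] at hlim
  obtain ⟨N, hN⟩ := eventually_atTop.1 (hlim.eventually (gt_mem_nhds (half_pos hδ)))
  refine ⟨N, fun m hm => ?_⟩
  rw [dist_zero_right]
  have e : (ε m : ℂ) • A m y = (ε m : ℂ) • A m (y - B w) + (ε m : ℂ) • A m (B w) := by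
    rw [← smul_add, ← map_add, sub_add_cancel]
  have h1 := h.norm_smul_le m (y - B w)
  have h2 : ‖(ε m : ℂ) • A m (B w)‖ ≤ ε m * (2 * ‖w‖) := by
    rw [norm_smul, Complex.norm_real, Real.norm_of_nonneg (h.pos m).le]
    exact mul_le_mul_of_nonneg_left (h.norm_apply_le m w) (h.pos m).le
  rw [dist_eq_norm] at hw
  rw [e]
  linarith [norm_add_le ((ε m : ℂ) • A m (y - B w)) ((ε m : ℂ) • A m (B w)), hN m hm]

/-- The range of `B²` is dense, and there `A m (B (B w)) = B w + ε m A m (B w)` converges to `B w`.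
The comparison of commuting exponentials makes the orbits Cauchy, and contractivity extends this to
all `x`. -/
lemma InverseApprox.cauchySeq {B : X →L[ℂ] X} {A : ℕ → X →L[ℂ] X} {ε : ℕ → ℝ}
    (h : InverseApprox B A ε) (hd : DenseRange B) {t : ℝ} (ht : 0 ≤ t) (x : X) :
    CauchySeq fun m => NormedSpace.exp (t • A m) x := by
  rw [Metric.cauchySeq_iff']
  intro δ hδ
  have hd2 : DenseRange (B ∘ B) := hd.comp hd B.continuous
  obtain ⟨w, hw⟩ := hd2.exists_dist_lt x (show (0 : ℝ) < δ / 4 by positivity)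
  simp only [Function.comp_apply] at hw
  have hconv : Tendsto (fun m => t * ‖A m (B (B w)) - B w‖) atTop (𝓝 (t * ‖(0 : X)‖)) := by
    refine (Tendsto.norm ?_).const_mul t
    have := h.tendsto_smul hd (B w)
    refine this.congr fun m => ?_
    rw [h.apply_apply m (B w)]; abel
  rw [norm_zero, mul_zero] at hconv
  obtain ⟨N, hN⟩ := eventually_atTop.1
    (hconv.eventually (gt_mem_nhds (show (0 : ℝ) < δ / 4 by positivity)))
  refine ⟨N, fun m hm => ?_⟩
  rw [dist_eq_norm] at hw ⊢
  have h1 := norm_exp_smul_sub_exp_smul_le (h.dissipative m) (h.dissipative N) (h.commute m N) ht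
    (B (B w))
  have h2 : t * ‖A m (B (B w)) - A N (B (B w))‖ < δ / 2 := by
    have h3 := hN m hm
    have h4 := hN N le_rfl
    have h5 : ‖A m (B (B w)) - A N (B (B w))‖
        ≤ ‖A m (B (B w)) - B w‖ + ‖A N (B (B w)) - B w‖ := by
      rw [← sub_sub_sub_cancel_right _ _ (B w)]
      exact norm_sub_le _ _
    nlinarith
  have h6 := norm_exp_smul_apply_le (h.dissipative m) ht (x - B (B w))
  have h7 := norm_exp_smul_apply_le (h.dissipative N) ht (x - B (B w))
  have e : NormedSpace.exp (t • A m) x - NormedSpace.exp (t • A N) x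
      = NormedSpace.exp (t • A m) (x - B (B w)) - NormedSpace.exp (t • A N) (x - B (B w))
        + (NormedSpace.exp (t • A m) (B (B w)) - NormedSpace.exp (t • A N) (B (B w))) := by
    rw [map_sub, map_sub]; abel
  rw [e]
  have h8 := norm_add_le (NormedSpace.exp (t • A m) (x - B (B w))
      - NormedSpace.exp (t • A N) (x - B (B w)))
    (NormedSpace.exp (t • A m) (B (B w)) - NormedSpace.exp (t • A N) (B (B w)))
  have h9 := norm_sub_le (NormedSpace.exp (t • A m) (x - B (B w)))
    (NormedSpace.exp (t • A N) (x - B (B w)))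
  linarith

/-- A first order expansion at `B y`. The free vector `w` serves to make `‖y - B w‖` small, after
which small `t` handles the term with `‖w‖`; the `m`-dependent term vanishes in the limit. -/
lemma InverseApprox.norm_exp_sub_sub_le {B : X →L[ℂ] X} {A : ℕ → X →L[ℂ] X} {ε : ℕ → ℝ}
    (h : InverseApprox B A ε) {t : ℝ} (ht : 0 ≤ t) (m : ℕ) (y w : X) :
    ‖NormedSpace.exp (t • A m) (B y) - B y - t • y‖
      ≤ (2 * t * ‖w‖ + 2 * ‖y - B w‖ + ‖(ε m : ℂ) • A m y‖) * t := by
  set g : ℝ → X := fun s => NormedSpace.exp (s • A m) (B y) - B y - s • y with hg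
  have hcomm : ∀ s : ℝ, ∀ z, A m (NormedSpace.exp (s • A m) z)
      = NormedSpace.exp (s • A m) (A m z) := by
    intro s z
    have : Commute (A m) (NormedSpace.exp (s • A m)) := by
      let _ : NormedAlgebra ℚ (X →L[ℂ] X) := .restrictScalars ℚ ℝ _
      exact ((Commute.refl (A m)).smul_right s).exp_right
    exact congrArg (fun L : X →L[ℂ] X => L z) this.eq
  have hd : ∀ s, HasDerivAt g (NormedSpace.exp (s • A m) (y + (ε m : ℂ) • A m y) - y) s := by
    intro s
    have h1 := ((hasDerivAt_exp_smul_apply (A m) (B y) s).sub_const (B y)).sub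
      ((hasDerivAt_id s).smul_const y)
    rw [hcomm, h.apply_apply, one_smul] at h1
    exact h1
  -- The derivative is split at `B w`: the exponential moves `B w` by at most `s‖A m (B w)‖ ≤
  -- 2t‖w‖`, by comparison with the zero operator, and moves `y - B w` by at most twice its norm.
  have hb : ∀ s ∈ Set.Ico 0 t, ‖NormedSpace.exp (s • A m) (y + (ε m : ℂ) • A m y) - y‖
      ≤ 2 * t * ‖w‖ + 2 * ‖y - B w‖ + ‖(ε m : ℂ) • A m y‖ := by
    intro s hs
    have hz : ∀ x, (inner ℂ ((0 : X →L[ℂ] X) x) x).re ≤ 0 := fun x => by simp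
    have h1 := norm_exp_smul_sub_exp_smul_le (h.dissipative m) hz (Commute.zero_right _) hs.1 (B w)
    simp only [smul_zero, NormedSpace.exp_zero, one_apply_eq_self,
      zero_apply, sub_zero] at h1
    have h2 := h.norm_apply_le m w
    have h3 := norm_exp_smul_apply_le (h.dissipative m) hs.1 (y - B w)
    have h4 := norm_exp_smul_apply_le (h.dissipative m) hs.1 ((ε m : ℂ) • A m y)
    have e : NormedSpace.exp (s • A m) (y + (ε m : ℂ) • A m y) - y
        = (NormedSpace.exp (s • A m) (B w) - B w) + NormedSpace.exp (s • A m) (y - B w)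
          - (y - B w) + NormedSpace.exp (s • A m) ((ε m : ℂ) • A m y) := by
      rw [map_add, map_sub]; abel
    rw [e]
    have h5 : s * ‖A m (B w)‖ ≤ t * (2 * ‖w‖) :=
      mul_le_mul hs.2.le h2 (norm_nonneg _) ht
    refine (norm_add_le _ _).trans ?_
    refine (add_le_add_left ((norm_sub_le _ _).trans (add_le_add_left (norm_add_le _ _) _)) _).trans
      ?_
    linarith
  have key := norm_image_sub_le_of_norm_deriv_le_segment'
    (fun s _ => (hd s).hasDerivWithinAt) hb t ⟨ht, le_rfl⟩
  simpa [hg] using key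

/-- The inverse of an injective bounded dissipative operator generates a contraction semigroup. -/
theorem exists_semigroup_of_dissipative_inverse (B : X →L[ℂ] X)
    (hB : ∀ x, (inner ℂ (B x) x).re ≤ 0) (hinj : ∀ x, B x = 0 → x = 0) :
    ∃ T : ℝ≥0 → X →L[ℂ] X, IsC0ContractionSemigroup T ∧
      ∀ x y, B y = x ↔
        Tendsto (fun t : ℝ≥0 => (((t : ℝ)⁻¹ : ℝ) : ℂ) • (T t x - x)) (𝓝[>] 0) (𝓝 y) := by
  obtain ⟨A, ε, h⟩ := exists_inverseApprox B hB
  have hd := denseRange_of_dissipative B hB hinj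
  choose F hF using fun (t : ℝ≥0) (x : X) =>
    cauchySeq_tendsto_of_complete (h.cauchySeq hd t.2 x)
  let T : ℝ≥0 → X →L[ℂ] X := fun t =>
    continuousLinearMapOfTendsto (fun m => NormedSpace.exp ((t : ℝ) • A m))
      (f := F t) (tendsto_pi_nhds.2 (hF t))
  have hT : ∀ (t : ℝ≥0) x, Tendsto (fun m => NormedSpace.exp ((t : ℝ) • A m) x) atTop
      (𝓝 (T t x)) := hF
  have hcontr : ∀ (t : ℝ≥0) x, ‖T t x‖ ≤ ‖x‖ := fun t x =>
    le_of_tendsto' (hT t x).norm fun m => norm_exp_smul_apply_le (h.dissipative m) t.2 x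
  have hkey : ∀ (t : ℝ≥0) (y w : X), ‖T t (B y) - B y - (t : ℝ) • y‖
      ≤ (2 * t * ‖w‖ + 2 * ‖y - B w‖) * t := by
    intro t y w
    have h1 : Tendsto (fun m => ‖NormedSpace.exp ((t : ℝ) • A m) (B y) - B y - (t : ℝ) • y‖) atTop
        (𝓝 ‖T t (B y) - B y - (t : ℝ) • y‖) := (((hT t (B y)).sub_const _).sub_const _).norm
    have h2 : Tendsto (fun m => (2 * (t : ℝ) * ‖w‖ + 2 * ‖y - B w‖ + ‖(ε m : ℂ) • A m y‖) * t) atTop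
        (𝓝 ((2 * t * ‖w‖ + 2 * ‖y - B w‖ + ‖(0 : X)‖) * t)) :=
      (((h.tendsto_smul hd y).norm).const_add _).mul_const _
    have h3 := le_of_tendsto_of_tendsto' h1 h2 fun m => h.norm_exp_sub_sub_le t.2 m y w
    simpa using h3
  have hgen : ∀ y, Tendsto (fun t : ℝ≥0 => (((t : ℝ)⁻¹ : ℝ) : ℂ) • (T t (B y) - B y)) (𝓝[>] 0)
      (𝓝 y) := by
    intro y
    rw [Metric.tendsto_nhdsWithin_nhds]
    intro δ hδ
    obtain ⟨w, hw⟩ := hd.exists_dist_lt y (show (0 : ℝ) < δ / 4 by positivity)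
    -- This radius gives `2t‖w‖ < δ/2`; the choice of `w` gives `2‖y - B w‖ < δ/2`.
    refine ⟨δ / (4 * (‖w‖ + 1)), by positivity, fun {t} ht htd => ?_⟩
    have ht0 : (0 : ℝ) < t := ht
    rw [dist_eq_norm] at hw ⊢
    rw [NNReal.dist_eq, NNReal.coe_zero, sub_zero, abs_of_pos ht0, lt_div_iff₀ (by positivity)]
      at htd
    have e : (((t : ℝ)⁻¹ : ℝ) : ℂ) • (T t (B y) - B y) - y
        = (((t : ℝ)⁻¹ : ℝ) : ℂ) • (T t (B y) - B y - (t : ℝ) • y) := by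
      rw [smul_sub _ (T t (B y) - B y), Complex.coe_smul, Complex.coe_smul, smul_smul (t : ℝ)⁻¹,
        inv_mul_cancel₀ ht0.ne', one_smul]
    rw [e, norm_smul, Complex.norm_real, Real.norm_of_nonneg (inv_nonneg.2 ht0.le), inv_mul_eq_div,
      div_lt_iff₀ ht0]
    refine (hkey t y w).trans_lt (mul_lt_mul_of_pos_right ?_ ht0)
    nlinarith
  have hcommB : ∀ (t : ℝ≥0) x, T t (B x) = B (T t x) := by
    intro t x
    refine tendsto_nhds_unique (hT t (B x)) ?_
    refine ((B.continuous.tendsto _).comp (hT t x)).congr fun m => ?_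
    have : Commute B (NormedSpace.exp ((t : ℝ) • A m)) := by
      let _ : NormedAlgebra ℚ (X →L[ℂ] X) := .restrictScalars ℚ ℝ _
      exact ((h.commute_right m).symm.smul_right (t : ℝ)).exp_right
    exact congrArg (fun L : X →L[ℂ] X => L x) this.eq
  refine ⟨T, ⟨?_, ?_, ?_, hcontr⟩, ?_⟩
  · ext x
    refine tendsto_nhds_unique (hT 0 x) ?_
    simp
  · intro s t
    ext x
    refine tendsto_nhds_unique (hT (s + t) x) ?_
    have := tendsto_apply_of_contraction (S := fun m => NormedSpace.exp ((s : ℝ) • A m)) (S' := T s)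
      (fun m x => norm_exp_smul_apply_le (h.dissipative m) s.2 x) (hT s) (hT t x)
    refine this.congr fun m => ?_
    let _ : NormedAlgebra ℚ (X →L[ℂ] X) := .restrictScalars ℚ ℝ _
    rw [NNReal.coe_add, add_smul, NormedSpace.exp_add_of_commute
      (((Commute.refl (A m)).smul_left (s : ℝ)).smul_right (t : ℝ))]
    rfl
  · intro x
    have hBy : ∀ y, Tendsto (fun t => T t (B y)) (𝓝[>] (0 : ℝ≥0)) (𝓝 (B y)) := by
      intro y
      have h1 : Tendsto (fun t : ℝ≥0 => (((t : ℝ) : ℂ))) (𝓝[>] 0) (𝓝 0) := by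
        have : Continuous fun t : ℝ≥0 => ((t : ℝ) : ℂ) := by fun_prop
        simpa using (this.tendsto 0).mono_left nhdsWithin_le_nhds
      have h2 := (h1.smul (hgen y)).add_const (B y)
      rw [zero_smul, zero_add] at h2
      refine h2.congr' ?_
      filter_upwards [self_mem_nhdsWithin] with t ht
      have ht0 : (0 : ℝ) < t := ht
      rw [smul_smul, ← Complex.ofReal_mul, mul_inv_cancel₀ ht0.ne', Complex.ofReal_one, one_smul,
        sub_add_cancel]
    rw [Metric.tendsto_nhds]
    intro δ hδ
    obtain ⟨y, hy⟩ := hd.exists_dist_lt x (show (0 : ℝ) < δ / 4 by positivity)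
    filter_upwards [(Metric.tendsto_nhds.1 (hBy y)) (δ / 4) (by positivity)] with t ht
    rw [dist_eq_norm] at hy ht ⊢
    have e : T t x - x = T t (x - B y) - (x - B y) + (T t (B y) - B y) := by
      rw [map_sub]; abel
    rw [e]
    linarith [norm_add_le (T t (x - B y) - (x - B y)) (T t (B y) - B y),
      norm_sub_le (T t (x - B y)) (x - B y), hcontr t (x - B y)]
  · intro x y
    constructor
    · rintro rfl
      exact hgen y
    -- `T t` commutes with `B`, so applying `B` to the quotients at `x` gives those at `B x`. Their
    -- limits are `B y` and, by `hgen`, `x`.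
    · intro hx
      refine tendsto_nhds_unique (((B.continuous.tendsto _).comp hx).congr fun t => ?_) (hgen x)
      simp only [Function.comp_apply, map_smul, map_sub, hcommB]

/-- A dissipative operator that is bijective from its domain onto the space generates a contraction
semigroup. -/
theorem exists_semigroup_of_dissipative_bijective (A : X →ₗ.[ℂ] X)
    (hdiss : ∀ x y, (x, y) ∈ A.graph → (inner ℂ x y).re ≤ 0)
    (hinj : ∀ x, (x, 0) ∈ A.graph → x = 0) (hsurj : ∀ y, ∃ x, (x, y) ∈ A.graph) :
    ∃ T : ℝ≥0 → X →L[ℂ] X, IsC0ContractionSemigroup T ∧ IsGenerator A T := by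
  choose f hf using hsurj
  have huniq : ∀ x x' y, (x, y) ∈ A.graph → (x', y) ∈ A.graph → x = x' := by
    intro x x' y h h'
    have := A.graph.sub_mem h h'
    rw [Prod.mk_sub_mk, sub_self] at this
    exact sub_eq_zero.1 (hinj _ this)
  let L : X →ₗ[ℂ] X :=
    { toFun := f
      map_add' := fun y z => huniq _ _ (y + z) (hf _) (A.graph.add_mem (hf y) (hf z))
      map_smul' := fun c y => huniq _ _ (c • y) (hf _) (A.graph.smul_mem c (hf y)) }
  -- The condition `Re ⟨x, y⟩ ≤ 0` on pairs of the graph is the same for an operator and for its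
  -- inverse.
  have hL : ∀ x, (inner ℂ (L x) x).re ≤ 0 := fun x => hdiss _ _ (hf x)
  let B : X →L[ℂ] X := ⟨L, continuous_of_dissipative L hL⟩
  have hBgraph : ∀ x y, (x, y) ∈ A.graph ↔ B y = x := fun x y =>
    ⟨fun h => huniq _ _ y (hf y) h, fun h => h ▸ hf y⟩
  -- Injectivity of `B` is the single-valuedness of `A`.
  obtain ⟨T, hT, hgen⟩ := exists_semigroup_of_dissipative_inverse B hL fun y hy =>
    A.graph_fst_eq_zero_snd ((hBgraph 0 y).2 hy) rfl
  exact ⟨T, hT, fun x y => (hBgraph x y).trans (hgen x y)⟩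

end Semigroup

/-! ### Multiplication operators on `L²` -/

section MulOp

variable {μ : Measure (Rn n)}

lemma memLp_mul_of_bound {m : Rn n → ℂ} (hm : AEStronglyMeasurable m μ) {C : ℝ}
    (hb : ∀ x, ‖m x‖ ≤ C) {f : Rn n → ℂ} (hf : MemLp f 2 μ) : MemLp (fun x => m x * f x) 2 μ :=
  hf.of_le_mul (c := C) (hm.mul hf.1) (Eventually.of_forall fun x => by
    rw [norm_mul]
    exact mul_le_mul_of_nonneg_right (hb x) (norm_nonneg _))

/-- Multiplication by a bounded function, as an operator on `L²`. -/
def mulOp (m : Rn n → ℂ) (hm : AEStronglyMeasurable m μ) (C : ℝ) (hb : ∀ x, ‖m x‖ ≤ C) :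
    Lp ℂ 2 μ →L[ℂ] Lp ℂ 2 μ :=
  LinearMap.mkContinuous
    { toFun := fun u => (memLp_mul_of_bound hm hb (Lp.memLp u)).toLp _
      map_add' := fun u v => by
        rw [← MemLp.toLp_add]
        refine MemLp.toLp_congr _ _ ?_
        filter_upwards [Lp.coeFn_add u v] with x hx
        rw [hx, Pi.add_apply, mul_add, Pi.add_apply]
      map_smul' := fun c u => by
        rw [RingHom.id_apply, ← MemLp.toLp_const_smul]
        refine MemLp.toLp_congr _ _ ?_
        filter_upwards [Lp.coeFn_smul c u] with x hx
        rw [hx, Pi.smul_apply, Pi.smul_apply, smul_eq_mul, smul_eq_mul]; ring }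
    C fun u => by
      refine Lp.norm_le_mul_norm_of_ae_le_mul ?_
      filter_upwards [MemLp.coeFn_toLp (memLp_mul_of_bound hm hb (Lp.memLp u))] with x hx
      change ‖(MemLp.toLp _ (memLp_mul_of_bound hm hb (Lp.memLp u)) : Rn n → ℂ) x‖ ≤ _
      rw [hx, norm_mul]
      exact mul_le_mul_of_nonneg_right (hb x) (norm_nonneg _)

lemma coeFn_mulOp (m : Rn n → ℂ) (hm : AEStronglyMeasurable m μ) (C : ℝ) (hb : ∀ x, ‖m x‖ ≤ C)
    (u : Lp ℂ 2 μ) : mulOp m hm C hb u =ᵐ[μ] fun x => m x * u x :=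
  MemLp.coeFn_toLp (memLp_mul_of_bound hm hb (Lp.memLp u))

lemma norm_mulOp_apply_le (m : Rn n → ℂ) (hm : AEStronglyMeasurable m μ) (C : ℝ)
    (hb : ∀ x, ‖m x‖ ≤ C) (u : Lp ℂ 2 μ) : ‖mulOp m hm C hb u‖ ≤ C * ‖u‖ := by
  have hC : 0 ≤ C := (norm_nonneg _).trans (hb 0)
  exact ContinuousLinearMap.le_of_opNorm_le _ (LinearMap.mkContinuous_norm_le _ hC _) u

end MulOp

/-! ### Continuously differentiable functions of compact support -/

/-- `φ` is of class `C¹` with compact support contained in `S`. -/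
structure IsTest (S : Set (Rn n)) (φ : Rn n → ℂ) : Prop where
  contDiff : ContDiff ℝ 1 φ
  compact : HasCompactSupport φ
  subset : tsupport φ ⊆ S

/-- The `e`-th standard unit vector. -/
abbrev unit (e : Fin n) : Rn n := EuclideanSpace.single e 1

lemma continuous_pd {f : Rn n → ℂ} (hf : ContDiff ℝ 1 f) (i : Fin n) : Continuous (pd i f) :=
  (hf.continuous_fderiv (by simp)).clm_apply continuous_const

lemma pd_add {f g : Rn n → ℂ} (hf : Differentiable ℝ f) (hg : Differentiable ℝ g) (i : Fin n) :
    pd i (fun x => f x + g x) = fun x => pd i f x + pd i g x := by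
  funext x
  simp only [pd]
  rw [fderiv_fun_add (hf x) (hg x)]; rfl

lemma pd_const_mul {f : Rn n → ℂ} (hf : Differentiable ℝ f) (c : ℂ) (i : Fin n) :
    pd i (fun x => c * f x) = fun x => c * pd i f x := by
  funext x
  simp only [pd]
  rw [fderiv_const_mul (hf x)]; rfl

lemma pd_mul {f g : Rn n → ℂ} (hf : Differentiable ℝ f) (hg : Differentiable ℝ g) (i : Fin n) :
    pd i (fun x => f x * g x) = fun x => f x * pd i g x + pd i f x * g x := by
  funext x
  simp only [pd]
  rw [fderiv_fun_mul (hf x) (hg x)]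
  simp only [add_apply, smul_apply, smul_eq_mul]; ring

lemma pd_eq_zero_of_notMem {f : Rn n → ℂ} {x : Rn n} (hx : x ∉ tsupport f) (i : Fin n) :
    pd i f x = 0 := by
  have := image_eq_zero_of_notMem_tsupport
    (fun h => hx ((tsupport_fderiv_subset ℝ (f := f)) h))
  simp only [pd, this]; rfl

namespace IsTest

variable {S S' : Set (Rn n)} {φ ψ : Rn n → ℂ}

lemma mono (h : IsTest S φ) (hS : S ⊆ S') : IsTest S' φ := ⟨h.1, h.2, h.3.trans hS⟩

lemma differentiable (h : IsTest S φ) : Differentiable ℝ φ := h.contDiff.differentiable (by simp)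

lemma zero : IsTest S (fun _ => 0) :=
  ⟨contDiff_const, HasCompactSupport.zero, by simp [tsupport, Function.support_fun_zero]⟩

lemma mul_left {a : Rn n → ℂ} (h : IsTest S φ) (ha : ContDiff ℝ 1 a) :
    IsTest S fun x => a x * φ x :=
  ⟨ha.mul h.1, h.2.mul_left, (tsupport_mul_subset_right (f := a)).trans h.3⟩

lemma const_mul (h : IsTest S φ) (c : ℂ) : IsTest S fun x => c * φ x := h.mul_left contDiff_const

lemma add (h : IsTest S φ) (k : IsTest S ψ) : IsTest S fun x => φ x + ψ x :=
  ⟨h.1.add k.1, h.2.add k.2, (tsupport_add φ ψ).trans (Set.union_subset h.3 k.3)⟩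

/-- Since `σ` is a left inverse of `τ`, the support of `φ ∘ τ` lies in the compact image of
`tsupport φ` under `σ`. -/
lemma comp {τ : Rn n → Rn n} (h : IsTest S φ) (hτ : ContDiff ℝ 1 τ) {σ : Rn n → Rn n}
    (hσ : Continuous σ) (hστ : ∀ x, σ (τ x) = x) (hS : ∀ x ∈ S, σ x ∈ S') :
    IsTest S' fun x => φ (τ x) := by
  have hsub : tsupport (fun x => φ (τ x)) ⊆ σ '' tsupport φ := by
    refine closure_minimal (fun x hx => ⟨τ x, subset_tsupport _ hx, hστ x⟩) ?_
    exact (h.2.isCompact.image hσ).isClosed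
  refine ⟨h.1.comp hτ, ?_, ?_⟩
  · exact (h.2.isCompact.image hσ).of_isClosed_subset (isClosed_tsupport _) hsub
  · rintro x hx
    obtain ⟨y, hy, rfl⟩ := hsub hx
    exact hS y (h.3 hy)

lemma conj (h : IsTest S φ) : IsTest S fun x => star (φ x) := by
  refine ⟨(Complex.conjCLE.contDiff.comp h.1), h.2.comp_left (g := star) (star_zero _), ?_⟩
  exact (closure_mono (Function.support_comp_subset (star_zero _) φ)).trans h.3

lemma continuous_pd (h : IsTest S φ) (i : Fin n) : Continuous (pd i φ) :=
  Plate.continuous_pd h.1 i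

lemma memLp (h : IsTest S φ) (μ : Measure (Rn n)) [IsFiniteMeasureOnCompacts μ] : MemLp φ 2 μ :=
  h.1.continuous.memLp_of_hasCompactSupport h.2

lemma memLp_pd (h : IsTest S φ) (μ : Measure (Rn n)) [IsFiniteMeasureOnCompacts μ] (i : Fin n) :
    MemLp (pd i φ) 2 μ :=
  (h.continuous_pd i).memLp_of_hasCompactSupport (hasCompactSupport_pd h.2 i)

lemma pd_conj (h : IsTest S φ) (i : Fin n) :
    pd i (fun x => star (φ x)) = fun x => star (pd i φ x) := by
  funext x
  simp only [pd]
  have := (Complex.conjCLE.toContinuousLinearMap.hasFDerivAt.comp x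
    (h.differentiable x).hasFDerivAt).fderiv
  change fderiv ℝ (Complex.conjCLE.toContinuousLinearMap ∘ φ) x _ = _
  rw [this]; rfl

end IsTest

/-! ### Closure of the test functions in `H¹(ℝⁿ)` -/

/-- The Hilbert space `L²(ℝⁿ)`. -/
abbrev FullL2 (n : ℕ) : Type := Lp ℂ 2 (volume : Measure (Rn n))

/-- The pairs `(φ, ∇φ)` with `φ` of class `C¹` with compact support in `S`. -/
def testPairs (S : Set (Rn n)) : Submodule ℂ (FullL2 n × (Fin n → FullL2 n)) where
  carrier := {z | ∃ φ, IsTest S φ ∧ z.1 =ᵐ[volume] φ ∧ ∀ i, z.2 i =ᵐ[volume] pd i φ}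
  add_mem' := by
    rintro z w ⟨φ, h, h1, h2⟩ ⟨ψ, k, h3, h4⟩
    refine ⟨_, h.add k, ?_, fun i => ?_⟩
    · filter_upwards [Lp.coeFn_add z.1 w.1, h1, h3] with x hx hx1 hx3
      rw [Prod.fst_add, hx, Pi.add_apply, hx1, hx3]
    · filter_upwards [Lp.coeFn_add (z.2 i) (w.2 i), h2 i, h4 i] with x hx hx1 hx3
      rw [Prod.snd_add, Pi.add_apply, hx, Pi.add_apply, hx1, hx3,
        pd_add h.differentiable k.differentiable]
  zero_mem' := by
    refine ⟨_, IsTest.zero, Lp.coeFn_zero _ _ _, fun i => ?_⟩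
    filter_upwards [Lp.coeFn_zero ℂ 2 (volume : Measure (Rn n))] with x hx
    change (0 : FullL2 n) x = fderiv ℝ (fun _ => (0 : ℂ)) x _
    rw [hx]; simp
  smul_mem' := by
    rintro c z ⟨φ, h, h1, h2⟩
    refine ⟨_, h.const_mul c, ?_, fun i => ?_⟩
    · filter_upwards [Lp.coeFn_smul c z.1, h1] with x hx hx1
      rw [Prod.smul_fst, hx, Pi.smul_apply, hx1, smul_eq_mul]
    · filter_upwards [Lp.coeFn_smul c (z.2 i), h2 i] with x hx hx1
      rw [Prod.smul_snd, Pi.smul_apply, hx, Pi.smul_apply, hx1, smul_eq_mul,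
        pd_const_mul h.differentiable]

/-- The closure of `C¹_c(S)` in `H¹(ℝⁿ)`, as pairs of a function and its gradient. -/
def testClosure (S : Set (Rn n)) : Submodule ℂ (FullL2 n × (Fin n → FullL2 n)) :=
  (testPairs S).topologicalClosure

/-- The class in `L²(ℝⁿ)` of a test function. -/
def IsTest.cls {S : Set (Rn n)} {φ : Rn n → ℂ} (h : IsTest S φ) : FullL2 n :=
  (h.memLp volume).toLp φ

/-- The class in `L²(ℝⁿ)` of a partial derivative of a test function. -/
def IsTest.clsPd {S : Set (Rn n)} {φ : Rn n → ℂ} (h : IsTest S φ) (i : Fin n) : FullL2 n :=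
  (h.memLp_pd volume i).toLp (pd i φ)

lemma IsTest.mem_testPairs {S : Set (Rn n)} {φ : Rn n → ℂ} (h : IsTest S φ) :
    (h.cls, h.clsPd) ∈ testPairs S :=
  ⟨φ, h, MemLp.coeFn_toLp (h.memLp volume), fun i => MemLp.coeFn_toLp (h.memLp_pd volume i)⟩

lemma exists_test_of_mem_testPairs {S : Set (Rn n)} {z : FullL2 n × (Fin n → FullL2 n)}
    (hz : z ∈ testPairs S) : ∃ φ, ∃ h : IsTest S φ, z = (h.cls, h.clsPd) := by
  obtain ⟨φ, h, h1, h2⟩ := hz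
  refine ⟨φ, h, Prod.ext ?_ (funext fun i => ?_)⟩
  · exact Lp.ext (h1.trans (MemLp.coeFn_toLp (h.memLp volume)).symm)
  · exact Lp.ext ((h2 i).trans (MemLp.coeFn_toLp (h.memLp_pd volume i)).symm)

/-- A closed condition on `testClosure S` can be checked on test functions. -/
lemma testClosure_induction {S : Set (Rn n)} {p : FullL2 n × (Fin n → FullL2 n) → Prop}
    (hp : IsClosed {z | p z}) (h : ∀ φ, ∀ h : IsTest S φ, p (h.cls, h.clsPd))
    {z : FullL2 n × (Fin n → FullL2 n)} (hz : z ∈ testClosure S) : p z := by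
  have : closure (testPairs S : Set (FullL2 n × (Fin n → FullL2 n))) ⊆ {z | p z} := by
    refine closure_minimal (fun z hz => ?_) hp
    obtain ⟨φ, hφ, rfl⟩ := exists_test_of_mem_testPairs hz
    exact h φ hφ
  exact this hz

/-- An `L²` bound for bounded functions supported in a compact set. -/
lemma norm_toLp_le_of_support {K : Set (Rn n)} (hK : IsCompact K) {f : Rn n → ℂ}
    (hf : MemLp f 2 volume) {δ : ℝ} (hb : ∀ x, ‖f x‖ ≤ δ) (hs : ∀ x ∉ K, f x = 0) :
    ‖hf.toLp f‖ ≤ (volume K ^ (2⁻¹ : ℝ)).toReal * δ := by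
  have hδ : 0 ≤ δ := (norm_nonneg _).trans (hb 0)
  have h1 : eLpNorm f 2 volume = eLpNorm f 2 (volume.restrict K) := by
    rw [← eLpNorm_indicator_eq_eLpNorm_restrict hK.measurableSet]
    congr 1
    funext x
    by_cases hx : x ∈ K
    · simp [hx]
    · simp [hx, hs x hx]
  have h2 : eLpNorm f 2 (volume.restrict K) ≤ volume K ^ (2⁻¹ : ℝ) * ENNReal.ofReal δ := by
    have := eLpNorm_le_of_ae_bound (p := 2) (μ := volume.restrict K) (f := f)
      (Eventually.of_forall hb)
    simpa using this
  rw [Lp.norm_toLp, h1]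
  refine (ENNReal.toReal_mono ?_ h2).trans_eq ?_
  · exact ENNReal.mul_ne_top (ENNReal.rpow_ne_top_of_nonneg (by norm_num) hK.measure_lt_top.ne)
      ENNReal.ofReal_ne_top
  · rw [ENNReal.toReal_mul, ENNReal.toReal_ofReal hδ]

/-! ### Shifts along a graph -/

/-- `γ` is the graph function of a hypersurface, extended to be constant in the direction `e`:
a `C²` function whose first derivative is bounded by `C` and `C`-Lipschitz. -/
structure IsProfile (e : Fin n) (γ : Rn n → ℝ) (C : ℝ) : Prop where
  contDiff : ContDiff ℝ 2 γ
  invariant : ∀ y (t : ℝ), γ (y + t • unit e) = γ y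
  bound : ∀ y, ‖fderiv ℝ γ y‖ ≤ C
  lipschitz : ∀ x y, ‖fderiv ℝ γ x - fderiv ℝ γ y‖ ≤ C * ‖x - y‖

/-- The shift by `v` along the graph of `γ`. -/
def shift (e : Fin n) (γ : Rn n → ℝ) (v y : Rn n) : Rn n := y + v + (γ (y + v) - γ y) • unit e

namespace IsProfile

variable {e : Fin n} {γ : Rn n → ℝ} {C : ℝ}

lemma zero (e : Fin n) : IsProfile e (fun _ => 0) 0 :=
  ⟨contDiff_const, fun _ _ => rfl, fun y => by simp, fun x y => by simp⟩

lemma nonneg (h : IsProfile e γ C) : 0 ≤ C := (norm_nonneg _).trans (h.bound 0)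

lemma differentiable (h : IsProfile e γ C) : Differentiable ℝ γ :=
  h.contDiff.differentiable (by simp)

lemma contDiff_fderiv (h : IsProfile e γ C) : ContDiff ℝ 1 (fderiv ℝ γ) :=
  h.contDiff.fderiv_right (by norm_num)

lemma fderiv_add_smul (h : IsProfile e γ C) (y : Rn n) (t : ℝ) :
    fderiv ℝ γ (y + t • unit e) = fderiv ℝ γ y := by
  have : (fun y => γ (y + t • unit e)) = γ := funext fun y => h.invariant y t
  rw [← fderiv_comp_add_right, this]

lemma fderiv_unit (h : IsProfile e γ C) (y : Rn n) : fderiv ℝ γ y (unit e) = 0 := by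
  have h1 : HasDerivAt (fun t : ℝ => y + t • unit e) (unit e) 0 := by
    simpa using ((hasDerivAt_id (0 : ℝ)).smul_const (unit e)).const_add y
  have h2 := (h.differentiable (y + (0 : ℝ) • unit e)).hasFDerivAt.comp_hasDerivAt 0 h1
  have h3 : (γ ∘ fun t : ℝ => y + t • unit e) = fun _ => γ y := funext fun t => h.invariant y t
  rw [h3] at h2
  simpa using h2.unique (hasDerivAt_const (0 : ℝ) (γ y))

lemma abs_sub_le (h : IsProfile e γ C) (x y : Rn n) : |γ x - γ y| ≤ C * ‖x - y‖ := by
  have := Convex.norm_image_sub_le_of_norm_fderiv_le (𝕜 := ℝ) (f := γ) (s := Set.univ)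
    (fun x _ => h.differentiable x) (fun x _ => h.bound x) convex_univ
    (Set.mem_univ y) (Set.mem_univ x)
  simpa using this

/-- `γ` does not see the corrections along `e`, so they telescope and the shifts form an additive
group. -/
lemma shift_shift (h : IsProfile e γ C) (v w y : Rn n) :
    shift e γ v (shift e γ w y) = shift e γ (v + w) y := by
  have h1 : γ (shift e γ w y) = γ (y + w) := h.invariant _ _
  have h2 : γ (shift e γ w y + v) = γ (y + w + v) := by
    have : shift e γ w y + v = (y + w + v) + (γ (y + w) - γ y) • unit e := by
      simp only [shift]; abel
    rw [this, h.invariant]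
  have h3 : shift e γ (v + w) y = y + w + v + (γ (y + w + v) - γ y) • unit e := by
    rw [shift, add_comm v w, ← add_assoc]
  rw [shift, h1, h2, h3, shift]
  module

lemma shift_zero (y : Rn n) : shift e γ 0 y = y := by simp [shift]

lemma shift_neg_shift (h : IsProfile e γ C) (v y : Rn n) :
    shift e γ (-v) (shift e γ v y) = y := by
  rw [h.shift_shift, neg_add_cancel, shift_zero]

lemma contDiff_shift (h : IsProfile e γ C) (v : Rn n) : ContDiff ℝ 2 (shift e γ v) := by
  have := h.contDiff
  unfold shift
  fun_prop

lemma norm_unit (e : Fin n) : ‖unit e‖ = 1 := by simp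

lemma norm_shift_sub_le (h : IsProfile e γ C) (v y : Rn n) :
    ‖shift e γ v y - y‖ ≤ (1 + C) * ‖v‖ := by
  have e1 : shift e γ v y - y = v + (γ (y + v) - γ y) • unit e := by
    simp only [shift]; abel
  rw [e1]
  refine (norm_add_le _ _).trans ?_
  rw [norm_smul, norm_unit, mul_one, Real.norm_eq_abs]
  have := h.abs_sub_le (y + v) y
  rw [add_sub_cancel_left] at this
  linarith

/-- Shears in the direction `e` preserve volume. -/
lemma measurePreserving_shear (h : IsProfile e γ C) :
    MeasurePreserving (fun y : Rn n => y + γ y • unit e) volume volume := by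
  have hinv : ∀ y, (y + γ y • unit e) - γ (y + γ y • unit e) • unit e = y := fun y => by
    rw [h.invariant]; abel
  have hinv' : ∀ y, (y - γ y • unit e) + γ (y - γ y • unit e) • unit e = y := fun y => by
    rw [sub_eq_add_neg, ← neg_smul, h.invariant]; module
  have hc : Continuous (fun y : Rn n => y + γ y • unit e) := by
    have := h.contDiff.continuous
    fun_prop
  have key := map_withDensity_abs_det_fderiv_eq_addHaar (volume : Measure (Rn n))
    (s := Set.univ) (f := fun y : Rn n => y + γ y • unit e)
    (f' := fun y => ContinuousLinearMap.id ℝ _ + (fderiv ℝ γ y).smulRight (unit e))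
    MeasurableSet.univ.nullMeasurableSet
    (fun y _ => ((hasFDerivAt_id y).add
      ((h.differentiable y).hasFDerivAt.smul_const (unit e))).hasFDerivWithinAt)
    (Function.LeftInverse.injective (g := fun y => y - γ y • unit e) hinv).injOn
  -- The derivative is a transvection because `∂ₑγ = 0`.
  have hdet : ∀ y, (ContinuousLinearMap.id ℝ (Rn n)
      + (fderiv ℝ γ y).smulRight (unit e)).det = 1 := by
    intro y
    have := LinearMap.transvection.det (fderiv ℝ γ y : Rn n →ₗ[ℝ] ℝ) (unit e)
    rw [ContinuousLinearMap.coe_coe, h.fderiv_unit, add_zero] at this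
    exact this
  simp only [hdet, abs_one, ENNReal.ofReal_one, Measure.restrict_univ] at key
  refine ⟨hc.measurable, ?_⟩
  have h1 : (fun y : Rn n => y + γ y • unit e) '' Set.univ = Set.univ := by
    rw [Set.image_univ]
    exact Set.range_eq_univ.2
      (Function.RightInverse.surjective (g := fun y => y - γ y • unit e) hinv')
  have h2 : (volume : Measure (Rn n)).withDensity (fun _ => 1) = volume := withDensity_one
  rwa [h1, h2, Measure.restrict_univ] at key

lemma neg (h : IsProfile e γ C) : IsProfile e (fun y => -γ y) C := by
  have hf : ∀ y, fderiv ℝ (fun y => -γ y) y = -fderiv ℝ γ y := fun y => fderiv_fun_neg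
  refine ⟨h.contDiff.neg, fun y t => by rw [h.invariant], fun y => ?_, fun x y => ?_⟩
  · rw [hf, norm_neg]; exact h.bound y
  · rw [hf, hf, neg_sub_neg, norm_sub_rev]; exact h.lipschitz x y

/-- A shift is the shear by `-γ`, which flattens the graph, then the translation by `v`, then the
shear by `γ`. -/
lemma measurePreserving_shift (h : IsProfile e γ C) (v : Rn n) :
    MeasurePreserving (shift e γ v) volume volume := by
  have h1 := (h.measurePreserving_shear.comp
    (measurePreserving_add_right volume v)).comp h.neg.measurePreserving_shear
  convert h1 using 1
  funext y
  have : γ (y + -γ y • unit e + v) = γ (y + v) := by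
    rw [add_right_comm, h.invariant]
  simp only [Function.comp_apply, this, shift]
  module

end IsProfile

/-- Bounded sequences in a Hilbert space have weak cluster points. -/
lemma exists_weak_limit {X : Type*} [NormedAddCommGroup X] [InnerProductSpace ℂ X]
    [CompleteSpace X] {g : ℕ → X} {M : ℝ} (hg : ∀ m, ‖g m‖ ≤ M) :
    ∃ G : X, ∀ (ψ : X) (l : ℂ), Tendsto (fun m => inner ℂ (g m) ψ) atTop (𝓝 l) →
      l = inner ℂ G ψ := by
  set f : ℕ → WeakDual ℂ X := fun m =>
    StrongDual.toWeakDual (InnerProductSpace.toDual ℂ X (g m)) with hf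
  -- Banach–Alaoglu gives a weak cluster point. No subsequence is needed: a convergent sequence of
  -- pairings can only converge to the pairing with that point.
  have hK := WeakDual.isCompact_closedBall (𝕜 := ℂ) (E := X) 0 M
  have hmem : ∀ m, f m ∈ WeakDual.toStrongDual ⁻¹' Metric.closedBall (0 : StrongDual ℂ X) M := by
    intro m
    change dist (InnerProductSpace.toDual ℂ X (g m)) 0 ≤ M
    rw [dist_zero_right, LinearIsometryEquiv.norm_map]
    exact hg m
  obtain ⟨ℓ, -, hℓ⟩ := hK.exists_mapClusterPt (f := atTop) (u := f)
    (tendsto_principal.2 (Eventually.of_forall hmem))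
  refine ⟨(InnerProductSpace.toDual ℂ X).symm (WeakDual.toStrongDual ℓ), fun ψ l hl => ?_⟩
  rw [InnerProductSpace.toDual_symm_apply]
  have h1 : MapClusterPt (ℓ ψ) atTop (fun m => f m ψ) :=
    hℓ.continuousAt_comp (f := fun z : WeakDual ℂ X => z ψ)
      (WeakDual.eval_continuous ψ).continuousAt
  have h2 : Tendsto (fun m => f m ψ) atTop (𝓝 l) := hl
  have h3 : (𝓝 (ℓ ψ) ⊓ 𝓝 l).NeBot := NeBot.mono h1 (inf_le_inf_left _ h2)
  exact (eq_of_nhds_neBot h3).symm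

/-- The derivative of `φ` along the tangential vector field `∂ₖ + ∂ₖγ ∂ₑ`. -/
def tang (e : Fin n) (γ : Rn n → ℝ) (k : Fin n) (φ : Rn n → ℂ) : Rn n → ℂ :=
  fun y => pd k φ y + ((fderiv ℝ γ y (unit k) : ℝ) : ℂ) * pd e φ y

/-! ### Shifts as isometries of L²(ℝⁿ) -/

namespace IsProfile

variable {e : Fin n} {γ : Rn n → ℝ} {C : ℝ}

lemma contDiff_pd (h : IsProfile e γ C) (k : Fin n) :
    ContDiff ℝ 1 fun y => ((fderiv ℝ γ y (unit k) : ℝ) : ℂ) :=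
  Complex.ofRealCLM.contDiff.comp (h.contDiff_fderiv.clm_apply contDiff_const)

lemma norm_pd_le (h : IsProfile e γ C) (k : Fin n) (y : Rn n) :
    ‖((fderiv ℝ γ y (unit k) : ℝ) : ℂ)‖ ≤ C := by
  rw [Complex.norm_real]
  refine ((fderiv ℝ γ y).le_opNorm _).trans ?_
  rw [norm_unit, mul_one]
  exact h.bound y

lemma norm_pd_sub_le (h : IsProfile e γ C) (k : Fin n) (v y : Rn n) :
    ‖((fderiv ℝ γ (y + v) (unit k) - fderiv ℝ γ y (unit k) : ℝ) : ℂ)‖ ≤ C * ‖v‖ := by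
  rw [Complex.norm_real, ← sub_apply]
  refine ((fderiv ℝ γ (y + v) - fderiv ℝ γ y).le_opNorm _).trans ?_
  rw [norm_unit, mul_one]
  simpa using h.lipschitz (y + v) y

/-- Composition with the shift by `v`, as an isometry of `L²(ℝⁿ)`. -/
def shiftOp (h : IsProfile e γ C) (v : Rn n) : FullL2 n →ₗᵢ[ℂ] FullL2 n :=
  Lp.compMeasurePreservingₗᵢ ℂ (shift e γ v) (h.measurePreserving_shift v)

lemma coeFn_shiftOp (h : IsProfile e γ C) (v : Rn n) (U : FullL2 n) :
    h.shiftOp v U =ᵐ[volume] fun y => U (shift e γ v y) :=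
  Lp.coeFn_compMeasurePreserving U (h.measurePreserving_shift v)

lemma shiftOp_shiftOp (h : IsProfile e γ C) (v w : Rn n) (U : FullL2 n) :
    h.shiftOp v (h.shiftOp w U) = h.shiftOp (v + w) U := by
  refine Lp.ext ?_
  have h1 := (h.measurePreserving_shift v).quasiMeasurePreserving.ae_eq_comp (h.coeFn_shiftOp w U)
  filter_upwards [h.coeFn_shiftOp v (h.shiftOp w U), h.coeFn_shiftOp (v + w) U, h1] with y h2 h3 h4
  simp only [Function.comp_apply] at h4
  rw [h2, h3, h4, h.shift_shift, add_comm]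

lemma shiftOp_zero (h : IsProfile e γ C) (U : FullL2 n) : h.shiftOp 0 U = U := by
  refine Lp.ext ?_
  filter_upwards [h.coeFn_shiftOp 0 U] with y h2
  rw [h2, shift_zero]

/-- Discrete integration by parts: the shift by `-v` is both inverse and adjoint of the isometry. -/
lemma inner_shiftOp_left (h : IsProfile e γ C) (v : Rn n) (U V : FullL2 n) :
    inner ℂ (h.shiftOp v U) V = inner ℂ U (h.shiftOp (-v) V) := by
  have : V = h.shiftOp v (h.shiftOp (-v) V) := by
    rw [h.shiftOp_shiftOp, add_neg_cancel, h.shiftOp_zero]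
  conv_lhs => rw [this]
  exact (h.shiftOp v).inner_map_map _ _

/-- The correction term in the gradient of a shifted function. -/
def gradCorr (h : IsProfile e γ C) (v : Rn n) (j : Fin n) : FullL2 n →L[ℂ] FullL2 n :=
  mulOp (fun y => ((fderiv ℝ γ (y + v) (unit j) - fderiv ℝ γ y (unit j) : ℝ) : ℂ))
    (by
      have : Continuous (fderiv ℝ γ) := h.contDiff_fderiv.continuous
      exact Continuous.aestronglyMeasurable (by fun_prop))
    (C * ‖v‖) (h.norm_pd_sub_le j v)

/-- The gradient of a shifted function in terms of its gradient. -/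
def shiftGrad (h : IsProfile e γ C) (v : Rn n) (P : Fin n → FullL2 n) (j : Fin n) : FullL2 n :=
  h.shiftOp v (P j) + h.gradCorr v j (h.shiftOp v (P e))

lemma norm_gradCorr_le (h : IsProfile e γ C) (v : Rn n) (j : Fin n) (U : FullL2 n) :
    ‖h.gradCorr v j U‖ ≤ C * ‖v‖ * ‖U‖ := norm_mulOp_apply_le _ _ _ _ U

lemma hasFDerivAt_shift (h : IsProfile e γ C) (v y : Rn n) :
    HasFDerivAt (shift e γ v) (ContinuousLinearMap.id ℝ (Rn n)
      + (fderiv ℝ γ (y + v) - fderiv ℝ γ y).smulRight (unit e)) y := by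
  have h1 : HasFDerivAt (fun y => γ (y + v)) (fderiv ℝ γ (y + v)) y :=
    (h.differentiable (y + v)).hasFDerivAt.comp y ((hasFDerivAt_id y).add_const v)
  exact ((hasFDerivAt_id y).add_const v).add
    ((h1.sub (h.differentiable y).hasFDerivAt).smul_const (unit e))

/-- The coefficient of the extra `∂ₑ` term is `O(‖v‖)`, as `fderiv ℝ γ` is Lipschitz, so it stays
bounded in difference quotients. -/
lemma pd_comp_shift (h : IsProfile e γ C) (v : Rn n) {φ : Rn n → ℂ} (hφ : Differentiable ℝ φ)
    (j : Fin n) (y : Rn n) :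
    pd j (fun y => φ (shift e γ v y)) y = pd j φ (shift e γ v y)
      + ((fderiv ℝ γ (y + v) (unit j) - fderiv ℝ γ y (unit j) : ℝ) : ℂ)
        * pd e φ (shift e γ v y) := by
  have h1 := ((hφ (shift e γ v y)).hasFDerivAt.comp y (h.hasFDerivAt_shift v y)).fderiv
  simp only [pd]
  change fderiv ℝ (φ ∘ shift e γ v) y _ = _
  rw [h1]
  simp only [ContinuousLinearMap.comp_apply, add_apply, ContinuousLinearMap.id_apply,
    ContinuousLinearMap.smulRight_apply, map_add, map_smul, sub_apply, Complex.real_smul]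

/-- The support of `φ ∘ shift e γ v` is that of `φ` moved by `-v`, whence the sign in `hS`. -/
lemma shift_mem_testClosure (h : IsProfile e γ C) (v : Rn n) {S S' : Set (Rn n)}
    (hS : ∀ x ∈ S, shift e γ (-v) x ∈ S') {z : FullL2 n × (Fin n → FullL2 n)}
    (hz : z ∈ testClosure S) : (h.shiftOp v z.1, h.shiftGrad v z.2) ∈ testClosure S' := by
  refine testClosure_induction (p := fun z => (h.shiftOp v z.1, h.shiftGrad v z.2) ∈ testClosure S')
    ?_ ?_ hz
  · refine IsClosed.preimage (f := fun z : FullL2 n × (Fin n → FullL2 n) =>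
      (h.shiftOp v z.1, h.shiftGrad v z.2)) ?_ (testPairs S').isClosed_topologicalClosure
    refine ((h.shiftOp v).continuous.comp continuous_fst).prodMk (continuous_pi fun j => ?_)
    unfold shiftGrad
    have := (h.shiftOp v).continuous
    fun_prop
  · intro φ hφ
    refine (testPairs S').le_topologicalClosure
      ⟨_, hφ.comp ((h.contDiff_shift v).of_le (by norm_num))
      (h.contDiff_shift (-v)).continuous (h.shift_neg_shift v) hS, ?_, fun j => ?_⟩
    · exact (h.coeFn_shiftOp v hφ.cls).trans
        ((h.measurePreserving_shift v).quasiMeasurePreserving.ae_eq_comp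
          (MemLp.coeFn_toLp (hφ.memLp volume)))
    · have h1 := fun i => (h.coeFn_shiftOp v (hφ.clsPd i)).trans
        ((h.measurePreserving_shift v).quasiMeasurePreserving.ae_eq_comp
          (MemLp.coeFn_toLp (hφ.memLp_pd volume i)))
      filter_upwards [Lp.coeFn_add (h.shiftOp v (hφ.clsPd j))
        (h.gradCorr v j (h.shiftOp v (hφ.clsPd e))), h1 j, h1 e,
        coeFn_mulOp (fun y => ((fderiv ℝ γ (y + v) (unit j) - fderiv ℝ γ y (unit j) : ℝ) : ℂ))
          (by
            have : Continuous (fderiv ℝ γ) := h.contDiff_fderiv.continuous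
            exact Continuous.aestronglyMeasurable (by fun_prop))
          (C * ‖v‖) (h.norm_pd_sub_le j v) (h.shiftOp v (hφ.clsPd e))] with y e1 e2 e3 e4
      change (h.shiftOp v (hφ.clsPd j) + h.gradCorr v j (h.shiftOp v (hφ.clsPd e)) : FullL2 n) y = _
      rw [e1, Pi.add_apply, e2, h.pd_comp_shift v hφ.differentiable]
      congr 1
      refine e4.trans ?_
      simp only [e3, Function.comp_apply]

/-! ### Tangential derivatives -/

lemma continuous_tang (h : IsProfile e γ C) {S : Set (Rn n)} {φ : Rn n → ℂ} (hφ : IsTest S φ)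
    (k : Fin n) : Continuous (tang e γ k φ) :=
  (hφ.continuous_pd k).add ((h.contDiff_pd k).continuous.mul (hφ.continuous_pd e))

lemma tang_eq_zero {φ : Rn n → ℂ} {y : Rn n} (hy : y ∉ tsupport φ) (k : Fin n) :
    tang e γ k φ y = 0 := by
  simp [tang, pd_eq_zero_of_notMem hy]

lemma hasCompactSupport_tang {S : Set (Rn n)} {φ : Rn n → ℂ} (hφ : IsTest S φ)
    (k : Fin n) : HasCompactSupport (tang e γ k φ) :=
  HasCompactSupport.intro hφ.compact.isCompact fun _ hy => tang_eq_zero hy k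

lemma memLp_tang (h : IsProfile e γ C) {S : Set (Rn n)} {φ : Rn n → ℂ} (hφ : IsTest S φ)
    (k : Fin n) : MemLp (tang e γ k φ) 2 volume :=
  (h.continuous_tang hφ k).memLp_of_hasCompactSupport (hasCompactSupport_tang hφ k)

/-- The velocity contains `∂ₖγ` at `y + s • unit k`. The shifted point differs from it by a multiple
of `unit e`, along which `∂ₖγ` is constant, so the derivative is `tang` at the shifted point. -/
lemma hasDerivAt_comp_shift (h : IsProfile e γ C) {φ : Rn n → ℂ} (hφ : Differentiable ℝ φ)
    (k : Fin n) (y : Rn n) (s : ℝ) :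
    HasDerivAt (fun s : ℝ => φ (shift e γ (s • unit k) y))
      (tang e γ k φ (shift e γ (s • unit k) y)) s := by
  have h1 : HasDerivAt (fun s : ℝ => y + s • unit k) (unit k) s := by
    simpa using ((hasDerivAt_id s).smul_const (unit k)).const_add y
  have h2 := (h.differentiable (y + s • unit k)).hasFDerivAt.comp_hasDerivAt s h1
  have h3 : HasDerivAt (fun s : ℝ => shift e γ (s • unit k) y)
      (unit k + (fderiv ℝ γ (y + s • unit k) (unit k)) • unit e) s :=
    h1.add ((h2.sub_const (γ y)).smul_const (unit e))
  have h4 := (hφ (shift e γ (s • unit k) y)).hasFDerivAt.comp_hasDerivAt s h3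
  refine h4.congr_deriv ?_
  have h5 : fderiv ℝ γ (shift e γ (s • unit k) y) = fderiv ℝ γ (y + s • unit k) :=
    h.fderiv_add_smul _ _
  rw [tang, h5, map_add, map_smul, Complex.real_smul]
  rfl

/-- The quotients converge uniformly, by the mean value inequality and the uniform continuity of
`tang e γ k φ`, and for `|s| ≤ 1` they vanish off a fixed compact set; hence they converge in `L²`.
-/
lemma tendsto_diffQuot (h : IsProfile e γ C) {S : Set (Rn n)} {φ : Rn n → ℂ} (hφ : IsTest S φ)
    (k : Fin n) :
    Tendsto (fun s : ℝ => ((s⁻¹ : ℝ) : ℂ) • (h.shiftOp (s • unit k) hφ.cls - hφ.cls)) (𝓝[≠] 0)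
      (𝓝 ((h.memLp_tang hφ k).toLp _)) := by
  have hC := h.nonneg
  -- A shift of length at most `1` moves points by at most `1 + C`.
  set K := Metric.cthickening (1 + C) (tsupport φ) with hK
  have hKc : IsCompact K := hφ.compact.isCompact.cthickening
  set c := (volume K ^ (2⁻¹ : ℝ)).toReal with hc
  have hc0 : 0 ≤ c := ENNReal.toReal_nonneg
  rw [Metric.tendsto_nhdsWithin_nhds]
  intro ε hε
  obtain ⟨δ, hδ, hδ'⟩ := Metric.uniformContinuous_iff.1
    ((hasCompactSupport_tang hφ k).uniformContinuous_of_continuous (h.continuous_tang hφ k))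
    (ε / (2 * (c + 1))) (by positivity)
  refine ⟨min 1 (δ / (1 + C)), by positivity, fun {s} hs hsd => ?_⟩
  have hs0 : s ≠ 0 := hs
  rw [dist_zero_right, Real.norm_eq_abs, lt_min_iff, lt_div_iff₀ (by positivity)] at hsd
  have hns : ∀ r : ℝ, ‖r • unit k‖ = |r| := fun r => by
    rw [norm_smul, norm_unit, mul_one, Real.norm_eq_abs]
  have hmv : ∀ y, ‖φ (shift e γ (s • unit k) y) - φ y - s * tang e γ k φ y‖
      ≤ ε / (2 * (c + 1)) * |s| := by
    intro y
    have key := Convex.norm_image_sub_le_of_norm_hasDerivWithin_le (𝕜 := ℝ)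
      (f := fun r : ℝ => φ (shift e γ (r • unit k) y) - r • tang e γ k φ y)
      (f' := fun r : ℝ => tang e γ k φ (shift e γ (r • unit k) y) - tang e γ k φ y)
      (s := Set.Icc (-|s|) |s|) (x := 0) (y := s) (C := ε / (2 * (c + 1)))
      (fun r _ => by
        have := (h.hasDerivAt_comp_shift hφ.differentiable k y r).fun_sub
          ((hasDerivAt_id' r).smul_const (tang e γ k φ y))
        rw [one_smul] at this
        exact this.hasDerivWithinAt)
      (fun r hr => by
        rw [← dist_eq_norm]
        refine (hδ' ?_).le
        rw [dist_eq_norm]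
        refine (h.norm_shift_sub_le _ y).trans_lt ?_
        rw [hns]
        have : |r| ≤ |s| := abs_le.2 hr
        nlinarith)
      (convex_Icc _ _) (by simp) (abs_le.1 le_rfl)
    simp only [zero_smul, shift_zero, sub_zero, Complex.real_smul, Real.norm_eq_abs] at key
    rw [sub_right_comm]
    exact key
  have hmem : MemLp (fun y => ((s⁻¹ : ℝ) : ℂ) * (φ (shift e γ (s • unit k) y) - φ y)
      - tang e γ k φ y) 2 volume :=
    (((((hφ.memLp volume).comp_measurePreserving (h.measurePreserving_shift _)).sub
      (hφ.memLp volume)).const_mul _).sub (h.memLp_tang hφ k))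
  have heq : ((s⁻¹ : ℝ) : ℂ) • (h.shiftOp (s • unit k) hφ.cls - hφ.cls)
      - (h.memLp_tang hφ k).toLp _ = hmem.toLp _ := by
    refine Lp.ext ?_
    have h1 := (h.coeFn_shiftOp (s • unit k) hφ.cls).trans
        ((h.measurePreserving_shift (s • unit k)).quasiMeasurePreserving.ae_eq_comp
          (MemLp.coeFn_toLp (hφ.memLp volume)))
    filter_upwards [Lp.coeFn_sub (((s⁻¹ : ℝ) : ℂ) • (h.shiftOp (s • unit k) hφ.cls - hφ.cls))
      ((h.memLp_tang hφ k).toLp _), Lp.coeFn_smul ((s⁻¹ : ℝ) : ℂ)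
      (h.shiftOp (s • unit k) hφ.cls - hφ.cls), Lp.coeFn_sub (h.shiftOp (s • unit k) hφ.cls) hφ.cls,
      h1, MemLp.coeFn_toLp (hφ.memLp volume), MemLp.coeFn_toLp (h.memLp_tang hφ k),
      MemLp.coeFn_toLp hmem] with y e1 e2 e3 e4 e5 e6 e7
    have e5' : (hφ.cls : FullL2 n) y = φ y := e5
    rw [e1, Pi.sub_apply, e2, Pi.smul_apply, e3, Pi.sub_apply, e4, e5', e6, e7]
    simp
  rw [dist_eq_norm, heq]
  have hb : ∀ y, ‖((s⁻¹ : ℝ) : ℂ) * (φ (shift e γ (s • unit k) y) - φ y) - tang e γ k φ y‖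
      ≤ ε / (2 * (c + 1)) := by
    intro y
    have e1 : ((s⁻¹ : ℝ) : ℂ) * (φ (shift e γ (s • unit k) y) - φ y) - tang e γ k φ y
        = ((s⁻¹ : ℝ) : ℂ) * (φ (shift e γ (s • unit k) y) - φ y - s * tang e γ k φ y) := by
      have : (s : ℂ) ≠ 0 := by exact_mod_cast hs0
      push_cast
      field_simp
    rw [e1, norm_mul, Complex.norm_real, norm_inv, Real.norm_eq_abs,
      inv_mul_le_iff₀ (abs_pos.2 hs0), mul_comm |s|]
    exact hmv y
  have hsupp : ∀ y ∉ K, ((s⁻¹ : ℝ) : ℂ) * (φ (shift e γ (s • unit k) y) - φ y)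
      - tang e γ k φ y = 0 := by
    intro y hy
    have h1 : y ∉ tsupport φ := fun h' => hy (Metric.self_subset_cthickening _ h')
    have h2 : shift e γ (s • unit k) y ∉ tsupport φ := by
      intro h'
      refine hy (Metric.mem_cthickening_of_dist_le _ _ _ _ h' ?_)
      rw [dist_comm, dist_eq_norm]
      refine (h.norm_shift_sub_le _ y).trans ?_
      rw [hns]
      nlinarith [hsd.1]
    rw [tang_eq_zero h1, image_eq_zero_of_notMem_tsupport h1, image_eq_zero_of_notMem_tsupport h2]
    simp
  refine (norm_toLp_le_of_support hKc hmem hb hsupp).trans_lt ?_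
  rw [← hc, ← mul_div_assoc, div_lt_iff₀ (by positivity)]
  nlinarith

/-- The shifts in direction `k` form a one-parameter group of isometries, so the orbit of `φ` has a
derivative of constant norm. -/
lemma norm_shiftOp_cls_sub_le (h : IsProfile e γ C) {S : Set (Rn n)} {φ : Rn n → ℂ}
    (hφ : IsTest S φ) (k : Fin n) (s : ℝ) :
    ‖h.shiftOp (s • unit k) hφ.cls - hφ.cls‖ ≤ ‖(h.memLp_tang hφ k).toLp _‖ * |s| := by
  set X := (h.memLp_tang hφ k).toLp _ with hX
  have hd : ∀ r : ℝ, HasDerivAt (fun r : ℝ => h.shiftOp (r • unit k) hφ.cls)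
      (h.shiftOp (r • unit k) X) r := by
    intro r
    rw [hasDerivAt_iff_tendsto_slope_zero]
    refine (((h.shiftOp (r • unit k)).continuous.tendsto _).comp (h.tendsto_diffQuot hφ k)).congr
      fun t => ?_
    rw [Function.comp_apply, map_smul, map_sub, h.shiftOp_shiftOp, ← add_smul]
    rfl
  have := Convex.norm_image_sub_le_of_norm_hasDerivWithin_le (𝕜 := ℝ) (s := Set.univ) (x := 0)
    (y := s) (C := ‖X‖) (fun r _ => (hd r).hasDerivWithinAt)
    (fun r _ => ((h.shiftOp (r • unit k)).norm_map X).le) convex_univ (Set.mem_univ _)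
    (Set.mem_univ _)
  simpa [h.shiftOp_zero] using this

lemma norm_toLp_tang_le (h : IsProfile e γ C) {S : Set (Rn n)} {φ : Rn n → ℂ}
    (hφ : IsTest S φ) (k : Fin n) :
    ‖(h.memLp_tang hφ k).toLp _‖ ≤ ‖hφ.clsPd k‖ + C * ‖hφ.clsPd e‖ := by
  have hm : AEStronglyMeasurable (fun y => ((fderiv ℝ γ y (unit k) : ℝ) : ℂ)) volume :=
    (h.contDiff_pd k).continuous.aestronglyMeasurable
  have h1 : (h.memLp_tang hφ k).toLp _
      = hφ.clsPd k + mulOp _ hm C (h.norm_pd_le k) (hφ.clsPd e) := by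
    refine Lp.ext ?_
    filter_upwards [MemLp.coeFn_toLp (h.memLp_tang hφ k), MemLp.coeFn_toLp (hφ.memLp_pd volume k),
      MemLp.coeFn_toLp (hφ.memLp_pd volume e), coeFn_mulOp _ hm C (h.norm_pd_le k) (hφ.clsPd e),
      Lp.coeFn_add (hφ.clsPd k) (mulOp _ hm C (h.norm_pd_le k) (hφ.clsPd e))] with y e1 e2 e3 e4 e5
    rw [e1, e5, Pi.add_apply, e4]
    change _ = hφ.clsPd k y + _ * hφ.clsPd e y
    have e2' : hφ.clsPd k y = pd k φ y := e2
    have e3' : hφ.clsPd e y = pd e φ y := e3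
    rw [e2', e3', tang]
  rw [h1]
  exact (norm_add_le _ _).trans (by gcongr; exact norm_mulOp_apply_le _ _ _ _ _)

/-- The `L²` modulus of continuity along shifts is controlled by the gradient. -/
lemma norm_shiftOp_sub_le (h : IsProfile e γ C) {S : Set (Rn n)}
    {z : FullL2 n × (Fin n → FullL2 n)} (hz : z ∈ testClosure S) (k : Fin n) (s : ℝ) :
    ‖h.shiftOp (s • unit k) z.1 - z.1‖ ≤ (‖z.2 k‖ + C * ‖z.2 e‖) * |s| := by
  refine testClosure_induction (p := fun z => ‖h.shiftOp (s • unit k) z.1 - z.1‖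
    ≤ (‖z.2 k‖ + C * ‖z.2 e‖) * |s|) ?_ ?_ hz
  · have := (h.shiftOp (s • unit k)).continuous
    exact isClosed_le (by fun_prop) (by fun_prop)
  · intro φ hφ
    exact (h.norm_shiftOp_cls_sub_le hφ k s).trans
      (mul_le_mul_of_nonneg_right (h.norm_toLp_tang_le hφ k) (abs_nonneg s))

/-! ### Nirenberg's difference quotient estimate -/

/-- Difference quotients of the gradient of a weak solution are bounded. -/
lemma norm_diffQuot_le (h : IsProfile e γ C) {S₁ S₂ S : Set (Rn n)} (h₁₂ : S₁ ⊆ S₂) (h₂ : S₂ ⊆ S)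
    {U F : FullL2 n} {P : Fin n → FullL2 n} (hU : (U, P) ∈ testClosure S₁)
    (hweak : ∀ z ∈ testClosure S, ∑ j, inner ℂ (z.2 j) (P j) = inner ℂ z.1 F) (k : Fin n) {s : ℝ}
    (hs : s ≠ 0) (hs₁ : ∀ x ∈ S₁, shift e γ (-(s • unit k)) x ∈ S₂)
    (hs₂ : ∀ x ∈ S₂, shift e γ (s • unit k) x ∈ S) (j : Fin n) :
    ‖((s⁻¹ : ℝ) : ℂ) • (h.shiftOp (s • unit k) (P j) - P j)‖
      ≤ 2 * n * C * (∑ i, ‖P i‖) + (1 + C) * ‖F‖ + C * ∑ i, ‖P i‖ := by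
  have hC := h.nonneg
  set v := s • unit k with hv
  set c : ℂ := ((s⁻¹ : ℝ) : ℂ) with hc
  have hnc : ‖c‖ * |s| = 1 := by
    rw [hc, Complex.norm_real, norm_inv, Real.norm_eq_abs, inv_mul_cancel₀ (abs_pos.2 hs).ne']
  have hnv : ‖v‖ = |s| := by rw [hv, norm_smul, norm_unit, mul_one, Real.norm_eq_abs]
  -- `N` arises because shifts do not commute with the gradient; it is bounded by `C‖P e‖`. With it,
  -- `Q` is the gradient of the quotient `DU`.
  set N : Fin n → FullL2 n := fun j => c • h.gradCorr v j (h.shiftOp v (P e)) with hN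
  set DU : FullL2 n := c • (h.shiftOp v U - U) with hDU
  set Q : Fin n → FullL2 n := fun j => c • (h.shiftOp v (P j) - P j) + N j with hQ
  have hDUmem : (DU, Q) ∈ testClosure S₂ := by
    have h1 := h.shift_mem_testClosure v hs₁ hU
    have h2 : (U, P) ∈ testClosure S₂ := by
      refine testClosure_induction (testPairs S₂).isClosed_topologicalClosure (fun φ hφ => ?_) hU
      exact (testPairs S₂).le_topologicalClosure (hφ.mono h₁₂).mem_testPairs
    have h3 := Submodule.smul_mem _ c (Submodule.sub_mem _ h1 h2)
    have e1 : (DU, Q) = c • ((h.shiftOp v U, h.shiftGrad v P) - (U, P)) := by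
      refine Prod.ext rfl (funext fun j => ?_)
      change _ = c • (h.shiftGrad v P j - P j)
      simp only [hQ, hN, shiftGrad]
      module
    rw [e1]
    exact h3
  set N' : Fin n → FullL2 n := fun j => c • h.gradCorr (-v) j (h.shiftOp (-v) (Q e)) with hN'
  -- The test function is a second difference of `U`, obtained by shifting `DU` back; `S₁ ⊆ S₂ ⊆ S`
  -- leave room for the two shifts.
  set V : FullL2 n := c • (h.shiftOp (-v) DU - DU) with hV
  set R : Fin n → FullL2 n := fun j => c • (h.shiftOp (-v) (Q j) - Q j) + N' j with hR
  have hVmem : (V, R) ∈ testClosure S := by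
    have h1 := h.shift_mem_testClosure (-v) (S' := S) (by simpa using hs₂) hDUmem
    have h2 : (DU, Q) ∈ testClosure S := by
      refine testClosure_induction (testPairs S).isClosed_topologicalClosure (fun φ hφ => ?_) hDUmem
      exact (testPairs S).le_topologicalClosure (hφ.mono h₂).mem_testPairs
    have h3 := Submodule.smul_mem _ c (Submodule.sub_mem _ h1 h2)
    have e1 : (V, R) = c • ((h.shiftOp (-v) DU, h.shiftGrad (-v) Q) - (DU, Q)) := by
      refine Prod.ext rfl (funext fun j => ?_)
      change _ = c • (h.shiftGrad (-v) Q j - Q j)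
      simp only [hR, hN', shiftGrad]
      module
    rw [e1]
    exact h3
  have hcorr : ∀ w : Rn n, ‖w‖ = |s| → ∀ j (Z : FullL2 n),
      ‖c • h.gradCorr w j (h.shiftOp w Z)‖ ≤ C * ‖Z‖ := by
    intro w hw j Z
    have h1 := h.norm_gradCorr_le w j (h.shiftOp w Z)
    rw [LinearIsometry.norm_map, hw] at h1
    rw [norm_smul]
    calc ‖c‖ * ‖h.gradCorr w j (h.shiftOp w Z)‖ ≤ ‖c‖ * (C * |s| * ‖Z‖) := by gcongr
      _ = (‖c‖ * |s|) * (C * ‖Z‖) := by ring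
      _ = C * ‖Z‖ := by rw [hnc, one_mul]
  set p := ∑ i, ‖P i‖ with hp
  have hPp : ∀ i, ‖P i‖ ≤ p := fun i =>
    Finset.single_le_sum (f := fun i => ‖P i‖) (fun _ _ => norm_nonneg _) (Finset.mem_univ i)
  have hNb : ∀ j, ‖N j‖ ≤ C * p := fun j =>
    (hcorr v hnv j (P e)).trans (mul_le_mul_of_nonneg_left (hPp e) hC)
  have hN'b : ∀ j, ‖N' j‖ ≤ C * ‖Q e‖ := fun j => hcorr (-v) (by rw [norm_neg, hnv]) j (Q e)
  have hVb : ‖V‖ ≤ ‖Q k‖ + C * ‖Q e‖ := by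
    have h1 := h.norm_shiftOp_sub_le hDUmem k (-s)
    rw [neg_smul, abs_neg] at h1
    rw [hV, norm_smul]
    calc ‖c‖ * ‖h.shiftOp (-v) DU - DU‖ ≤ ‖c‖ * ((‖Q k‖ + C * ‖Q e‖) * |s|) := by gcongr
      _ = (‖c‖ * |s|) * (‖Q k‖ + C * ‖Q e‖) := by ring
      _ = _ := by rw [hnc, one_mul]
  -- Moving the backward difference from the test gradient onto `P` turns the weak equation into an
  -- identity for `∑ ‖Q j‖²` with two correction terms.
  have hid : ∑ j, inner ℂ (Q j) (Q j)
      = ∑ j, inner ℂ (Q j) (N j) - ∑ j, inner ℂ (N' j) (P j) + inner ℂ V F := by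
    rw [← hweak _ hVmem]
    change _ = _ - _ + ∑ j, inner ℂ (R j) (P j)
    rw [← Finset.sum_sub_distrib, ← Finset.sum_add_distrib]
    refine Finset.sum_congr rfl fun j _ => ?_
    have h1 : inner ℂ (c • (h.shiftOp (-v) (Q j) - Q j)) (P j) = inner ℂ (Q j) (Q j - N j) := by
      have h2 : Q j - N j = c • (h.shiftOp v (P j) - P j) := by simp only [hQ]; abel
      rw [h2, inner_smul_left, inner_smul_right, inner_sub_left, inner_sub_right,
        h.inner_shiftOp_left, neg_neg, hc, Complex.conj_ofReal]
    have h3 : inner ℂ (R j) (P j) = inner ℂ (Q j) (Q j) - inner ℂ (Q j) (N j)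
        + inner ℂ (N' j) (P j) := by
      simp only [hR]
      rw [inner_add_left, h1, inner_sub_right]
    rw [h3]; ring
  set q := Real.sqrt (∑ j, ‖Q j‖ ^ 2) with hq
  have hq2 : q ^ 2 = ∑ j, ‖Q j‖ ^ 2 := Real.sq_sqrt (Finset.sum_nonneg fun _ _ => sq_nonneg _)
  have hq0 : 0 ≤ q := Real.sqrt_nonneg _
  have hQq : ∀ j, ‖Q j‖ ≤ q := fun j => by
    refine Real.le_sqrt_of_sq_le ?_
    exact Finset.single_le_sum (f := fun i => ‖Q i‖ ^ 2) (fun _ _ => sq_nonneg _)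
      (Finset.mem_univ j)
  have hp0 : 0 ≤ p := Finset.sum_nonneg fun _ _ => norm_nonneg _
  -- Each term on the right is at most linear in `q`, since `N'` and `V` are controlled by `Q`.
  -- Dividing by `q` leaves a bound independent of `s`.
  have hmain : q ^ 2 ≤ q * (2 * n * C * p + (1 + C) * ‖F‖) := by
    have e1 : ((q ^ 2 : ℝ) : ℂ) = ∑ j, inner ℂ (Q j) (Q j) := by
      rw [hq2, Complex.ofReal_sum]
      refine Finset.sum_congr rfl fun j _ => ?_
      rw [inner_self_eq_norm_sq_to_K]; push_cast; rfl
    have e2 : q ^ 2 = ‖∑ j, inner ℂ (Q j) (Q j)‖ := by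
      rw [← e1, Complex.norm_real, Real.norm_of_nonneg (sq_nonneg q)]
    rw [e2, hid]
    have b1 : ‖∑ j, inner ℂ (Q j) (N j)‖ ≤ n * (q * (C * p)) := by
      refine (norm_sum_le _ _).trans
        ((Finset.sum_le_card_nsmul _ _ (q * (C * p)) fun j _ => ?_).trans (by simp))
      exact (norm_inner_le_norm _ _).trans
        (mul_le_mul (hQq j) (hNb j) (norm_nonneg _) hq0)
    have b2 : ‖∑ j, inner ℂ (N' j) (P j)‖ ≤ n * (C * q * p) := by
      refine (norm_sum_le _ _).trans ((Finset.sum_le_card_nsmul _ _ (C * q * p) fun j _ => ?_).trans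
        (by simp))
      exact (norm_inner_le_norm _ _).trans
        (mul_le_mul ((hN'b j).trans (mul_le_mul_of_nonneg_left (hQq e) hC)) (hPp j)
          (norm_nonneg _) (by positivity))
    have b3 : ‖inner ℂ V F‖ ≤ (q + C * q) * ‖F‖ :=
      (norm_inner_le_norm _ _).trans (mul_le_mul_of_nonneg_right (hVb.trans
        (add_le_add (hQq k) (mul_le_mul_of_nonneg_left (hQq e) hC))) (norm_nonneg _))
    have b4 := norm_add_le (∑ j, inner ℂ (Q j) (N j) - ∑ j, inner ℂ (N' j) (P j)) (inner ℂ V F)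
    have b5 := norm_sub_le (∑ j, inner ℂ (Q j) (N j)) (∑ j, inner ℂ (N' j) (P j))
    linarith
  have hqle : q ≤ 2 * n * C * p + (1 + C) * ‖F‖ := by
    rcases hq0.eq_or_lt with h0 | h0
    · rw [← h0]; positivity
    · rw [sq] at hmain
      exact le_of_mul_le_mul_left hmain h0
  have e3 : c • (h.shiftOp v (P j) - P j) = Q j - N j := by simp only [hQ]; abel
  rw [e3]
  linarith [norm_sub_le (Q j) (N j), hQq j, hNb j]

/-- The gradient of a weak solution has tangential derivatives in `L²`. -/
lemma exists_tang_derivative (h : IsProfile e γ C) {S₁ S₂ S : Set (Rn n)} (h₁₂ : S₁ ⊆ S₂)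
    (h₂ : S₂ ⊆ S) {U F : FullL2 n} {P : Fin n → FullL2 n} (hU : (U, P) ∈ testClosure S₁)
    (hweak : ∀ z ∈ testClosure S, ∑ j, inner ℂ (z.2 j) (P j) = inner ℂ z.1 F) (k : Fin n) {δ : ℝ}
    (hδ : 0 < δ) (hs₁ : ∀ s : ℝ, |s| ≤ δ → ∀ x ∈ S₁, shift e γ (s • unit k) x ∈ S₂)
    (hs₂ : ∀ s : ℝ, |s| ≤ δ → ∀ x ∈ S₂, shift e γ (s • unit k) x ∈ S) (j : Fin n) :
    ∃ G : FullL2 n, ∀ ψ, ∀ hψ : IsTest Set.univ ψ,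
      inner ℂ (P j) ((h.memLp_tang hψ k).toLp _) = -inner ℂ G hψ.cls := by
  set s : ℕ → ℝ := fun m => δ / ((m : ℝ) + 1) with hsdef
  have hs0 : ∀ m, 0 < s m := fun m => by positivity
  have hsle : ∀ m, s m ≤ δ := fun m => by
    refine div_le_self hδ.le ?_
    linarith [Nat.cast_nonneg (α := ℝ) m]
  -- Moving a quotient of step `s` onto the test function gives minus the quotient of step `-s`.
  have hslim : Tendsto (fun m => -s m) atTop (𝓝[≠] 0) := by
    refine tendsto_nhdsWithin_iff.2 ⟨?_, Eventually.of_forall fun m => ?_⟩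
    · have := (tendsto_one_div_add_atTop_nhds_zero_nat (𝕜 := ℝ)).const_mul δ
      simpa [hsdef, div_eq_mul_inv] using this.neg
    · exact neg_ne_zero.2 (hs0 m).ne'
  obtain ⟨G, hG⟩ := exists_weak_limit (g := fun m =>
    (((s m)⁻¹ : ℝ) : ℂ) • (h.shiftOp (s m • unit k) (P j) - P j)) fun m =>
      h.norm_diffQuot_le h₁₂ h₂ hU hweak k (hs0 m).ne'
        (fun x hx => by
          rw [← neg_smul]
          exact hs₁ _ (by rw [abs_neg, abs_of_pos (hs0 m)]; exact hsle m) x hx)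
        (hs₂ _ (by rw [abs_of_pos (hs0 m)]; exact hsle m)) j
  refine ⟨G, fun ψ hψ => ?_⟩
  rw [← hG hψ.cls _ ?_, neg_neg]
  have h2 := ((tendsto_const_nhds (x := P j)).inner (𝕜 := ℂ)
    ((h.tendsto_diffQuot hψ k).comp hslim)).neg
  refine h2.congr fun m => ?_
  rw [Function.comp_apply, inner_smul_left, inner_smul_right, inner_sub_left, inner_sub_right,
    h.inner_shiftOp_left, Complex.conj_ofReal, neg_smul, inv_neg]
  push_cast
  ring

end IsProfile

/-! ### Regularization -/

open scoped Convolution in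
/-- Smooth functions are dense in `C¹_c(S)` for the `H¹` norm. -/
lemma IsTest.exists_smooth_approx {S : Set (Rn n)} (hS : IsOpen S) {φ : Rn n → ℂ}
    (hφ : IsTest S φ) {ε : ℝ} (hε : 0 < ε) :
    ∃ ψ, ∃ hψ : IsTest S ψ, ContDiff ℝ ((⊤ : ℕ∞) : WithTop ℕ∞) ψ ∧ ‖hψ.cls - hφ.cls‖ ≤ ε ∧
      ∀ i, ‖hψ.clsPd i - hφ.clsPd i‖ ≤ ε := by
  obtain ⟨r, hr, hrS⟩ := hφ.compact.isCompact.exists_cthickening_subset_open hS hφ.subset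
  set K := Metric.cthickening r (tsupport φ) with hK
  have hKc : IsCompact K := hφ.compact.isCompact.cthickening
  set c := (volume K ^ (2⁻¹ : ℝ)).toReal with hc
  have hc0 : 0 ≤ c := ENNReal.toReal_nonneg
  set ε' := ε / (c + 1) with hε'
  have hε'0 : 0 < ε' := by positivity
  have hcε : c * ε' ≤ ε := by
    rw [hε', ← mul_div_assoc, div_le_iff₀ (by positivity)]; nlinarith
  obtain ⟨δ₁, hδ₁, h₁⟩ := Metric.uniformContinuous_iff.1
    (hφ.compact.uniformContinuous_of_continuous hφ.1.continuous) ε' hε'0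
  obtain ⟨δ₂, hδ₂, h₂⟩ := Metric.uniformContinuous_iff.1
    ((hφ.compact.fderiv (𝕜 := ℝ)).uniformContinuous_of_continuous
      (hφ.1.continuous_fderiv (by simp))) ε' hε'0
  -- `r` keeps the support inside `S`; `δ₁` and `δ₂` control the oscillation of `φ` and of its
  -- derivative.
  set ρ := min r (min δ₁ δ₂) with hρ
  have hρ0 : 0 < ρ := by positivity
  let b : ContDiffBump (0 : Rn n) := ⟨ρ / 2, ρ, by positivity, by linarith⟩
  have hrout : b.rOut = ρ := rfl
  have hbs : ContDiff ℝ ((⊤ : ℕ∞) : WithTop ℕ∞) (b.normed volume) := b.contDiff_normed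
  have hbc : HasCompactSupport (b.normed volume) := b.hasCompactSupport_normed
  set ψ : Rn n → ℂ := (b.normed volume) ⋆[ContinuousLinearMap.lsmul ℝ ℝ, volume] φ with hψdef
  have hφmeas : AEStronglyMeasurable φ volume := hφ.1.continuous.aestronglyMeasurable
  have hsm : ContDiff ℝ ((⊤ : ℕ∞) : WithTop ℕ∞) ψ :=
    hbc.contDiff_convolution_left _ hbs hφ.1.continuous.locallyIntegrable
  have hzero : ∀ x ∉ K, ψ x = 0 := by
    intro x hx
    have hx0 : ∀ y ∈ Metric.ball x b.rOut, φ y = 0 := by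
      intro y hy
      refine image_eq_zero_of_notMem_tsupport fun hy' => hx ?_
      refine Metric.mem_cthickening_of_dist_le _ _ _ _ hy' ?_
      rw [Metric.mem_ball, hrout, dist_comm] at hy
      exact hy.le.trans (min_le_left _ _)
    have hxx := hx0 x (Metric.mem_ball_self b.rOut_pos)
    rw [hψdef, b.normed_convolution_eq_right (fun y hy => by rw [hx0 y hy, hxx]), hxx]
  have hsub : tsupport ψ ⊆ K := closure_minimal
    (fun x hx => by_contra fun h => hx (hzero x h)) hKc.isClosed
  have htest : IsTest S ψ := by
    exact ⟨hsm.of_le (by simp), hKc.of_isClosed_subset (isClosed_tsupport _) hsub, hsub.trans hrS⟩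
  have hdist : ∀ x, ‖ψ x - φ x‖ ≤ ε' := by
    intro x
    rw [← dist_eq_norm]
    refine b.dist_normed_convolution_le hφmeas fun y hy => (h₁ ?_).le
    exact (Metric.mem_ball.1 hy).trans_le ((min_le_right _ _).trans (min_le_left _ _))
  have hpd : ∀ i x, pd i ψ x
      = ((b.normed volume) ⋆[ContinuousLinearMap.lsmul ℝ ℝ, volume] (pd i φ)) x := by
    intro i x
    have h3 := (hφ.compact.hasFDerivAt_convolution_right
      (ContinuousLinearMap.lsmul ℝ ℝ : ℝ →L[ℝ] ℂ →L[ℝ] ℂ)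
      (μ := volume) hbs.continuous.locallyIntegrable hφ.1 x).fderiv
    rw [pd, hψdef, h3]
    exact convolution_precompR_apply (L := (ContinuousLinearMap.lsmul ℝ ℝ : ℝ →L[ℝ] ℂ →L[ℝ] ℂ))
      hbs.continuous.locallyIntegrable (hφ.compact.fderiv (𝕜 := ℝ))
      (hφ.1.continuous_fderiv (by simp)) x (EuclideanSpace.single i 1)
  have hdistpd : ∀ i x, ‖pd i ψ x - pd i φ x‖ ≤ ε' := by
    intro i x
    rw [← dist_eq_norm, hpd]
    refine b.dist_normed_convolution_le (hφ.continuous_pd i).aestronglyMeasurable fun y hy => ?_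
    have h4 : dist (fderiv ℝ φ y) (fderiv ℝ φ x) < ε' :=
      h₂ ((Metric.mem_ball.1 hy).trans_le ((min_le_right _ _).trans (min_le_right _ _)))
    rw [dist_eq_norm] at h4 ⊢
    rw [pd, pd, ← sub_apply]
    refine ((fderiv ℝ φ y - fderiv ℝ φ x).le_opNorm _).trans ?_
    rw [IsProfile.norm_unit, mul_one]
    exact h4.le
  have hφK : ∀ x ∉ K, x ∉ tsupport φ := fun x hx h => hx (Metric.self_subset_cthickening _ h)
  refine ⟨ψ, htest, hsm, ?_, fun i => ?_⟩
  · rw [IsTest.cls, IsTest.cls, ← MemLp.toLp_sub]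
    refine (norm_toLp_le_of_support hKc _ hdist fun x hx => ?_).trans hcε
    rw [hzero x hx, image_eq_zero_of_notMem_tsupport (hφK x hx), sub_zero]
  · rw [IsTest.clsPd, IsTest.clsPd, ← MemLp.toLp_sub]
    refine (norm_toLp_le_of_support hKc _ (hdistpd i) fun x hx => ?_).trans hcε
    have : x ∉ tsupport ψ := fun h => hx (hsub h)
    rw [pd_eq_zero_of_notMem (hφK x hx), pd_eq_zero_of_notMem this, sub_zero]

/-- A closed condition on `testClosure S` can be checked on smooth test functions. -/
lemma testClosure_induction_smooth {S : Set (Rn n)} (hS : IsOpen S)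
    {p : FullL2 n × (Fin n → FullL2 n) → Prop} (hp : IsClosed {z | p z})
    (h : ∀ φ, ∀ h : IsTest S φ, ContDiff ℝ ((⊤ : ℕ∞) : WithTop ℕ∞) φ → p (h.cls, h.clsPd))
    {z : FullL2 n × (Fin n → FullL2 n)} (hz : z ∈ testClosure S) : p z := by
  refine testClosure_induction hp (fun φ hφ => ?_) hz
  rw [← Set.mem_ofPred_eq (p := p), ← hp.closure_eq, Metric.mem_closure_iff]
  intro ε hε
  obtain ⟨ψ, hψ, hs, h1, h2⟩ := hφ.exists_smooth_approx hS (half_pos hε)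
  refine ⟨_, h ψ hψ hs, ?_⟩
  rw [dist_comm, Prod.dist_eq]
  refine (max_le ?_ ?_).trans_lt (half_lt_self hε)
  · rw [dist_eq_norm]; exact h1
  · refine (dist_pi_le_iff (half_pos hε).le).2 fun i => ?_
    rw [dist_eq_norm]; exact h2 i

/-! ### Pairing of `L²` functions with test functions -/

/-- The pairing `∫ conj(P) f`. -/
def ip (P : FullL2 n) (f : Rn n → ℂ) : ℂ := ∫ x, star (P x) * f x

lemma ip_eq_inner (P : FullL2 n) {f : Rn n → ℂ} (hf : MemLp f 2 volume) :
    ip P f = inner ℂ P (hf.toLp f) := by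
  rw [L2.inner_def, ip]
  refine integral_congr_ae ?_
  filter_upwards [MemLp.coeFn_toLp hf] with x hx
  rw [hx, RCLike.inner_apply, mul_comm]
  rfl

lemma ip_add (P : FullL2 n) {f g : Rn n → ℂ} (hf : MemLp f 2 volume) (hg : MemLp g 2 volume) :
    ip P (fun x => f x + g x) = ip P f + ip P g := by
  rw [ip_eq_inner P hf, ip_eq_inner P hg, ← inner_add_right, ← MemLp.toLp_add]
  exact ip_eq_inner P (hf.add hg)

lemma ip_sum (P : FullL2 n) {ι : Type*} (s : Finset ι) {f : ι → Rn n → ℂ}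
    (hf : ∀ i ∈ s, MemLp (f i) 2 volume) :
    ip P (fun x => ∑ i ∈ s, f i x) = ∑ i ∈ s, ip P (f i) := by
  classical
  induction s using Finset.induction_on with
  | empty => simp [ip]
  | insert i s his ih =>
    simp only [Finset.sum_insert his]
    rw [ip_add P (hf i (Finset.mem_insert_self i s))
      (memLp_finsetSum _ fun j hj => hf j (Finset.mem_insert_of_mem hj)),
      ih fun j hj => hf j (Finset.mem_insert_of_mem hj)]

lemma add_ip (P Q : FullL2 n) {f : Rn n → ℂ} (hf : MemLp f 2 volume) :
    ip (P + Q) f = ip P f + ip Q f := by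
  rw [ip_eq_inner _ hf, ip_eq_inner _ hf, ip_eq_inner _ hf, inner_add_left]

lemma sub_ip (P Q : FullL2 n) {f : Rn n → ℂ} (hf : MemLp f 2 volume) :
    ip (P - Q) f = ip P f - ip Q f := by
  rw [ip_eq_inner _ hf, ip_eq_inner _ hf, ip_eq_inner _ hf, inner_sub_left]

lemma neg_ip (P : FullL2 n) {f : Rn n → ℂ} (hf : MemLp f 2 volume) : ip (-P) f = -ip P f := by
  rw [ip_eq_inner _ hf, ip_eq_inner _ hf, inner_neg_left]

lemma sum_ip {ι : Type*} (s : Finset ι) (P : ι → FullL2 n) {f : Rn n → ℂ}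
    (hf : MemLp f 2 volume) : ip (∑ i ∈ s, P i) f = ∑ i ∈ s, ip (P i) f := by
  simp only [ip_eq_inner _ hf, sum_inner]

lemma mulOp_ip {m : Rn n → ℝ} (hm : AEStronglyMeasurable (fun x => (m x : ℂ)) volume) (C : ℝ)
    (hb : ∀ x, ‖(m x : ℂ)‖ ≤ C) (P : FullL2 n) (f : Rn n → ℂ) :
    ip (mulOp _ hm C hb P) f = ip P fun x => (m x : ℂ) * f x := by
  refine integral_congr_ae ?_
  filter_upwards [coeFn_mulOp _ hm C hb P] with x hx
  rw [hx, star_mul', Complex.star_def, Complex.conj_ofReal]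
  ring

/-- Weak second derivatives commute. -/
lemma ip_pd_comm {S : Set (Rn n)} (hS : IsOpen S) {z : FullL2 n × (Fin n → FullL2 n)}
    (hz : z ∈ testClosure S) {S' : Set (Rn n)} {ψ : Rn n → ℂ} (hψ : IsTest S' ψ) (i j : Fin n) :
    ip (z.2 j) (pd i ψ) = ip (z.2 i) (pd j ψ) := by
  simp only [ip_eq_inner _ (hψ.memLp_pd volume _)]
  refine testClosure_induction_smooth hS (p := fun z => inner ℂ (z.2 j) (hψ.clsPd i)
    = inner ℂ (z.2 i) (hψ.clsPd j)) (isClosed_eq (by fun_prop) (by fun_prop)) ?_ hz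
  intro φ hφ hs
  -- For smooth `φ` both derivatives can be put on `φ`, where they commute; this is why the
  -- induction runs over smooth functions.
  have key : ∀ i j, inner ℂ (hφ.clsPd j) (hψ.clsPd i)
      = -∫ x, star (pd i (pd j φ) x) * ψ x := by
    intro i j
    have hs1 : ContDiff ℝ ((⊤ : ℕ∞) : WithTop ℕ∞) (pd j φ) := contDiff_pd hs j
    have ht : IsTest Set.univ (pd j φ) :=
      ⟨hs1.of_le (by simp), hasCompactSupport_pd hφ.2 j, Set.subset_univ _⟩
    have h1 : inner ℂ (hφ.clsPd j) (hψ.clsPd i) = ∫ x, star (pd j φ x) * pd i ψ x := by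
      rw [L2.inner_def]
      refine integral_congr_ae ?_
      filter_upwards [MemLp.coeFn_toLp (hφ.memLp_pd volume j),
        MemLp.coeFn_toLp (hψ.memLp_pd volume i)] with x e1 e2
      change inner ℂ (hφ.clsPd j x) (hψ.clsPd i x) = _
      have e1' : hφ.clsPd j x = pd j φ x := e1
      have e2' : hψ.clsPd i x = pd i ψ x := e2
      rw [e1', e2', RCLike.inner_apply, mul_comm]; rfl
    rw [h1]
    have h2 := ht.conj.pd_conj
    have h3 := integral_mul_fderiv_eq_neg_fderiv_mul_of_integrable (μ := (volume : Measure (Rn n)))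
      (f := fun x => star (pd j φ x)) (g := ψ) (v := EuclideanSpace.single i 1)
      ?_ ?_ ?_ (fun x _ => ht.conj.differentiable x) (fun x _ => hψ.differentiable x)
    · refine h3.trans ?_
      congr 1
      refine integral_congr_ae (Eventually.of_forall fun x => ?_)
      have := congrFun (ht.pd_conj i) x
      simp only [pd] at this ⊢
      rw [this]
    · exact (((ht.conj.continuous_pd i).mul hψ.1.continuous).integrable_of_hasCompactSupport
        hψ.2.mul_left)
    · exact ((ht.conj.1.continuous.mul (hψ.continuous_pd i)).integrable_of_hasCompactSupport
        (hasCompactSupport_pd hψ.2 i).mul_left)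
    · exact ((ht.conj.1.continuous.mul hψ.1.continuous).integrable_of_hasCompactSupport
        hψ.2.mul_left)
  change inner ℂ (hφ.clsPd j) (hψ.clsPd i) = inner ℂ (hφ.clsPd i) (hψ.clsPd j)
  rw [key i j, key j i]
  congr 1
  refine integral_congr_ae (Eventually.of_forall fun x => ?_)
  have hs2 : ContDiff ℝ 2 φ := contDiff_infty.1 hs 2
  have hd : DifferentiableAt ℝ (fderiv ℝ φ) x :=
    (hs2.fderiv_right (m := 1) (by norm_num)).differentiable (by simp) x
  have hcomm : pd i (pd j φ) x = pd j (pd i φ) x := by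
    have e1 : ∀ i j : Fin n, pd i (pd j φ) x = fderiv ℝ (fderiv ℝ φ) x (unit i) (unit j) := by
      intro i j
      have := (hd.hasFDerivAt.clm_apply (hasFDerivAt_const (unit j) x)).fderiv
      change fderiv ℝ (fun y => fderiv ℝ φ y (unit j)) x (unit i) = _
      rw [this]; simp
    rw [e1, e1]
    exact (hs2.contDiffAt.isSymmSndFDerivAt (by simp)) _ _
  simp only [hcomm]

/-! ### The Hessian near a graph -/

namespace IsProfile

variable {e : Fin n} {γ : Rn n → ℝ} {C : ℝ}

/-- The complex valued partial derivative `∂ₖγ`. -/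
def slope (γ : Rn n → ℝ) (k : Fin n) (y : Rn n) : ℝ := fderiv ℝ γ y (unit k)

lemma slope_add_smul (h : IsProfile e γ C) (k : Fin n) (y : Rn n) (t : ℝ) :
    slope γ k (y + t • unit e) = slope γ k y := by rw [slope, h.fderiv_add_smul, slope]

/-- The function `1 + ∑ₖ (∂ₖγ)²`. -/
def metric (e : Fin n) (γ : Rn n → ℝ) (y : Rn n) : ℝ :=
  1 + ∑ k ∈ Finset.univ.erase e, slope γ k y ^ 2

lemma one_le_metric (e : Fin n) (γ : Rn n → ℝ) (y : Rn n) : 1 ≤ metric e γ y :=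
  le_add_of_nonneg_right (Finset.sum_nonneg fun _ _ => sq_nonneg _)

lemma contDiff_slope (h : IsProfile e γ C) (k : Fin n) : ContDiff ℝ 1 (slope γ k) :=
  h.contDiff_fderiv.clm_apply contDiff_const

lemma contDiff_metric (h : IsProfile e γ C) : ContDiff ℝ 1 (metric e γ) :=
  contDiff_const.add (ContDiff.sum fun k _ => (h.contDiff_slope k).pow 2)

lemma metric_add_smul (h : IsProfile e γ C) (y : Rn n) (t : ℝ) :
    metric e γ (y + t • unit e) = metric e γ y := by
  simp only [metric, h.slope_add_smul]

/-- A factor that is constant along `e` passes through `∂ₑ`; `∂ₖγ` and `metric e γ` are of this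
kind. -/
lemma pd_mul_of_invariant {a : Rn n → ℝ} (ha : ContDiff ℝ 1 a)
    (hinv : ∀ y (t : ℝ), a (y + t • unit e) = a y) {ψ : Rn n → ℂ} (hψ : Differentiable ℝ ψ) :
    pd e (fun y => (a y : ℂ) * ψ y) = fun y => (a y : ℂ) * pd e ψ y := by
  have hac : Differentiable ℝ fun y => (a y : ℂ) :=
    Complex.ofRealCLM.differentiable.comp (ha.differentiable (by simp))
  have h0 : ∀ y, pd e (fun y => (a y : ℂ)) y = 0 := by
    intro y
    have h1 : HasDerivAt (fun t : ℝ => y + t • unit e) (unit e) 0 := by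
      simpa using ((hasDerivAt_id (0 : ℝ)).smul_const (unit e)).const_add y
    have h2 := (hac (y + (0 : ℝ) • unit e)).hasFDerivAt.comp_hasDerivAt 0 h1
    have h3 : ((fun y => (a y : ℂ)) ∘ fun t : ℝ => y + t • unit e) = fun _ => (a y : ℂ) :=
      funext fun t => by simp only [Function.comp_apply, hinv y t]
    rw [h3] at h2
    have h4 := h2.unique (hasDerivAt_const (0 : ℝ) (a y : ℂ))
    rwa [zero_smul, add_zero] at h4
  rw [pd_mul hac hψ]
  funext y
  rw [h0, zero_mul, add_zero]

/-- Near a graph, a weak solution whose gradient has tangential derivatives in `L²` has all second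
derivatives in `L²`. -/
lemma exists_hessian_of_tang (h : IsProfile e γ C) {S : Set (Rn n)} {F : FullL2 n}
    {P : Fin n → FullL2 n}
    (hsymm : ∀ ψ, IsTest S ψ → ∀ i j, ip (P j) (pd i ψ) = ip (P i) (pd j ψ))
    (hweak : ∀ ψ, IsTest S ψ → ∑ j, ip (P j) (pd j ψ) = ip F ψ)
    (htang : ∀ k ≠ e, ∀ j, ∃ G : FullL2 n, ∀ ψ, IsTest S ψ → ip (P j) (tang e γ k ψ) = -ip G ψ) :
    ∀ i j, ∃ q : FullL2 n, ∀ ψ, IsTest S ψ → ip (P i) (pd j ψ) = -ip q ψ := by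
  have hgc : ∀ k, ContDiff ℝ 1 fun y => (slope γ k y : ℂ) := h.contDiff_pd
  have hgt : ∀ k {ψ}, IsTest S ψ → IsTest S fun y => (slope γ k y : ℂ) * ψ y :=
    fun k ψ hψ => hψ.mul_left (hgc k)
  have hgb : ∀ k y, ‖(slope γ k y : ℂ)‖ ≤ C := h.norm_pd_le
  have hgm : ∀ k, AEStronglyMeasurable (fun y => (slope γ k y : ℂ)) volume :=
    fun k => (hgc k).continuous.aestronglyMeasurable
  have hgpd : ∀ k {ψ}, IsTest S ψ → pd e (fun y => (slope γ k y : ℂ) * ψ y)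
      = fun y => (slope γ k y : ℂ) * pd e ψ y := fun k ψ hψ =>
    pd_mul_of_invariant (h.contDiff_slope k) (h.slope_add_smul k) hψ.differentiable
  -- `∂ₖψ` is the tangential derivative minus `∂ₑ((∂ₖγ)ψ)`, so up to an `L²` term `∂ₖ` acts on `P j`
  -- as `-(∂ₖγ)∂ₑ`.
  have htang' : ∀ k ≠ e, ∀ j, ∃ G : FullL2 n, ∀ ψ, IsTest S ψ →
      ip (P j) (pd k ψ) = -ip G ψ - ip (P j) (pd e fun y => (slope γ k y : ℂ) * ψ y) := by
    intro k hk j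
    obtain ⟨G, hG⟩ := htang k hk j
    refine ⟨G, fun ψ hψ => ?_⟩
    rw [← hG ψ hψ, hgpd k hψ, eq_sub_iff_add_eq,
      ← ip_add _ (hψ.memLp_pd volume k) (by
        rw [← hgpd k hψ]; exact (hgt k hψ).memLp_pd volume e)]
    rfl
  choose! G hG using htang'
  set s := Finset.univ.erase e with hs
  have hse : ∀ k ∈ s, k ≠ e := fun k hk => Finset.ne_of_mem_erase hk
  have hmix : ∀ i, (∃ q : FullL2 n, ∀ ψ, IsTest S ψ → ip (P i) (pd e ψ) = -ip q ψ) → ∀ k,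
      ∃ q : FullL2 n, ∀ ψ, IsTest S ψ → ip (P i) (pd k ψ) = -ip q ψ := by
    rintro i ⟨q, hq⟩ k
    rcases eq_or_ne k e with rfl | hk
    · exact ⟨q, hq⟩
    refine ⟨G k i - mulOp _ (hgm k) C (hgb k) q, fun ψ hψ => ?_⟩
    rw [sub_ip _ _ (hψ.memLp volume), mulOp_ip, hG k hk i ψ hψ, hq _ (hgt k hψ)]
    ring
  -- Using `htang'` twice on each `∂ₖPₖ`, with symmetry in between, turns the equation into one for
  -- `∂ₑPₑ` alone with coefficient `metric e γ ≥ 1`. Testing with `χ = ψ / metric` removes this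
  -- factor.
  have hee : ∃ q : FullL2 n, ∀ ψ, IsTest S ψ → ip (P e) (pd e ψ) = -ip q ψ := by
    have hθ1 := one_le_metric e γ
    have hθ0 : ∀ y, metric e γ y ≠ 0 := fun y => (zero_lt_one.trans_le (hθ1 y)).ne'
    have hθc : ContDiff ℝ 1 fun y => (((metric e γ y)⁻¹ : ℝ) : ℂ) :=
      Complex.ofRealCLM.contDiff.comp (h.contDiff_metric.inv hθ0)
    have hθb : ∀ y, ‖(((metric e γ y)⁻¹ : ℝ) : ℂ)‖ ≤ 1 := fun y => by
      rw [Complex.norm_real, norm_inv, Real.norm_of_nonneg (zero_le_one.trans (hθ1 y))]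
      exact inv_le_one_of_one_le₀ (hθ1 y)
    refine ⟨-mulOp _ hθc.continuous.aestronglyMeasurable 1 hθb
      (F + ∑ k ∈ s, (G k k - mulOp _ (hgm k) C (hgb k) (G k e))), fun ψ hψ => ?_⟩
    set χ : Rn n → ℂ := fun y => (((metric e γ y)⁻¹ : ℝ) : ℂ) * ψ y with hχdef
    have hχ : IsTest S χ := hψ.mul_left hθc
    have hψχ : ψ = fun y => (metric e γ y : ℂ) * χ y := by
      funext y
      have : (metric e γ y : ℂ) ≠ 0 := by exact_mod_cast hθ0 y
      simp only [hχdef, Complex.ofReal_inv]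
      field_simp
    have hpdψ : pd e ψ = fun y => pd e χ y
        + ∑ k ∈ s, pd e (fun y => (slope γ k y : ℂ) * ((slope γ k y : ℂ) * χ y)) y := by
      conv_lhs => rw [hψχ]
      rw [pd_mul_of_invariant h.contDiff_metric h.metric_add_smul hχ.differentiable]
      funext y
      simp only [hgpd _ (hgt _ hχ), hgpd _ hχ, metric]
      push_cast
      rw [add_mul, one_mul, Finset.sum_mul]
      congr 1
      refine Finset.sum_congr rfl fun k _ => by ring
    have hkk : ∀ k ∈ s, ip (P k) (pd k χ)
        = -ip (G k k) χ + ip (G k e) (fun y => (slope γ k y : ℂ) * χ y)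
        + ip (P e) (pd e fun y => (slope γ k y : ℂ) * ((slope γ k y : ℂ) * χ y)) := by
      intro k hk
      rw [hG k (hse k hk) k χ hχ, hsymm _ (hgt k hχ) e k, hG k (hse k hk) e _ (hgt k hχ)]
      ring
    have hw := hweak χ hχ
    rw [← Finset.add_sum_erase _ _ (Finset.mem_univ e), Finset.sum_congr rfl hkk,
      Finset.sum_add_distrib, Finset.sum_add_distrib] at hw
    rw [hpdψ, ip_add _ (hχ.memLp_pd volume e) (memLp_finsetSum _ fun k _ =>
      (hgt k (hgt k hχ)).memLp_pd volume e), ip_sum _ _ fun k _ =>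
      (hgt k (hgt k hχ)).memLp_pd volume e, neg_ip _ (hψ.memLp volume), mulOp_ip,
      add_ip _ _ (hχ.memLp volume), sum_ip _ _ (hχ.memLp volume), neg_neg]
    have h5 : ∀ k ∈ s, ip (G k k - mulOp _ (hgm k) C (hgb k) (G k e)) χ
        = ip (G k k) χ - ip (G k e) (fun y => (slope γ k y : ℂ) * χ y) := fun k _ => by
      rw [sub_ip _ _ (hχ.memLp volume), mulOp_ip]
    rw [Finset.sum_congr rfl h5, Finset.sum_sub_distrib, ← hw, Finset.sum_neg_distrib]
    ring
  -- From `∂ₑPₑ` follows `∂ᵢPₑ`, by symmetry `∂ₑPᵢ`, and then `∂ⱼPᵢ`.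
  intro i j
  refine hmix i ?_ j
  obtain ⟨q, hq⟩ := hmix e hee i
  exact ⟨q, fun ψ hψ => by rw [hsymm ψ hψ e i, hq ψ hψ]⟩

/-- Local regularity of weak solutions up to a graph. -/
lemma exists_hessian (h : IsProfile e γ C) {S₁ S₂ S : Set (Rn n)} (hS : IsOpen S) (h₁₂ : S₁ ⊆ S₂)
    (h₂ : S₂ ⊆ S) {U F : FullL2 n} {P : Fin n → FullL2 n} (hU : (U, P) ∈ testClosure S₁)
    (hweak : ∀ z ∈ testClosure S, ∑ j, inner ℂ (z.2 j) (P j) = inner ℂ z.1 F) {δ : ℝ}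
    (hδ : 0 < δ)
    (hs₁ : ∀ k ≠ e, ∀ s : ℝ, |s| ≤ δ → ∀ x ∈ S₁, shift e γ (s • unit k) x ∈ S₂)
    (hs₂ : ∀ k ≠ e, ∀ s : ℝ, |s| ≤ δ → ∀ x ∈ S₂, shift e γ (s • unit k) x ∈ S) :
    ∀ i j, ∃ q : FullL2 n, ∀ ψ, IsTest S ψ → ip (P i) (pd j ψ) = -ip q ψ := by
  have hU' : (U, P) ∈ testClosure S := by
    refine testClosure_induction (testPairs S).isClosed_topologicalClosure (fun φ hφ => ?_) hU
    exact (testPairs S).le_topologicalClosure (hφ.mono (h₁₂.trans h₂)).mem_testPairs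
  refine h.exists_hessian_of_tang (F := F) (fun ψ hψ i j => ip_pd_comm hS hU' hψ i j)
    (fun ψ hψ => ?_) fun k hk j => ?_
  · have h1 := congrArg (starRingEnd ℂ)
      (hweak _ ((testPairs S).le_topologicalClosure hψ.mem_testPairs))
    rw [map_sum, inner_conj_symm] at h1
    simp only [inner_conj_symm] at h1
    rw [ip_eq_inner _ (hψ.memLp volume)]
    refine Eq.trans (Finset.sum_congr rfl fun j _ => ?_) h1
    exact ip_eq_inner _ (hψ.memLp_pd volume j)
  · obtain ⟨G, hG⟩ := h.exists_tang_derivative h₁₂ h₂ hU hweak k hδ (hs₁ k hk) (hs₂ k hk) j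
    refine ⟨G, fun ψ hψ => ?_⟩
    rw [ip_eq_inner _ (h.memLp_tang hψ k), ip_eq_inner _ (hψ.memLp volume)]
    exact hG ψ (hψ.mono (Set.subset_univ S))

end IsProfile

/-! ### Local graph representation of `C²` boundaries -/

/-- The projection that annihilates the `e`-th coordinate. -/
def flat (e : Fin n) : Rn n →L[ℝ] Rn n :=
  ContinuousLinearMap.id ℝ _ - (EuclideanSpace.proj e : Rn n →L[ℝ] ℝ).smulRight (unit e)

lemma flat_apply (e : Fin n) (y : Rn n) : flat e y = y - y e • unit e := rfl

lemma flat_add_smul (e : Fin n) (y : Rn n) (t : ℝ) : flat e (y + t • unit e) = flat e y := by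
  simp only [flat_apply, PiLp.add_apply, PiLp.smul_apply, PiLp.single_apply, if_true,
    smul_eq_mul, mul_one]
  module

/-- `flat e` removes the dependence on the `e`-th coordinate, and the compact support of `g` makes
the derivative bounds global. -/
lemma isProfile_comp_flat (e : Fin n) {g : Rn n → ℝ} (hg : ContDiff ℝ 2 g)
    (hc : HasCompactSupport g) : ∃ C, IsProfile e (fun y => g (flat e y)) C := by
  have hd : ContDiff ℝ 1 (fderiv ℝ g) := hg.fderiv_right (by norm_num)
  obtain ⟨L, hL⟩ := hd.lipschitzWith_of_hasCompactSupport (hc.fderiv (𝕜 := ℝ)) (by simp)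
  obtain ⟨M, hM⟩ := hd.continuous.bounded_above_of_compact_support (hc.fderiv (𝕜 := ℝ))
  have hM0 : 0 ≤ M := (norm_nonneg _).trans (hM 0)
  have hf : ∀ y, fderiv ℝ (fun y => g (flat e y)) y = (fderiv ℝ g (flat e y)).comp (flat e) :=
    fun y => ((hg.differentiable (by simp) _).hasFDerivAt.comp y (flat e).hasFDerivAt).fderiv
  set N := ‖flat e‖ with hN
  -- One constant has to bound both the derivative, by `M N`, and its Lipschitz constant, by `L N²`.
  refine ⟨M * N + L * N * N, hg.comp (flat e).contDiff, fun y t => by rw [flat_add_smul],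
    fun y => ?_, fun x y => ?_⟩
  · rw [hf]
    refine (ContinuousLinearMap.opNorm_comp_le _ _).trans ?_
    have : ‖fderiv ℝ g (flat e y)‖ * ‖flat e‖ ≤ M * N := by gcongr; exact hM _
    have h0 : 0 ≤ L * N * N := by positivity
    linarith
  · rw [hf, hf, ← ContinuousLinearMap.sub_comp]
    refine (ContinuousLinearMap.opNorm_comp_le _ _).trans ?_
    have h1 := hL.dist_le_mul (flat e x) (flat e y)
    rw [dist_eq_norm, dist_eq_norm, ← map_sub] at h1
    have h2 := (flat e).le_opNorm (x - y)
    have h3 : ‖fderiv ℝ g (flat e x) - fderiv ℝ g (flat e y)‖ * ‖flat e‖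
        ≤ (L * (N * ‖x - y‖)) * N := by
      gcongr
      exact h1.trans (by gcongr)
    have h0 : 0 ≤ M * N * ‖x - y‖ := by positivity
    linarith

lemma mul_neg_iff_of_mul_pos {t a c : ℝ} (h : 0 < a * c) : t * a < 0 ↔ t * c < 0 := by
  rcases pos_and_pos_or_neg_and_neg_of_mul_pos h with ⟨ha, hc⟩ | ⟨ha, hc⟩
  · simp [mul_neg_iff, ha, hc, ha.not_gt, hc.not_gt]
  · simp [mul_neg_iff, ha, hc, ha.not_gt, hc.not_gt]

/-- The zero set of a `C²` function with nonvanishing derivative is locally a graph, and the sign of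
the function is determined by the position relative to the graph. -/
lemma exists_profile_of_fderiv_ne_zero {ρ : Rn n → ℝ} {x₀ : Rn n} (hρ : ContDiffAt ℝ 2 ρ x₀)
    (h0 : ρ x₀ = 0) {e : Fin n} (he : fderiv ℝ ρ x₀ (unit e) ≠ 0) :
    ∃ γ C, IsProfile e γ C ∧
      ∀ᶠ y in 𝓝 x₀, (ρ y < 0 ↔ (y e - γ y) * fderiv ℝ ρ x₀ (unit e) < 0) := by
  set c := fderiv ℝ ρ x₀ (unit e) with hc
  have hρd : DifferentiableAt ℝ ρ x₀ := hρ.differentiableAt (by simp)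
  -- `Ψ` replaces the `e`-th coordinate by the value of `ρ`, so it sends the zero set of `ρ` into a
  -- hyperplane. Its Jacobian determinant at `x₀` is `c`.
  set Ψ : Rn n → Rn n := fun y => y + (ρ y - y e) • unit e with hΨ
  set L : Rn n →L[ℝ] Rn n := ContinuousLinearMap.id ℝ _
    + (fderiv ℝ ρ x₀ - (EuclideanSpace.proj e : Rn n →L[ℝ] ℝ)).smulRight (unit e) with hL
  have hΨc : ContDiffAt ℝ 2 Ψ x₀ :=
    contDiffAt_id.add ((hρ.sub (EuclideanSpace.proj e : Rn n →L[ℝ] ℝ).contDiff.contDiffAt).smul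
      contDiffAt_const)
  have hΨd : HasFDerivAt Ψ L x₀ :=
    (hasFDerivAt_id x₀).add ((hρd.hasFDerivAt.sub
      (EuclideanSpace.proj e : Rn n →L[ℝ] ℝ).hasFDerivAt).smul_const (unit e))
  have hdet : L.det ≠ 0 := by
    have h1 := LinearMap.transvection.det
      ((fderiv ℝ ρ x₀ - (EuclideanSpace.proj e : Rn n →L[ℝ] ℝ) : Rn n →L[ℝ] ℝ) : Rn n →ₗ[ℝ] ℝ)
      (unit e)
    have h2 : (1 : ℝ) + (fderiv ℝ ρ x₀ - (EuclideanSpace.proj e : Rn n →L[ℝ] ℝ)) (unit e) = c := by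
      rw [sub_apply]
      simp [hc]
    rw [ContinuousLinearMap.coe_coe, h2] at h1
    have h3 : L.det = c := h1
    rw [h3]; exact he
  set L' := L.toContinuousLinearEquivOfDetNeZero hdet with hL'
  have hΨd' : HasFDerivAt Ψ (L' : Rn n →L[ℝ] Rn n) x₀ := hΨd
  set H := hΨc.toOpenPartialHomeomorph Ψ hΨd' (by simp) with hH
  set Θ := hΨc.localInverse hΨd' (by simp) with hΘ
  have hp : Ψ x₀ = flat e x₀ := by
    simp only [hΨ, flat_apply, h0]; module
  have hΘc : ContDiffAt ℝ 2 Θ (flat e x₀) := by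
    rw [← hp]; exact hΨc.to_localInverse hΨd' (by simp)
  have hΘx : Θ (flat e x₀) = x₀ := by
    rw [← hp]; exact hΨc.localInverse_apply_image hΨd' (by simp)
  have hinv : ∀ᶠ z in 𝓝 (flat e x₀), Ψ (Θ z) = z := by
    have : H.target ∈ 𝓝 (flat e x₀) := by
      rw [← hp]
      exact H.open_target.mem_nhds (hΨc.image_mem_toOpenPartialHomeomorph_target hΨd' (by simp))
    filter_upwards [this] with z hz using H.right_inv hz
  have hΘev : ∀ᶠ z in 𝓝 (flat e x₀), ContDiffAt ℝ 2 Θ z := hΘc.eventually (by simp)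
  obtain ⟨r, hr, hball⟩ := Metric.eventually_nhds_iff_ball.1 hΘev
  let b : ContDiffBump (flat e x₀) := ⟨r / 3, r / 2, by positivity, by linarith⟩
  -- On the hyperplane the `e`-th coordinate of the local inverse is the graph function; the bump
  -- extends it and equals `1` near `flat e x₀`.
  set g : Rn n → ℝ := fun z => b z * Θ z e with hg
  have hgc : ContDiff ℝ 2 g := by
    rw [contDiff_iff_contDiffAt]
    intro z
    by_cases hz : z ∈ Metric.ball (flat e x₀) r
    · exact b.contDiff.contDiffAt.mul
        ((EuclideanSpace.proj e : Rn n →L[ℝ] ℝ).contDiff.contDiffAt.comp z (hball z hz))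
    · have hz' : z ∈ (tsupport b)ᶜ := by
        rw [b.tsupport_eq]
        intro h'
        refine hz ?_
        rw [Metric.mem_closedBall] at h'
        exact Metric.mem_ball.2 (h'.trans_lt (by change r / 2 < r; linarith))
      have : g =ᶠ[𝓝 z] fun _ => 0 := by
        filter_upwards [(isClosed_tsupport b).isOpen_compl.mem_nhds hz'] with w hw
        simp only [hg, image_eq_zero_of_notMem_tsupport hw, zero_mul]
      exact contDiffAt_const.congr_of_eventuallyEq this
  obtain ⟨C, hprof⟩ := isProfile_comp_flat e hgc (b.hasCompactSupport.mul_right)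
  refine ⟨_, C, hprof, ?_⟩
  have hflat : Tendsto (flat e) (𝓝 x₀) (𝓝 (flat e x₀)) := (flat e).continuous.tendsto x₀
  have hone : ∀ᶠ z in 𝓝 (flat e x₀), b z = 1 := by
    filter_upwards [Metric.closedBall_mem_nhds (flat e x₀) b.rIn_pos] with z hz
    exact b.one_of_mem_closedBall hz
  have hpos : ∀ᶠ y in 𝓝 x₀, ContDiffAt ℝ 2 ρ y ∧ 0 < fderiv ℝ ρ y (unit e) * c := by
    refine (hρ.eventually (by simp)).and ?_
    have h1 : ContinuousAt (fun y => fderiv ℝ ρ y (unit e) * c) x₀ := by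
      have := (hρ.fderiv_right (m := 1) (by norm_num)).continuousAt
      fun_prop
    refine h1.eventually (lt_mem_nhds ?_)
    exact mul_self_pos.2 he
  obtain ⟨R, hR, hRball⟩ := Metric.eventually_nhds_iff_ball.1 hpos
  have hΘball : ∀ᶠ z in 𝓝 (flat e x₀), Θ z ∈ Metric.ball x₀ R := by
    have h1 := hΘc.continuousAt
    rw [ContinuousAt, hΘx] at h1
    exact h1.eventually (Metric.ball_mem_nhds x₀ hR)
  filter_upwards [hflat.eventually hone, hflat.eventually hinv, hflat.eventually hΘball,
    Metric.ball_mem_nhds x₀ hR] with y h1 h2 h3 h4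
  set w := Θ (flat e y) with hw
  have hγ : g (flat e y) = w e := by simp only [hg, h1, one_mul, hw]
  rw [hγ]
  have h5 : ρ w = 0 := by
    have := congrArg (fun z : Rn n => z e) h2
    simpa [hΨ, flat_apply] using this
  have h6 : y - w = (y e - w e) • unit e := by
    have : w + (ρ w - w e) • unit e = y - y e • unit e := h2
    rw [h5, zero_sub, neg_smul, ← sub_eq_add_neg] at this
    rw [sub_smul, sub_eq_sub_iff_add_eq_add, add_comm (y e • unit e) w]
    rw [sub_eq_sub_iff_add_eq_add] at this
    exact this.symm
  -- `y` and its foot point `w` on the graph differ only in the `e`-th coordinate and `ρ w = 0`.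
  -- Hence `ρ y = (y e - w e) ∂ₑρ(ξ)`, where `∂ₑρ(ξ)` has the sign of `c`.
  obtain ⟨ξ, hξ, hξ'⟩ := domain_mvt (f := ρ) (s := Metric.ball x₀ R) (x := w) (y := y)
    (f' := fderiv ℝ ρ)
    (fun z hz => (((hRball z hz).1.differentiableAt (by simp)).hasFDerivAt).hasFDerivWithinAt)
    (convex_ball x₀ R) h3 h4
  have hξR := (convex_ball x₀ R).segment_subset h3 h4 hξ
  rw [h5, sub_zero, h6, map_smul, smul_eq_mul] at hξ'
  have h7 := (hRball ξ hξR).2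
  rw [hξ']
  set a := fderiv ℝ ρ ξ (unit e)
  exact mul_neg_iff_of_mul_pos h7

/-- Near each point of its closure, a domain with `C²` boundary is described by its position
relative to a graph. -/
lemma exists_profile (hn : 0 < n) {Ω : Opens (Rn n)} (hΩ : HasC2Boundary (Ω : Set (Rn n)))
    {x₀ : Rn n} (hx : x₀ ∈ closure (Ω : Set (Rn n))) :
    ∃ (e : Fin n) (γ : Rn n → ℝ) (C R : ℝ), IsProfile e γ C ∧ 0 < R ∧
      ∀ y ∈ Metric.ball x₀ R, ∀ z ∈ Metric.ball x₀ R, y ∈ Ω → z e - γ z = y e - γ y → z ∈ Ω := by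
  by_cases hxΩ : x₀ ∈ Ω
  -- At an interior point plain translations suffice: zero profile, any direction.
  · obtain ⟨R, hR, hball⟩ := Metric.isOpen_iff.1 Ω.isOpen x₀ hxΩ
    exact ⟨⟨0, hn⟩, fun _ => 0, 0, R, IsProfile.zero _, hR, fun y _ z hz _ _ => hball hz⟩
  · have hfr : x₀ ∈ frontier (Ω : Set (Rn n)) := by
      rw [Ω.isOpen.frontier_eq]; exact ⟨hx, hxΩ⟩
    obtain ⟨U, ρ, hU, hxU, hρ, hρ0, hρd, hUΩ⟩ := hΩ x₀ hfr
    obtain ⟨e, he⟩ : ∃ e, fderiv ℝ ρ x₀ (unit e) ≠ 0 := by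
      by_contra! hcon
      refine hρd ?_
      refine ContinuousLinearMap.coe_injective ((EuclideanSpace.basisFun (Fin n) ℝ).toBasis.ext
        fun i => ?_)
      simpa using hcon i
    obtain ⟨γ, C, hγ, hev⟩ := exists_profile_of_fderiv_ne_zero
      (hρ.contDiffAt (hU.mem_nhds hxU)) hρ0 he
    obtain ⟨R, hR, hball⟩ := Metric.eventually_nhds_iff_ball.1 (hev.and (hU.mem_nhds hxU))
    refine ⟨e, γ, C, R, hγ, hR, fun y hy z hz hyΩ hyz => ?_⟩
    have h1 := (hball y hy).1.1 ((hUΩ y (hball y hy).2).1 hyΩ)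
    rw [← hyz] at h1
    exact (hUΩ z (hball z hz).2).2 ((hball z hz).1.2 h1)

/-- Local regularity of weak solutions in a domain with `C²` boundary. -/
lemma exists_hessian_of_support (hn : 0 < n) {Ω : Opens (Rn n)}
    (hΩ : HasC2Boundary (Ω : Set (Rn n))) {x₀ : Rn n} (hx : x₀ ∈ closure (Ω : Set (Rn n))) :
    ∃ r > 0, ∀ (U F : FullL2 n) (P : Fin n → FullL2 n),
      (U, P) ∈ testClosure ((Ω : Set (Rn n)) ∩ Metric.ball x₀ r) →
      (∀ z ∈ testClosure (Ω : Set (Rn n)), ∑ j, inner ℂ (z.2 j) (P j) = inner ℂ z.1 F) →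
      ∀ i j, ∃ q : FullL2 n, ∀ ψ, IsTest (Ω : Set (Rn n)) ψ → ip (P i) (pd j ψ) = -ip q ψ := by
  obtain ⟨e, γ, C, R, h, hR, hΩR⟩ := exists_profile hn hΩ hx
  have hC := h.nonneg
  -- A shift of length at most `δ` moves points by at most `R/3`, so the radii `R/3`, `2R/3`, `R`
  -- leave room for two shifts.
  set δ := R / (3 * (1 + C)) with hδ
  have hδ0 : 0 < δ := by positivity
  have hmove : ∀ k ≠ e, ∀ s : ℝ, |s| ≤ δ → ∀ r, r + R / 3 ≤ R →
      ∀ x ∈ (Ω : Set (Rn n)) ∩ Metric.ball x₀ r,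
      shift e γ (s • unit k) x ∈ (Ω : Set (Rn n)) ∩ Metric.ball x₀ (r + R / 3) := by
    intro k hk s hs r hr x hx
    have h1 : dist (shift e γ (s • unit k) x) x₀ < r + R / 3 := by
      have h2 := h.norm_shift_sub_le (s • unit k) x
      rw [norm_smul, IsProfile.norm_unit, mul_one, Real.norm_eq_abs, ← dist_eq_norm] at h2
      have h3 : (1 + C) * |s| ≤ R / 3 := by
        calc (1 + C) * |s| ≤ (1 + C) * δ := by gcongr
          _ = R / 3 := by rw [hδ]; field_simp
      have h4 := dist_triangle (shift e γ (s • unit k) x) x x₀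
      have h5 := Metric.mem_ball.1 hx.2
      linarith
    -- A shift in a direction `k ≠ e` preserves the height `y e - γ y` over the graph, hence
    -- membership in `Ω`.
    refine ⟨hΩR x (Metric.ball_subset_ball (by linarith) hx.2) _
      (Metric.mem_ball.2 (h1.trans_le hr)) hx.1 ?_, h1⟩
    have h6 : γ (shift e γ (s • unit k) x) = γ (x + s • unit k) := h.invariant _ _
    rw [h6]
    simp only [shift, PiLp.add_apply, PiLp.smul_apply, PiLp.single_apply, hk.symm,
      if_true, if_false, smul_eq_mul, mul_one, mul_zero]
    ring
  refine ⟨R / 3, by positivity, fun U F P hU hweak => ?_⟩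
  refine h.exists_hessian (S₁ := (Ω : Set (Rn n)) ∩ Metric.ball x₀ (R / 3))
    (S₂ := (Ω : Set (Rn n)) ∩ Metric.ball x₀ (R / 3 + R / 3)) Ω.isOpen
    (Set.inter_subset_inter_right _ (Metric.ball_subset_ball (by linarith))) Set.inter_subset_left
    hU hweak hδ0 (fun k hk s hs x hx => hmove k hk s hs _ (by linarith) x hx)
    (fun k hk s hs x hx => (hmove k hk s hs _ (by linarith) x hx).1)

variable {Ω : Opens (Rn n)}

/-! ### Functions on `Ω` and their extensions by zero -/

lemma memLp_indicator (u : L2 Ω) :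
    MemLp ((Ω : Set (Rn n)).indicator u) 2 (volume : Measure (Rn n)) :=
  (memLp_indicator_iff_restrict Ω.isOpen.measurableSet).2 (Lp.memLp u)

lemma ae_of_ae_restrict {p : Rn n → Prop}
    (h : ∀ᵐ x ∂(volume : Measure (Rn n)).restrict (Ω : Set (Rn n)), p x) :
    ∀ᵐ x ∂(volume : Measure (Rn n)), x ∈ Ω → p x :=
  (ae_restrict_iff' Ω.isOpen.measurableSet).1 h

/-- Extension by zero `L²(Ω) → L²(ℝⁿ)`. -/
def extend : L2 Ω →ₗᵢ[ℂ] FullL2 n where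
  toFun u := (memLp_indicator u).toLp _
  map_add' u v := by
    rw [← MemLp.toLp_add]
    refine MemLp.toLp_congr _ _ ?_
    filter_upwards [ae_of_ae_restrict (Lp.coeFn_add u v)] with x hx
    by_cases h : x ∈ (Ω : Set (Rn n))
    · rw [Pi.add_apply, Set.indicator_of_mem h, Set.indicator_of_mem h, Set.indicator_of_mem h,
        hx h, Pi.add_apply]
    · simp [h]
  map_smul' c u := by
    rw [RingHom.id_apply, ← MemLp.toLp_const_smul]
    refine MemLp.toLp_congr _ _ ?_
    filter_upwards [ae_of_ae_restrict (Lp.coeFn_smul c u)] with x hx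
    by_cases h : x ∈ (Ω : Set (Rn n))
    · simp [h, hx h]
    · simp [h]
  norm_map' u := by
    change ‖(memLp_indicator u).toLp _‖ = ‖u‖
    rw [Lp.norm_toLp, eLpNorm_indicator_eq_eLpNorm_restrict Ω.isOpen.measurableSet, Lp.norm_def]

lemma coeFn_extend (u : L2 Ω) : extend u =ᵐ[volume] (Ω : Set (Rn n)).indicator u :=
  MemLp.coeFn_toLp (memLp_indicator u)

lemma integral_extend_mul (u : L2 Ω) (f : Rn n → ℂ) :
    ∫ x, extend u x * f x = pair u f := by
  rw [pair, ← integral_indicator Ω.isOpen.measurableSet]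
  refine integral_congr_ae ?_
  filter_upwards [coeFn_extend u] with x hx
  rw [hx]
  by_cases h : x ∈ (Ω : Set (Rn n)) <;> simp [h]

lemma inner_cls_extend {f : Rn n → ℂ} (hf : MemLp f 2 volume) (u : L2 Ω) :
    inner ℂ (hf.toLp f) (extend u) = pair u fun x => star (f x) := by
  rw [L2.inner_def, ← integral_extend_mul]
  refine integral_congr_ae ?_
  filter_upwards [MemLp.coeFn_toLp hf] with x hx
  rw [hx]; rfl

lemma ip_extend (u : L2 Ω) (f : Rn n → ℂ) :
    ip (extend u) f = star (pair u fun x => star (f x)) := by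
  rw [← integral_extend_mul, ip, Complex.star_def, ← integral_conj]
  refine integral_congr_ae (Eventually.of_forall fun x => ?_)
  simp

/-- Restriction `L²(ℝⁿ) → L²(Ω)`. -/
def restr (q : FullL2 n) : L2 Ω := ((Lp.memLp q).restrict (Ω : Set (Rn n))).toLp q

lemma ip_eq_pair_restr (q : FullL2 n) {ψ : Rn n → ℂ} (hψ : IsTest (Ω : Set (Rn n)) ψ) :
    ip q ψ = star (pair (restr q : L2 Ω) fun x => star (ψ x)) := by
  rw [pair, Complex.star_def, ← integral_conj, ip]
  rw [← setIntegral_eq_integral_of_forall_compl_eq_zero (s := (Ω : Set (Rn n)))]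
  · refine integral_congr_ae ?_
    filter_upwards [MemLp.coeFn_toLp ((Lp.memLp q).restrict (Ω : Set (Rn n)))] with x hx
    simp only [restr]
    rw [hx]
    simp
  · intro x hx
    rw [image_eq_zero_of_notMem_tsupport fun h => hx (hψ.subset h), mul_zero]

/-! ### Test functions on `Ω` -/

lemma isTest_testFunction (φ : 𝓓(Ω, ℂ)) : IsTest (Ω : Set (Rn n)) φ :=
  ⟨φ.contDiff.of_le (by simp), φ.hasCompactSupport, φ.tsupport_subset⟩

/-! ### Cutoff functions and the Leibniz rule -/

/-- Smooth functions of compact support. -/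
structure IsCutoff (η : Rn n → ℂ) : Prop where
  smooth : ContDiff ℝ ((⊤ : ℕ∞) : WithTop ℕ∞) η
  compact : HasCompactSupport η

namespace IsCutoff

variable {η ζ : Rn n → ℂ}

lemma pd (h : IsCutoff η) (i : Fin n) : IsCutoff (pd i η) :=
  ⟨contDiff_pd h.1 i, hasCompactSupport_pd h.2 i⟩

lemma differentiable (h : IsCutoff η) : Differentiable ℝ η := h.1.differentiable (by simp)

lemma exists_bound (h : IsCutoff η) : ∃ C, ∀ x, ‖η x‖ ≤ C :=
  h.1.continuous.bounded_above_of_compact_support h.2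

/-- Multiplication by a cutoff function on `L²(Ω)`. -/
def cut (h : IsCutoff η) : L2 Ω →L[ℂ] L2 Ω :=
  mulOp η h.1.continuous.aestronglyMeasurable h.exists_bound.choose h.exists_bound.choose_spec

lemma coeFn_cut (h : IsCutoff η) (u : L2 Ω) :
    h.cut u =ᵐ[volume.restrict (Ω : Set (Rn n))] fun x => η x * u x := coeFn_mulOp _ _ _ _ u

lemma pair_cut (h : IsCutoff η) (u : L2 Ω) (f : Rn n → ℂ) :
    pair (h.cut u) f = pair u fun x => η x * f x := by
  refine integral_congr_ae ?_
  filter_upwards [h.coeFn_cut u] with x hx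
  rw [hx]; ring

/-- The product of a cutoff function and a test function. -/
def mulTest (h : IsCutoff η) (φ : 𝓓(Ω, ℂ)) : 𝓓(Ω, ℂ) :=
  ⟨fun x => η x * φ x, h.1.mul φ.contDiff, φ.hasCompactSupport.mul_left,
    (tsupport_mul_subset_right (f := η)).trans φ.tsupport_subset⟩

lemma mulTest_coe (h : IsCutoff η) (φ : 𝓓(Ω, ℂ)) : ⇑(h.mulTest φ) = fun x => η x * φ x := rfl

lemma pd_mulTest (h : IsCutoff η) (φ : 𝓓(Ω, ℂ)) (i : Fin n) :
    Plate.pd i (h.mulTest φ) = fun x => η x * Plate.pd i φ x + Plate.pd i η x * φ x := by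
  rw [h.mulTest_coe, pd_mul h.differentiable (isTest_testFunction φ).differentiable]

lemma sqInt_mul (h : IsCutoff η) {f : Rn n → ℂ} (hf : SqInt Ω f) : SqInt Ω fun x => η x * f x :=
  memLp_mul_of_bound h.1.continuous.aestronglyMeasurable h.exists_bound.choose_spec hf

end IsCutoff

lemma pair_fun_add (u : L2 Ω) {f g : Rn n → ℂ} (hf : SqInt Ω f) (hg : SqInt Ω g) :
    pair u (fun x => f x + g x) = pair u f + pair u g := by
  rw [pair, pair, pair, ← integral_add (integrable_pair u hf) (integrable_pair u hg)]
  simp only [mul_add]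

lemma pair_neg (u : L2 Ω) (f : Rn n → ℂ) : pair (-u) f = -pair u f := by
  rw [← neg_one_smul ℂ u, pair_smul, neg_one_mul]

lemma pair_sum {ι : Type*} (s : Finset ι) (u : ι → L2 Ω) {f : Rn n → ℂ} (hf : SqInt Ω f) :
    pair (∑ i ∈ s, u i) f = ∑ i ∈ s, pair (u i) f := by
  classical
  induction s using Finset.induction_on with
  | empty => simp [pair_zero]
  | insert i s his ih => rw [Finset.sum_insert his, Finset.sum_insert his, pair_add _ _ hf, ih]

/-- The Leibniz rule for weak derivatives. -/
lemma HasWeakPartial.cut {i : Fin n} {u g : L2 Ω} (hu : HasWeakPartial i u g) {η : Rn n → ℂ}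
    (h : IsCutoff η) : HasWeakPartial i (h.cut u) (h.cut g + (h.pd i).cut u) := fun φ => by
  have h1 := hu (h.mulTest φ)
  rw [h.pd_mulTest, pair_fun_add _ (h.sqInt_mul (sqInt_pd φ i))
    ((h.pd i).sqInt_mul (sqInt_test φ))] at h1
  rw [pair_add _ _ (sqInt_test φ), h.pair_cut, h.pair_cut, (h.pd i).pair_cut]
  rw [h.mulTest_coe] at h1
  linear_combination h1

lemma HasWeakGradient.cut {u : L2 Ω} {p : Fin n → L2 Ω} (hu : HasWeakGradient u p)
    {η : Rn n → ℂ} (h : IsCutoff η) :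
    HasWeakGradient (h.cut u) fun i => h.cut (p i) + (h.pd i).cut u := fun i => (hu i).cut h

lemma cut_mem_H2 {u : L2 Ω} (hu : u ∈ H2 Ω) {η : Rn n → ℂ} (h : IsCutoff η) : h.cut u ∈ H2 Ω := by
  obtain ⟨q, p, hp, hq⟩ := hu
  exact ⟨_, _, hp.cut h, fun i j => ((hq i j).cut h).add ((hp j).cut (h.pd i))⟩

/-- The class in `H¹(Ω)` of a test function. -/
def testGrad (φ : 𝓓(Ω, ℂ)) : L2 Ω × (Fin n → L2 Ω) :=
  ((sqInt_test φ).toLp _, fun i => (sqInt_pd φ i).toLp _)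

/-- A closed condition on `H¹₀(Ω)` can be checked on test functions. -/
lemma gradClosure_induction {p : L2 Ω × (Fin n → L2 Ω) → Prop} (hp : IsClosed {z | p z})
    (h : ∀ φ : 𝓓(Ω, ℂ), p (testGrad φ)) {z : L2 Ω × (Fin n → L2 Ω)}
    (hz : z ∈ (testGradients Ω).topologicalClosure) : p z := by
  have : closure (testGradients Ω : Set (L2 Ω × (Fin n → L2 Ω))) ⊆ {z | p z} := by
    refine closure_minimal ?_ hp
    rintro z ⟨φ, h1, h2⟩
    have : z = testGrad φ := Prod.ext (Lp.ext (h1.trans (MemLp.coeFn_toLp (sqInt_test φ)).symm))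
      (funext fun i => Lp.ext ((h2 i).trans (MemLp.coeFn_toLp (sqInt_pd φ i)).symm))
    rw [this]
    exact h φ
  exact this hz

lemma testGrad_mem (φ : 𝓓(Ω, ℂ)) : testGrad φ ∈ (testGradients Ω).topologicalClosure :=
  (testGradients Ω).le_topologicalClosure
    ⟨φ, MemLp.coeFn_toLp (sqInt_test φ), fun i => MemLp.coeFn_toLp (sqInt_pd φ i)⟩

lemma pair_eq_inner (u : L2 Ω) {f : Rn n → ℂ} (hf' : SqInt Ω fun x => star (f x)) :
    pair u f = inner ℂ (hf'.toLp _) u := by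
  rw [L2.inner_def, pair]
  refine integral_congr_ae ?_
  filter_upwards [MemLp.coeFn_toLp hf'] with x hx
  rw [hx, RCLike.inner_apply, starRingEnd_apply, star_star]

lemma sqInt_star {f : Rn n → ℂ} (hf : SqInt Ω f) : SqInt Ω fun x => star (f x) := hf.star

lemma continuous_pair {f : Rn n → ℂ} (hf : SqInt Ω f) : Continuous fun u : L2 Ω => pair u f := by
  simp only [fun u : L2 Ω => pair_eq_inner u (sqInt_star hf)]
  fun_prop

/-- Classical integration by parts. -/
lemma integral_mul_pd {φ ψ : Rn n → ℂ} {S S' : Set (Rn n)} (hφ : IsTest S φ) (hψ : IsTest S' ψ)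
    (i : Fin n) : ∫ x, φ x * pd i ψ x = -∫ x, pd i φ x * ψ x := by
  refine integral_mul_fderiv_eq_neg_fderiv_mul_of_integrable (f := φ) (g := ψ)
    (v := EuclideanSpace.single i 1) ?_ ?_ ?_ (fun x _ => hφ.differentiable x)
    (fun x _ => hψ.differentiable x)
  · exact ((hφ.continuous_pd i).mul hψ.1.continuous).integrable_of_hasCompactSupport hψ.2.mul_left
  · exact (hφ.1.continuous.mul (hψ.continuous_pd i)).integrable_of_hasCompactSupport
      (hasCompactSupport_pd hψ.2 i).mul_left
  · exact (hφ.1.continuous.mul hψ.1.continuous).integrable_of_hasCompactSupport hψ.2.mul_left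

lemma pair_toLp {f g : Rn n → ℂ} (hf : SqInt Ω f)
    (h0 : ∀ x ∉ (Ω : Set (Rn n)), g x = 0) : pair (hf.toLp f : L2 Ω) g = ∫ x, f x * g x := by
  have h1 := setIntegral_eq_integral_of_forall_compl_eq_zero (μ := (volume : Measure (Rn n)))
    (s := (Ω : Set (Rn n))) (f := fun x => f x * g x) fun x hx => by rw [h0 x hx, mul_zero]
  rw [pair, ← h1]
  refine integral_congr_ae ?_
  filter_upwards [MemLp.coeFn_toLp hf] with x hx
  rw [hx]

lemma hasWeakGradient_of_mem {z : L2 Ω × (Fin n → L2 Ω)}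
    (hz : z ∈ (testGradients Ω).topologicalClosure) : HasWeakGradient z.1 z.2 := by
  intro i φ
  refine gradClosure_induction (p := fun z => pair z.1 (pd i φ) = -pair (z.2 i) φ) ?_ ?_ hz
  · exact isClosed_eq ((continuous_pair (sqInt_pd φ i)).comp continuous_fst)
      (((continuous_pair (sqInt_test φ)).comp ((continuous_apply i).comp continuous_snd)).neg)
  · intro ψ
    have ht := isTest_testFunction φ
    change pair ((sqInt_test ψ).toLp _) _ = -pair ((sqInt_pd ψ i).toLp _) _
    rw [pair_toLp, pair_toLp, integral_mul_pd (isTest_testFunction ψ) ht]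
    · exact fun x hx => image_eq_zero_of_notMem_tsupport fun h => hx (ht.subset h)
    · exact fun x hx => pd_eq_zero_of_notMem (fun h => hx (ht.subset h)) i

/-! ### Regularity of weak solutions -/

/-- Cutting off an element of `H¹₀(Ω)`. -/
lemma extend_cut_mem {z : L2 Ω × (Fin n → L2 Ω)} (hz : z ∈ (testGradients Ω).topologicalClosure)
    {η : Rn n → ℂ} (h : IsCutoff η) {B : Set (Rn n)} (hB : tsupport η ⊆ B) :
    (extend (h.cut z.1), fun i => extend (h.cut (z.2 i) + (h.pd i).cut z.1))
      ∈ testClosure ((Ω : Set (Rn n)) ∩ B) := by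
  refine gradClosure_induction (p := fun z =>
    (extend (h.cut z.1), fun i => extend (h.cut (z.2 i) + (h.pd i).cut z.1))
      ∈ testClosure ((Ω : Set (Rn n)) ∩ B)) ?_ ?_ hz
  · refine IsClosed.preimage (f := fun z : L2 Ω × (Fin n → L2 Ω) =>
      ((extend (h.cut z.1), fun i => extend (h.cut (z.2 i) + (h.pd i).cut z.1)) :
        FullL2 n × (Fin n → FullL2 n))) ?_ (testPairs _).isClosed_topologicalClosure
    have := (extend (Ω := Ω)).continuous
    fun_prop
  · intro φ
    have hφ := isTest_testFunction φ
    have ht : IsTest ((Ω : Set (Rn n)) ∩ B) fun x => η x * φ x :=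
      ⟨(h.1.of_le (by simp)).mul hφ.1, hφ.2.mul_left, Set.subset_inter
        ((tsupport_mul_subset_right (f := η)).trans hφ.3)
        ((tsupport_mul_subset_left (g := φ)).trans hB)⟩
    have hout : ∀ x ∉ (Ω : Set (Rn n)), x ∉ tsupport fun x => η x * φ x :=
      fun x hx h' => hx (ht.subset h').1
    refine (testPairs _).le_topologicalClosure ⟨_, ht, ?_, fun i => ?_⟩
    · filter_upwards [coeFn_extend (h.cut (testGrad φ).1),
        ae_of_ae_restrict (h.coeFn_cut (testGrad φ).1),
        ae_of_ae_restrict (MemLp.coeFn_toLp (sqInt_test φ))] with x h1 h2 h3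
      rw [h1]
      by_cases hx : x ∈ (Ω : Set (Rn n))
      · rw [Set.indicator_of_mem hx, h2 hx]
        congr 1
        exact h3 hx
      · rw [Set.indicator_of_notMem hx]
        exact (image_eq_zero_of_notMem_tsupport (hout x hx)).symm
    · filter_upwards [coeFn_extend (h.cut ((testGrad φ).2 i) + (h.pd i).cut (testGrad φ).1),
        ae_of_ae_restrict (Lp.coeFn_add (h.cut ((testGrad φ).2 i)) ((h.pd i).cut (testGrad φ).1)),
        ae_of_ae_restrict (h.coeFn_cut ((testGrad φ).2 i)),
        ae_of_ae_restrict ((h.pd i).coeFn_cut (testGrad φ).1),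
        ae_of_ae_restrict (MemLp.coeFn_toLp (sqInt_test φ)),
        ae_of_ae_restrict (MemLp.coeFn_toLp (sqInt_pd φ i))] with x h1 h2 h3 h4 h5 h6
      rw [h1]
      by_cases hx : x ∈ (Ω : Set (Rn n))
      · have h5' : (testGrad φ).1 x = φ x := h5 hx
        have h6' : (testGrad φ).2 i x = pd i φ x := h6 hx
        rw [Set.indicator_of_mem hx, h2 hx, Pi.add_apply, h3 hx, h4 hx, h5', h6',
          pd_mul h.differentiable hφ.differentiable]
      · rw [Set.indicator_of_notMem hx, pd_eq_zero_of_notMem (hout x hx)]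

/-- Complex conjugation of test functions. -/
def conjTest (φ : Rn n → ℂ) (hs : ContDiff ℝ ((⊤ : ℕ∞) : WithTop ℕ∞) φ)
    (h : IsTest (Ω : Set (Rn n)) φ) : 𝓓(Ω, ℂ) :=
  ⟨fun x => star (φ x), Complex.conjCLE.contDiff.comp hs, h.conj.2, h.conj.3⟩

/-- Localization: if `Δu = f` weakly, then `ηu` solves a Dirichlet problem with datum in `L²`,
because the commutator involves only `u` and `∇u`. Extended by zero, it falls under
`exists_hessian_of_support`. -/
lemma cut_mem_H2_of_weak (hn : 0 < n) (hΩ : HasC2Boundary (Ω : Set (Rn n))) {x₀ : Rn n}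
    (hx : x₀ ∈ closure (Ω : Set (Rn n))) :
    ∃ r > 0, ∀ z ∈ (testGradients Ω).topologicalClosure, ∀ f : L2 Ω,
      (∀ φ : 𝓓(Ω, ℂ), ∑ j, pair (z.2 j) (pd j φ) = -pair f φ) →
      ∀ η, ∀ h : IsCutoff η, tsupport η ⊆ Metric.ball x₀ r → h.cut z.1 ∈ H2 Ω := by
  obtain ⟨r, hr, hreg⟩ := exists_hessian_of_support hn hΩ hx
  refine ⟨r, hr, fun z hz f hf η h hη => ?_⟩
  have hgrad := hasWeakGradient_of_mem hz
  set P : Fin n → L2 Ω := fun i => h.cut (z.2 i) + (h.pd i).cut z.1 with hP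
  -- This is `-Δ(ηu) = -(ηf + 2∇η·∇u + uΔη)`.
  set F : L2 Ω := -(h.cut f + ∑ j, ((h.pd j).cut (z.2 j) + (h.pd j).cut (z.2 j)
    + ((h.pd j).pd j).cut z.1)) with hF
  have hdist : ∀ χ : 𝓓(Ω, ℂ), ∑ j, pair (P j) (pd j χ) = pair F χ := by
    intro χ
    have h1 := hf (h.mulTest χ)
    have h2 : ∀ j, pair (P j) (pd j χ) = pair (z.2 j) (pd j (h.mulTest χ))
        - pair ((h.pd j).cut (z.2 j) + (h.pd j).cut (z.2 j) + ((h.pd j).pd j).cut z.1) χ := by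
      intro j
      have h3 := hgrad j ((h.pd j).mulTest χ)
      rw [(h.pd j).pd_mulTest, pair_fun_add _ ((h.pd j).sqInt_mul (sqInt_pd χ j))
        (((h.pd j).pd j).sqInt_mul (sqInt_test χ)), (h.pd j).mulTest_coe] at h3
      rw [h.pd_mulTest, pair_fun_add _ (h.sqInt_mul (sqInt_pd χ j))
        ((h.pd j).sqInt_mul (sqInt_test χ)), pair_add _ _ (sqInt_pd χ j),
        pair_add _ _ (sqInt_test χ), pair_add _ _ (sqInt_test χ), h.pair_cut, (h.pd j).pair_cut,
        (h.pd j).pair_cut, ((h.pd j).pd j).pair_cut]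
      linear_combination h3
    rw [Finset.sum_congr rfl fun j _ => h2 j, Finset.sum_sub_distrib, h1, hF, pair_neg,
      pair_add _ _ (sqInt_test χ), pair_sum _ _ (sqInt_test χ), h.pair_cut, h.mulTest_coe]
    ring
  have hweak : ∀ w ∈ testClosure (Ω : Set (Rn n)),
      ∑ j, inner ℂ (w.2 j) (extend (P j)) = inner ℂ w.1 (extend F) := by
    intro w hw
    refine testClosure_induction_smooth Ω.isOpen (p := fun w =>
      ∑ j, inner ℂ (w.2 j) (extend (P j)) = inner ℂ w.1 (extend F))
      (isClosed_eq (by fun_prop) (by fun_prop)) (fun φ hφ hs => ?_) hw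
    -- The inner product is conjugate linear in the test function, while `pair` is bilinear.
    have h1 := hdist (conjTest φ hs hφ)
    refine (Finset.sum_congr rfl fun j _ => ?_).trans (h1.trans ?_)
    · refine (inner_cls_extend (hφ.memLp_pd volume j) (P j)).trans ?_
      rw [← hφ.pd_conj]; rfl
    · exact (inner_cls_extend (hφ.memLp volume) F).symm
  choose q hq using hreg _ _ _ (extend_cut_mem hz h hη) hweak
  refine ⟨fun i j => restr (q i j), P, hgrad.cut h, fun i j φ => ?_⟩
  have hφ := (isTest_testFunction φ).conj
  have h1 := hq i j _ hφ
  rw [ip_extend, ip_eq_pair_restr _ hφ, ← star_neg, (isTest_testFunction φ).pd_conj] at h1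
  simpa only [star_star] using star_injective h1

/-- `H²` regularity of weak solutions of the Dirichlet problem. -/
theorem mem_H2_of_weak (hn : 0 < n) (hΩb : Bornology.IsBounded (Ω : Set (Rn n)))
    (hΩ : HasC2Boundary (Ω : Set (Rn n))) {z : L2 Ω × (Fin n → L2 Ω)}
    (hz : z ∈ (testGradients Ω).topologicalClosure) {f : L2 Ω}
    (hf : ∀ φ : 𝓓(Ω, ℂ), ∑ j, pair (z.2 j) (pd j φ) = -pair f φ) : z.1 ∈ H2 Ω := by
  have key : ∃ η, ∃ h : IsCutoff η, (∀ x ∈ closure (Ω : Set (Rn n)), η x = 1) ∧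
      h.cut z.1 ∈ H2 Ω := by
    -- The property passes to subsets and unions, so it need only hold near each point of the
    -- closure.
    refine IsCompact.induction_on (p := fun s => ∃ η, ∃ h : IsCutoff η, (∀ x ∈ s, η x = 1) ∧
      h.cut z.1 ∈ H2 Ω) hΩb.isCompact_closure ?_ ?_ ?_ ?_
    · refine ⟨fun _ => 0, ⟨contDiff_const, HasCompactSupport.zero⟩, by simp, ?_⟩
      convert (H2 Ω).zero_mem
      refine Lp.ext ?_
      filter_upwards [IsCutoff.coeFn_cut (Ω := Ω) ⟨contDiff_const, HasCompactSupport.zero⟩ z.1,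
        Lp.coeFn_zero ℂ 2 (volume.restrict (Ω : Set (Rn n)))] with x h1 h2
      rw [h1, h2]
      exact zero_mul _
    · rintro s t hst ⟨η, h, h1, h2⟩
      exact ⟨η, h, fun x hx => h1 x (hst hx), h2⟩
    · rintro s t ⟨η, h, h1, h2⟩ ⟨ζ, k, k1, k2⟩
      -- `1 - (1 - η)(1 - ζ)` equals `1` wherever one of the two does.
      have hk : IsCutoff fun x => η x + ζ x - η x * ζ x :=
        ⟨(h.1.add k.1).sub (h.1.mul k.1), (h.2.add k.2).sub h.2.mul_right⟩
      refine ⟨_, hk, ?_, ?_⟩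
      · rintro x (hx | hx)
        · rw [h1 x hx]; ring
        · rw [k1 x hx]; ring
      · have : hk.cut z.1 = h.cut z.1 + k.cut z.1 - h.cut (k.cut z.1) := by
          refine Lp.ext ?_
          filter_upwards [hk.coeFn_cut z.1, h.coeFn_cut z.1, k.coeFn_cut z.1,
            h.coeFn_cut (k.cut z.1), Lp.coeFn_add (h.cut z.1) (k.cut z.1),
            Lp.coeFn_sub (h.cut z.1 + k.cut z.1) (h.cut (k.cut z.1))] with x e1 e2 e3 e4 e5 e6
          rw [e1, e6, Pi.sub_apply, e5, Pi.add_apply, e2, e4, e3]; ring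
        rw [this]
        exact (H2 Ω).sub_mem ((H2 Ω).add_mem h2 k2) (cut_mem_H2 k2 h)
    · intro x hx
      obtain ⟨r, hr, hreg⟩ := cut_mem_H2_of_weak hn hΩ hx
      let b : ContDiffBump x := ⟨r / 3, r / 2, by positivity, by linarith⟩
      have hb : IsCutoff fun y => (b y : ℂ) :=
        ⟨Complex.ofRealCLM.contDiff.comp b.contDiff,
          b.hasCompactSupport.comp_left (g := fun r : ℝ => (r : ℂ)) Complex.ofReal_zero⟩
      refine ⟨Metric.closedBall x (r / 3),
        mem_nhdsWithin_of_mem_nhds (Metric.closedBall_mem_nhds x (by positivity)), _, hb,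
        fun y hy => ?_, hreg z hz f hf _ hb ?_⟩
      · rw [b.one_of_mem_closedBall hy, Complex.ofReal_one]
      · refine (closure_mono (Function.support_comp_subset (g := fun r : ℝ => (r : ℂ))
          Complex.ofReal_zero b)).trans ?_
        change tsupport b ⊆ _
        rw [b.tsupport_eq]
        exact Metric.closedBall_subset_ball (by change r / 2 < r; linarith)
  obtain ⟨η, h, h1, h2⟩ := key
  convert h2
  refine Lp.ext ?_
  filter_upwards [h.coeFn_cut z.1, ae_restrict_mem Ω.isOpen.measurableSet] with x e1 e2
  rw [e1, h1 x (subset_closure e2), one_mul]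

/-! ### The Poincaré inequality -/

lemma extend_toLp {f : Rn n → ℂ} (hf : SqInt Ω f) (hf' : MemLp f 2 volume)
    (h0 : ∀ x ∉ (Ω : Set (Rn n)), f x = 0) : extend (hf.toLp f : L2 Ω) = hf'.toLp f := by
  refine Lp.ext ?_
  filter_upwards [coeFn_extend (hf.toLp f : L2 Ω), MemLp.coeFn_toLp hf',
    ae_of_ae_restrict (MemLp.coeFn_toLp hf)] with x h1 h2 h3
  rw [h1, h2]
  by_cases hx : x ∈ (Ω : Set (Rn n))
  · rw [Set.indicator_of_mem hx, h3 hx]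
  · rw [Set.indicator_of_notMem hx, h0 x hx]

/-- The zero profile makes `shift` a translation, and a translation by `2M` moves the support off
itself. The translate is then orthogonal to `φ`, so the difference has norm at least `‖φ‖`, while
the gradient bounds it from above. -/
lemma norm_cls_le {S : Set (Rn n)} {φ : Rn n → ℂ} (hφ : IsTest S φ) {M : ℝ} (hM : 0 ≤ M)
    (hS : S ⊆ Metric.ball 0 M) (k : Fin n) : ‖hφ.cls‖ ≤ 2 * M * ‖hφ.clsPd k‖ := by
  set h := IsProfile.zero k
  have hmem : (hφ.cls, hφ.clsPd) ∈ testClosure S :=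
    (testPairs S).le_topologicalClosure hφ.mem_testPairs
  have h1 := h.norm_shiftOp_sub_le hmem k (2 * M)
  rw [zero_mul, add_zero, abs_of_nonneg (by positivity)] at h1
  have horth : inner ℂ (h.shiftOp ((2 * M) • unit k) hφ.cls) hφ.cls = 0 := by
    rw [L2.inner_def]
    refine integral_eq_zero_of_ae ?_
    filter_upwards [h.coeFn_shiftOp ((2 * M) • unit k) hφ.cls,
      (h.measurePreserving_shift ((2 * M) • unit k)).quasiMeasurePreserving.ae_eq_comp
        (MemLp.coeFn_toLp (hφ.memLp volume)), MemLp.coeFn_toLp (hφ.memLp volume)] with y e1 e2 e3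
    have e2' : hφ.cls (shift k (fun _ => 0) ((2 * M) • unit k) y)
      = φ (shift k (fun _ => 0) ((2 * M) • unit k) y) := e2
    have e3' : hφ.cls y = φ y := e3
    rw [e1, e2', e3']
    have : shift k (fun _ => 0) ((2 * M) • unit k) y = y + (2 * M) • unit k := by simp [shift]
    rw [this]
    by_cases hy : y ∈ tsupport φ
    · have hy' : y + (2 * M) • unit k ∉ tsupport φ := by
        intro hy'
        have b1 := mem_ball_zero_iff.1 (hS (hφ.subset hy))
        have b2 := mem_ball_zero_iff.1 (hS (hφ.subset hy'))
        have b3 := norm_sub_le (y + (2 * M) • unit k) y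
        rw [add_sub_cancel_left, norm_smul, IsProfile.norm_unit, mul_one,
          Real.norm_of_nonneg (by positivity)] at b3
        linarith
      simp [image_eq_zero_of_notMem_tsupport hy']
    · simp [image_eq_zero_of_notMem_tsupport hy]
  have h2 := norm_sub_sq (𝕜 := ℂ) (h.shiftOp ((2 * M) • unit k) hφ.cls) hφ.cls
  rw [horth, LinearIsometry.norm_map] at h2
  simp only [map_zero, mul_zero, sub_zero] at h2
  have h3 : ‖hφ.cls‖ ≤ ‖h.shiftOp ((2 * M) • unit k) hφ.cls - hφ.cls‖ :=
    le_of_sq_le_sq (by rw [h2]; linarith [sq_nonneg ‖hφ.cls‖]) (norm_nonneg _)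
  calc _ ≤ _ := h3
    _ ≤ _ := h1
    _ = _ := mul_comm _ _

/-- The Poincaré inequality on a bounded open set. -/
lemma exists_poincare (hΩb : Bornology.IsBounded (Ω : Set (Rn n))) (k : Fin n) :
    ∃ C, 0 ≤ C ∧ ∀ z ∈ (testGradients Ω).topologicalClosure, ‖z.1‖ ≤ C * ‖z.2 k‖ := by
  obtain ⟨M, hM0, hM⟩ := hΩb.subset_ball_lt 0 0
  refine ⟨2 * M, by positivity, fun z hz => ?_⟩
  refine gradClosure_induction (p := fun z => ‖z.1‖ ≤ 2 * M * ‖z.2 k‖)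
    (isClosed_le (by fun_prop) (by fun_prop)) (fun φ => ?_) hz
  have hφ := isTest_testFunction φ
  have h1 := norm_cls_le hφ hM0.le hM k
  have h2 : extend (testGrad φ).1 = hφ.cls :=
    extend_toLp (sqInt_test φ) (hφ.memLp volume) fun x hx =>
    image_eq_zero_of_notMem_tsupport fun h => hx (hφ.subset h)
  have h3 : extend ((testGrad φ).2 k) = hφ.clsPd k :=
    extend_toLp (sqInt_pd φ k) (hφ.memLp_pd volume k) fun x hx =>
    pd_eq_zero_of_notMem (fun h => hx (hφ.subset h)) k
  rwa [← h2, ← h3, LinearIsometry.norm_map, LinearIsometry.norm_map] at h1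

/-! ### Weak solutions -/

/-- Pairs `(φ, ∇φ)` with `φ ∈ H¹₀(Ω)`. -/
abbrev gradClosure (Ω : Opens (Rn n)) : Submodule ℂ (L2 Ω × (Fin n → L2 Ω)) :=
  (testGradients Ω).topologicalClosure

lemma fst_eq_zero_of_sum_inner_eq_zero (hn : 0 < n) (hΩb : Bornology.IsBounded (Ω : Set (Rn n)))
    {z : L2 Ω × (Fin n → L2 Ω)} (hz : z ∈ gradClosure Ω)
    (h : ∑ j, inner ℂ (z.2 j) (z.2 j) = 0) : z.1 = 0 := by
  obtain ⟨C, -, hpoin⟩ := exists_poincare hΩb (⟨0, hn⟩ : Fin n)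
  have h1 : ∑ j, ‖z.2 j‖ ^ 2 = 0 := by
    have := congrArg Complex.re h
    rw [Complex.re_sum] at this
    exact (Finset.sum_congr rfl fun j _ =>
      InnerProductSpace.norm_sq_eq_re_inner (𝕜 := ℂ) _).trans this
  have h2 := (Finset.sum_eq_zero_iff_of_nonneg fun j _ => sq_nonneg _).1 h1 ⟨0, hn⟩
    (Finset.mem_univ _)
  have h3 := hpoin z hz
  rw [pow_eq_zero_iff two_ne_zero] at h2
  rw [h2, mul_zero] at h3
  exact norm_le_zero_iff.1 h3

/-- The conjugate of a test function. -/
def starTest (φ : 𝓓(Ω, ℂ)) : 𝓓(Ω, ℂ) := conjTest φ φ.contDiff (isTest_testFunction φ)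

lemma pair_test_eq_inner (u : L2 Ω) (φ : 𝓓(Ω, ℂ)) :
    pair u φ = inner ℂ (testGrad (starTest φ)).1 u :=
  pair_eq_inner u (sqInt_star (sqInt_test φ))

lemma pair_pd_eq_inner (u : L2 Ω) (φ : 𝓓(Ω, ℂ)) (i : Fin n) :
    pair u (pd i φ) = inner ℂ ((testGrad (starTest φ)).2 i) u := by
  rw [pair_eq_inner u (sqInt_star (sqInt_pd φ i))]
  congr 1
  exact MemLp.toLp_congr (sqInt_star (sqInt_pd φ i)) (sqInt_pd (starTest φ) i)
    (Eventually.of_forall fun x => (congrFun ((isTest_testFunction φ).pd_conj i) x).symm)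

lemma starTest_starTest (φ : 𝓓(Ω, ℂ)) : starTest (starTest φ) = φ :=
  TestFunction.ext fun x => star_star (φ x)

/-- A divergence form equation in the sense of distributions holds with test functions in
`H¹₀(Ω)`. -/
lemma weak_iff (P : Fin n → L2 Ω) (h : L2 Ω) :
    (∀ φ : 𝓓(Ω, ℂ), ∑ j, pair (P j) (pd j φ) = pair h φ) ↔
      ∀ w ∈ gradClosure Ω, ∑ j, inner ℂ (w.2 j) (P j) = inner ℂ w.1 h := by
  constructor
  · intro H w hw
    refine gradClosure_induction (p := fun w => ∑ j, inner ℂ (w.2 j) (P j) = inner ℂ w.1 h)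
      (isClosed_eq (by fun_prop) (by fun_prop)) (fun φ => ?_) hw
    have := H (starTest φ)
    simpa only [pair_test_eq_inner, pair_pd_eq_inner, starTest_starTest] using this
  · intro H φ
    simp only [pair_test_eq_inner, pair_pd_eq_inner]
    exact H _ (testGrad_mem _)

/-- Weak solvability of divergence form equations in `H¹₀(Ω)`. -/
lemma exists_weak_solution (hn : 0 < n) (hΩb : Bornology.IsBounded (Ω : Set (Rn n))) (g : L2 Ω)
    (b : Fin n → L2 Ω) : ∃ z ∈ gradClosure Ω, ∀ w ∈ gradClosure Ω,
      ∑ j, inner ℂ (w.2 j) (z.2 j) = inner ℂ w.1 g + ∑ j, inner ℂ (w.2 j) (b j) := by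
  obtain ⟨C, hC, hpoin⟩ := exists_poincare hΩb (⟨0, hn⟩ : Fin n)
  -- Only the gradient enters the form, so Riesz is applied in the space `K` of gradients, with the
  -- Hilbert norm of `PiLp 2`.
  let T : L2 Ω × (Fin n → L2 Ω) →ₗ[ℂ] PiLp 2 fun _ : Fin n => L2 Ω :=
    (WithLp.linearEquiv 2 ℂ (Fin n → L2 Ω)).symm.toLinearMap ∘ₗ LinearMap.snd ℂ _ _
  let K : Submodule ℂ (PiLp 2 fun _ : Fin n => L2 Ω) := (gradClosure Ω).map T
  have hpoin' : ∀ z ∈ gradClosure Ω, ‖z.1‖ ≤ C * ‖T z‖ := fun z hz =>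
    (hpoin z hz).trans (mul_le_mul_of_nonneg_left (PiLp.norm_apply_le (T z) ⟨0, hn⟩) hC)
  have hKex : ∀ q : K, ∃ z, z ∈ gradClosure Ω ∧ T z = q := fun q => q.2
  choose σ hσ hσT using hKex
  have huniq : ∀ z ∈ gradClosure Ω, ∀ z' ∈ gradClosure Ω, T z = T z' → z.1 = z'.1 := by
    intro z hz z' hz' hT
    have := hpoin' _ ((gradClosure Ω).sub_mem hz hz')
    rw [map_sub, hT, sub_self, norm_zero, mul_zero] at this
    exact sub_eq_zero.1 (norm_le_zero_iff.1 this)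
  -- By Poincaré the gradient determines the function, and does so boundedly; the same inequality
  -- makes `K` closed.
  let S : K →L[ℂ] L2 Ω := LinearMap.mkContinuous
    { toFun := fun q => (σ q).1
      map_add' := fun q r => huniq _ (hσ _) _ ((gradClosure Ω).add_mem (hσ q) (hσ r)) (by
        rw [map_add, hσT, hσT, hσT]; rfl)
      map_smul' := fun c q => huniq _ (hσ _) _ ((gradClosure Ω).smul_mem c (hσ q)) (by
        rw [map_smul, hσT, hσT]; rfl) } C fun q => by
      have := hpoin' _ (hσ q)
      rwa [hσT] at this
  have hKc : IsClosed (K : Set (PiLp 2 fun _ : Fin n => L2 Ω)) := by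
    refine isClosed_of_closure_subset fun q hq => ?_
    obtain ⟨x, hx, hlim⟩ := mem_closure_iff_seq_limit.1 hq
    choose z hz hzT using hx
    have hcau : CauchySeq fun m => (z m).1 := by
      have h1 : CauchySeq x := hlim.cauchySeq
      rw [Metric.cauchySeq_iff'] at h1 ⊢
      intro ε hε
      obtain ⟨N, hN⟩ := h1 (ε / (C + 1)) (by positivity)
      refine ⟨N, fun m hm => ?_⟩
      have h2 := hpoin' _ ((gradClosure Ω).sub_mem (hz m) (hz N))
      rw [map_sub, hzT, hzT, ← dist_eq_norm] at h2
      have h3 := hN m hm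
      rw [lt_div_iff₀ (by positivity)] at h3
      rw [dist_eq_norm]
      refine h2.trans_lt ?_
      nlinarith [dist_nonneg (x := x m) (y := x N)]
    obtain ⟨u, hu⟩ := cauchySeq_tendsto_of_complete hcau
    refine ⟨(u, fun j => q j), ?_, rfl⟩
    refine (testGradients Ω).isClosed_topologicalClosure.mem_of_tendsto (f := z)
      (b := atTop) ?_ (Eventually.of_forall hz)
    refine hu.prodMk_nhds (tendsto_pi_nhds.2 fun j => ?_)
    have : Continuous fun q : PiLp 2 (fun _ : Fin n => L2 Ω) => q j := by fun_prop
    refine ((this.tendsto q).comp hlim).congr fun m => ?_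
    rw [Function.comp_apply, ← hzT]
    rfl
  have : CompleteSpace K := hKc.completeSpace_coe
  let β : PiLp 2 fun _ : Fin n => L2 Ω := WithLp.toLp 2 b
  let ℓ : K →L[ℂ] ℂ := (innerSL ℂ g).comp S + (innerSL ℂ β).comp K.subtypeL
  set q := (InnerProductSpace.toDual ℂ K).symm ℓ with hq
  refine ⟨σ q, hσ q, fun w hw => ?_⟩
  have h1 : inner ℂ q (⟨T w, w, hw, rfl⟩ : K) = ℓ ⟨T w, w, hw, rfl⟩ :=
    InnerProductSpace.toDual_symm_apply
  have h2 : ℓ ⟨T w, w, hw, rfl⟩ = inner ℂ g w.1 + inner ℂ β (T w) := by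
    have : S ⟨T w, w, hw, rfl⟩ = w.1 := huniq _ (hσ _) _ hw (hσT _)
    rw [← this]; rfl
  rw [h2, Submodule.coe_inner, ← hσT q, PiLp.inner_apply, PiLp.inner_apply] at h1
  have h3 := congrArg (starRingEnd ℂ) h1
  simp only [map_sum, map_add, inner_conj_symm] at h3
  exact h3

/-- Uniqueness of weak gradients. -/
lemma HasWeakGradient.unique {u : L2 Ω} {p q : Fin n → L2 Ω} (hp : HasWeakGradient u p)
    (hq : HasWeakGradient u q) : p = q := funext fun i => (hp i).unique (hq i)

lemma exists_gradClosure_of_mem_H10 {u : L2 Ω} (hu : u ∈ H10 Ω) :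
    ∃ z ∈ gradClosure Ω, z.1 = u := hu

lemma mem_H10_of_gradClosure {z : L2 Ω × (Fin n → L2 Ω)} (hz : z ∈ gradClosure Ω) :
    z.1 ∈ H10 Ω := ⟨z, hz, rfl⟩

/-- Green's formula for `v ∈ H²(Ω)` and test functions in `H¹₀(Ω)`. -/
lemma inner_lap (v : H2 Ω) {p : Fin n → L2 Ω} (hp : HasWeakGradient (v : L2 Ω) p)
    {w : L2 Ω × (Fin n → L2 Ω)} (hw : w ∈ gradClosure Ω) :
    inner ℂ w.1 (lap v) = -∑ j, inner ℂ (w.2 j) (p j) := by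
  obtain ⟨q, p', hp', hq⟩ := v.2
  obtain rfl := hp.unique hp'
  have h1 := (weak_iff p (-lap v)).1 (fun φ => by
    rw [lap_eq v ⟨p, hp, hq⟩, pair_neg, pair_sum _ _ (sqInt_test φ), ← Finset.sum_neg_distrib]
    exact Finset.sum_congr rfl fun i _ => hq i i φ) w hw
  rw [h1, inner_neg_right, neg_neg]

/-- Unique solvability of the Dirichlet problem in `H²(Ω) ∩ H¹₀(Ω)`: existence. -/
lemma exists_lap_eq (hn : 0 < n) (hΩb : Bornology.IsBounded (Ω : Set (Rn n)))
    (hΩ : HasC2Boundary (Ω : Set (Rn n))) (f : L2 Ω) :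
    ∃ u : H2H10 Ω, lap ⟨(u : L2 Ω), u.2.1⟩ = f := by
  -- The form `∑ ⟨∂ⱼw, ∂ⱼz⟩` represents `-Δz`, hence the datum `-f`.
  obtain ⟨z, hz, hweak⟩ := exists_weak_solution hn hΩb (-f) 0
  have hw := (weak_iff z.2 (-f)).2 fun w hw => by simpa using hweak w hw
  have hH2 : z.1 ∈ H2 Ω := mem_H2_of_weak (f := f) hn hΩb hΩ hz fun φ => by rw [hw φ, pair_neg]
  refine ⟨⟨z.1, hH2, mem_H10_of_gradClosure hz⟩, ?_⟩
  rw [← sub_eq_zero]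
  refine eq_zero_of_pair_test _ fun φ => ?_
  have h1 := inner_lap ⟨z.1, hH2⟩ (hasWeakGradient_of_mem hz) (testGrad_mem (starTest φ))
  have h2 := hweak _ (testGrad_mem (starTest φ))
  rw [pair_test_eq_inner, inner_sub_right, h1, h2]
  simp

/-- Unique solvability of the Dirichlet problem in `H²(Ω) ∩ H¹₀(Ω)`: uniqueness. -/
lemma eq_zero_of_lap_eq_zero (hn : 0 < n) (hΩb : Bornology.IsBounded (Ω : Set (Rn n)))
    (u : H2H10 Ω) (hu : lap ⟨(u : L2 Ω), u.2.1⟩ = 0) : u = 0 := by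
  obtain ⟨z, hz, hzu⟩ := exists_gradClosure_of_mem_H10 u.2.2
  have hg := hasWeakGradient_of_mem hz
  rw [hzu] at hg
  have h1 := inner_lap ⟨(u : L2 Ω), u.2.1⟩ hg hz
  rw [hu, inner_zero_right, eq_comm, neg_eq_zero] at h1
  have h2 := fst_eq_zero_of_sum_inner_eq_zero hn hΩb hz h1
  exact Subtype.ext (hzu.symm.trans h2)

/-! ### The energy space is a Hilbert space -/

namespace EnergySpace

lemma eq_zero_of_norm_eq_zero (hn : 0 < n) (hΩb : Bornology.IsBounded (Ω : Set (Rn n)))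
    (z : EnergySpace Ω) (hz : ‖z‖ = 0) : z = 0 := by
  have h1 := norm_sq z
  rw [hz] at h1
  have h2 : z.lapDisp = 0 := by
    rw [← norm_eq_zero]; nlinarith [norm_nonneg z.lapDisp, norm_nonneg z.vel]
  have h3 : z.vel = 0 := by
    rw [← norm_eq_zero]; nlinarith [norm_nonneg z.lapDisp, norm_nonneg z.vel]
  exact Prod.ext (eq_zero_of_lap_eq_zero hn hΩb z.1 h2) h3

lemma lapDisp_sub (z w : EnergySpace Ω) : (z - w).lapDisp = z.lapDisp - w.lapDisp := by
  rw [sub_eq_add_neg, ← neg_one_smul ℂ w, lapDisp_add, lapDisp_smul, neg_one_smul, sub_eq_add_neg]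

lemma vel_sub (z w : EnergySpace Ω) : (z - w).vel = z.vel - w.vel := rfl

lemma norm_lapDisp_le (z : EnergySpace Ω) : ‖z.lapDisp‖ ≤ ‖z‖ :=
  le_of_sq_le_sq (by rw [norm_sq]; linarith [sq_nonneg ‖z.vel‖]) (norm_nonneg _)

lemma norm_vel_le (z : EnergySpace Ω) : ‖z.vel‖ ≤ ‖z‖ :=
  le_of_sq_le_sq (by rw [norm_sq]; linarith [sq_nonneg ‖z.lapDisp‖]) (norm_nonneg _)

lemma norm_le (z : EnergySpace Ω) : ‖z‖ ≤ ‖z.lapDisp‖ + ‖z.vel‖ :=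
  le_of_sq_le_sq (by
    rw [norm_sq]; nlinarith [norm_nonneg z.lapDisp, norm_nonneg z.vel]) (by positivity)

/-- The energy norm sees only `Δu` and `v`, and the `L²` limit of the Laplacians is again `Δu` for
some `u ∈ H² ∩ H₀¹` because the Laplacian is onto. -/
lemma completeSpace (hn : 0 < n) (hΩb : Bornology.IsBounded (Ω : Set (Rn n)))
    (hΩ : HasC2Boundary (Ω : Set (Rn n))) : CompleteSpace (EnergySpace Ω) := by
  refine Metric.complete_of_cauchySeq_tendsto fun x hx => ?_
  have hc : ∀ F : EnergySpace Ω → L2 Ω, (∀ z w, F (z - w) = F z - F w) → (∀ z, ‖F z‖ ≤ ‖z‖) →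
      ∃ u, Tendsto (fun m => F (x m)) atTop (𝓝 u) := by
    intro F hsub hle
    refine cauchySeq_tendsto_of_complete ?_
    rw [Metric.cauchySeq_iff'] at hx ⊢
    intro ε hε
    obtain ⟨N, hN⟩ := hx ε hε
    refine ⟨N, fun m hm => lt_of_le_of_lt ?_ (hN m hm)⟩
    rw [dist_eq_norm, dist_eq_norm, ← hsub]
    exact hle _
  obtain ⟨f, hf⟩ := hc lapDisp lapDisp_sub norm_lapDisp_le
  obtain ⟨v, hv⟩ := hc vel vel_sub norm_vel_le
  obtain ⟨u, hu⟩ := exists_lap_eq hn hΩb hΩ f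
  let z : EnergySpace Ω := ((u, v) : ↥(H2H10 Ω) × L2 Ω)
  have hz1 : z.lapDisp = f := hu
  have hz2 : z.vel = v := rfl
  refine ⟨z, tendsto_iff_norm_sub_tendsto_zero.2 ?_⟩
  have h1 := (tendsto_iff_norm_sub_tendsto_zero.1 hf).add (tendsto_iff_norm_sub_tendsto_zero.1 hv)
  rw [add_zero] at h1
  refine squeeze_zero (fun m => norm_nonneg _) (fun m => ?_) h1
  have h2 := norm_le (x m - z)
  rwa [lapDisp_sub, vel_sub, hz1, hz2] at h2

end EnergySpace

/-! ### The plate operator is dissipative and bijective -/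

lemma aestronglyMeasurable_damping (ω : Opens (Rn n)) (d : ℝ) (μ : Measure (Rn n)) :
    AEStronglyMeasurable (damping (ω : Set (Rn n)) d) μ :=
  (stronglyMeasurable_const.indicator ω.isOpen.measurableSet).aestronglyMeasurable

lemma norm_damping_le (ω : Opens (Rn n)) (d : ℝ) (x : Rn n) :
    ‖damping (ω : Set (Rn n)) d x‖ ≤ |d| := by
  rw [damping]
  refine (norm_indicator_le_norm_self _ _).trans ?_
  rw [Complex.norm_real, Real.norm_eq_abs]

/-- Multiplication by the damping coefficient. -/
def dampingOp (ω : Opens (Rn n)) (d : ℝ) : L2 Ω →L[ℂ] L2 Ω :=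
  mulOp _ (aestronglyMeasurable_damping ω d _) |d| (norm_damping_le ω d)

lemma re_inner_dampingOp_nonneg (ω : Opens (Rn n)) {d : ℝ} (hd : 0 ≤ d) (p : L2 Ω) :
    0 ≤ (inner ℂ p (dampingOp ω d p)).re := by
  rw [L2.inner_def]
  have h1 := Complex.reCLM.integral_comp_comm (L2.integrable_inner (𝕜 := ℂ) p (dampingOp ω d p))
  rw [Complex.reCLM_apply] at h1
  rw [← h1]
  refine integral_nonneg_of_ae ?_
  filter_upwards [coeFn_mulOp _ (aestronglyMeasurable_damping ω d _) |d| (norm_damping_le ω d) p]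
    with x hx
  have hx' : dampingOp ω d p x = damping (ω : Set (Rn n)) d x * p x := hx
  rw [hx', Pi.zero_apply, Complex.reCLM_apply, RCLike.inner_apply, mul_assoc, RCLike.mul_conj]
  by_cases h : x ∈ (ω : Set (Rn n))
  · rw [damping, Set.indicator_of_mem h, Complex.re_ofReal_mul]
    refine mul_nonneg hd ?_
    rw [← RCLike.ofReal_pow]
    exact (sq_nonneg ‖p x‖).trans_eq (Complex.ofReal_re _).symm
  · rw [damping, Set.indicator_of_notMem h]
    simp

lemma pair_dampingOp (ω : Opens (Rn n)) (d : ℝ) (p : L2 Ω) (f : Rn n → ℂ) :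
    pair (dampingOp ω d p) f = pair p fun x => damping (ω : Set (Rn n)) d x * f x := by
  refine integral_congr_ae ?_
  filter_upwards [coeFn_mulOp _ (aestronglyMeasurable_damping ω d _) |d| (norm_damping_le ω d) p]
    with x hx
  have hx' : dampingOp ω d p x = damping (ω : Set (Rn n)) d x * p x := hx
  rw [hx']; ring

/-- The partial derivative of a test function, as a test function. -/
def pdTest (φ : 𝓓(Ω, ℂ)) (i : Fin n) : 𝓓(Ω, ℂ) :=
  ⟨pd i φ, contDiff_pd φ.contDiff i, hasCompactSupport_pd φ.hasCompactSupport i,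
    (closure_minimal (fun x (hx : pd i φ x ≠ 0) => by_contra fun h => hx (pd_eq_zero_of_notMem h i))
      (isClosed_tsupport _)).trans φ.tsupport_subset⟩

/-- Variational form of the force equation. -/
lemma isForce_iff (ω : Opens (Rn n)) (d : ℝ) {W : L2 Ω × (Fin n → L2 Ω)} (hW : W ∈ gradClosure Ω)
    (p : Fin n → L2 Ω) (h : L2 Ω) :
    IsForce ω d W.1 p h ↔ ∀ w ∈ gradClosure Ω,
      ∑ j, inner ℂ (w.2 j) (W.2 j - dampingOp ω d (p j)) = -inner ℂ w.1 h := by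
  have hgrad := hasWeakGradient_of_mem hW
  have hiff := weak_iff (fun j => W.2 j - dampingOp ω d (p j)) (-h)
  simp only [inner_neg_right] at hiff
  rw [← hiff]
  refine forall_congr' fun φ => ?_
  -- One derivative of `Δφ` moves onto `W`, since each `∂ⱼφ` is a test function.
  have h1 : pair W.1 (classicalLaplacian φ) = -∑ j, pair (W.2 j) (pd j φ) := by
    have h2 : ∀ s : Finset (Fin n), pair W.1 (fun x => ∑ i ∈ s, pd i (pd i φ) x)
        = -∑ j ∈ s, pair (W.2 j) (pd j φ) := by
      intro s
      induction s using Finset.induction_on with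
      | empty => simp [pair]
      | insert i s his ih =>
        simp only [Finset.sum_insert his]
        rw [pair_fun_add W.1 (f := pd i (pd i φ)) (g := fun x => ∑ i ∈ s, pd i (pd i φ) x)
          (sqInt_pd (pdTest φ i) i) (memLp_finsetSum _ fun j _ => sqInt_pd (pdTest φ j) j), ih,
          neg_add]
        congr 1
        exact hgrad i (pdTest φ i)
    exact h2 Finset.univ
  have h2 : ∀ j, pair (W.2 j - dampingOp ω d (p j)) (pd j φ) = pair (W.2 j) (pd j φ)
      - pair (p j) (fun x => damping (ω : Set (Rn n)) d x * pd j φ x) := by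
    intro j
    rw [sub_eq_add_neg, pair_add _ _ (sqInt_pd φ j), pair_neg, pair_dampingOp, sub_eq_add_neg]
  rw [h1, pair_neg, Finset.sum_congr rfl fun j _ => h2 j, Finset.sum_sub_distrib]
  constructor
  · intro H; linear_combination -H
  · intro H; linear_combination -H

/-- Let `W = Δu` and let `g` be the second component of `y`. Testing the force equation with `v`
gives `∑ ⟨∂ⱼv, ∂ⱼW - a∂ⱼv⟩ = ⟨v, g⟩`, and Green's formula gives `⟨W, Δv⟩ = -∑ ⟨∂ⱼW, ∂ⱼv⟩`. In the
real part of the sum only `-∫ a|∇v|²` remains. -/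
lemma re_inner_plateGraph_nonpos {ω : Opens (Rn n)} {d : ℝ} (hd : 0 ≤ d) {x y : EnergySpace Ω}
    (h : (x, y) ∈ plateGraph Ω ω d) : (inner ℂ x y).re ≤ 0 := by
  obtain ⟨h1, h2, p, hp, h3⟩ := h
  simp only at h1 h2 hp h3
  obtain ⟨W, hW, hWx⟩ := exists_gradClosure_of_mem_H10 h1
  have hvel : x.vel ∈ H10 Ω := h2 ▸ y.1.2.2
  obtain ⟨V, hV, hVx⟩ := exists_gradClosure_of_mem_H10 hvel
  have hVg := hasWeakGradient_of_mem hV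
  rw [hVx] at hVg
  obtain rfl := hp.unique hVg
  rw [← hWx] at h3
  have e1 := (isForce_iff ω d hW _ _).1 h3 V hV
  have e2 : inner ℂ W.1 y.lapDisp = -∑ j, inner ℂ (W.2 j) (V.2 j) :=
    inner_lap ⟨(y.1 : L2 Ω), y.1.2.1⟩ (by rw [← h2] at hp; exact hp) hW
  rw [inner_neg_right, neg_neg, hVx] at e1
  rw [EnergySpace.inner_def, ← hWx, e2, ← e1, ← Finset.sum_neg_distrib, ← Finset.sum_add_distrib,
    Complex.re_sum]
  refine Finset.sum_nonpos fun j _ => ?_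
  have e3 := re_inner_dampingOp_nonneg ω hd (V.2 j)
  have e4 : (inner ℂ (V.2 j) (W.2 j)).re = (inner ℂ (W.2 j) (V.2 j)).re := by
    rw [← inner_conj_symm, Complex.conj_re]
  rw [inner_sub_right, Complex.add_re, Complex.neg_re, Complex.sub_re, e4]
  linarith

/-- Here `v = 0`, so `Δu` is a weakly harmonic element of `H₀¹` and vanishes; then `u` vanishes by
uniqueness for the Dirichlet problem. -/
lemma eq_zero_of_plateGraph (hn : 0 < n) (hΩb : Bornology.IsBounded (Ω : Set (Rn n)))
    {ω : Opens (Rn n)} {d : ℝ} {x : EnergySpace Ω} (h : (x, 0) ∈ plateGraph Ω ω d) : x = 0 := by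
  obtain ⟨h1, h2, p, hp, h3⟩ := h
  simp only at h1 h2 hp h3
  have hv : x.vel = 0 := h2.symm
  rw [hv] at hp
  have hp0 : ∀ i, p i = 0 := fun i => (hp i).unique (HasWeakPartial.zero i)
  obtain ⟨W, hW, hWx⟩ := exists_gradClosure_of_mem_H10 h1
  rw [← hWx] at h3
  have e1 := (isForce_iff ω d hW _ _).1 h3 W hW
  simp only [hp0, map_zero, sub_zero, EnergySpace.vel_zero, neg_zero, inner_zero_right] at e1
  have hW0 := fst_eq_zero_of_sum_inner_eq_zero hn hΩb hW e1
  have hlap : x.lapDisp = 0 := hWx.symm.trans hW0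
  exact Prod.ext (eq_zero_of_lap_eq_zero hn hΩb x.1 hlap) hv

/-- The damping enters as the functional `w ↦ ∑ ⟨∂ⱼw, a∂ⱼv⟩`, so `W` is only a weak solution in
`H₀¹`, which is all that the domain asks of `Δu`. -/
lemma exists_plateGraph (hn : 0 < n) (hΩb : Bornology.IsBounded (Ω : Set (Rn n)))
    (hΩ : HasC2Boundary (Ω : Set (Rn n))) (ω : Opens (Rn n)) (d : ℝ) (y : EnergySpace Ω) :
    ∃ x, (x, y) ∈ plateGraph Ω ω d := by
  obtain ⟨V, hV, hVy⟩ := exists_gradClosure_of_mem_H10 y.1.2.2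
  obtain ⟨W, hW, hweak⟩ := exists_weak_solution hn hΩb y.vel fun j => dampingOp ω d (V.2 j)
  obtain ⟨u, hu⟩ := exists_lap_eq hn hΩb hΩ W.1
  let x : EnergySpace Ω := ((u, (y.1 : L2 Ω)) : ↥(H2H10 Ω) × L2 Ω)
  have hx : x.lapDisp = W.1 := hu
  refine ⟨x, ?_, rfl, V.2, ?_, ?_⟩
  · change x.lapDisp ∈ H10 Ω
    rw [hx]
    exact mem_H10_of_gradClosure hW
  · have := hasWeakGradient_of_mem hV
    rwa [hVy] at this
  · change IsForce ω d x.lapDisp V.2 (-y.vel)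
    rw [hx, isForce_iff ω d hW]
    intro w hw
    simp only [inner_sub_right, inner_neg_right, neg_neg]
    rw [Finset.sum_sub_distrib, hweak w hw]
    ring

end Plate

end

theorem theorem2p1 (n : ℕ) (hn : 2 ≤ n)
    (Ω : TopologicalSpace.Opens (EuclideanSpace ℝ (Fin n)))
    (hΩ_conn : IsConnected (Ω : Set (EuclideanSpace ℝ (Fin n))))
    (hΩ_bdd : Bornology.IsBounded (Ω : Set (EuclideanSpace ℝ (Fin n))))
    (hΩ_bdry : Plate.HasC2Boundary (Ω : Set (EuclideanSpace ℝ (Fin n))))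
    (ω : TopologicalSpace.Opens (EuclideanSpace ℝ (Fin n))) (hω : ω ≤ Ω)
    (d : ℝ) (hd : 0 < d) :
    -- the energy inner product makes the energy space a Hilbert space
    (∀ z : Plate.EnergySpace Ω, ‖z‖ = 0 → z = 0) ∧
    CompleteSpace (Plate.EnergySpace Ω) ∧
    -- the plate operator generates a semigroup of contractions on it
    ∃ T : ℝ≥0 → Plate.EnergySpace Ω →L[ℂ] Plate.EnergySpace Ω,
      Plate.IsC0ContractionSemigroup T ∧
      Plate.IsGenerator (Plate.plateOperator Ω ω d) T := by
  have hn0 : 0 < n := by omega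
  have hsep := Plate.EnergySpace.eq_zero_of_norm_eq_zero hn0 hΩ_bdd
  have hcomp := Plate.EnergySpace.completeSpace hn0 hΩ_bdd hΩ_bdry
  refine ⟨hsep, hcomp, ?_⟩
  -- The seminorm is definite by `hsep`; this instance keeps it as the norm, so limits and bounds
  -- retain their meaning.
  let _ : NormedAddCommGroup (Plate.EnergySpace Ω) := .ofSeparation hsep
  refine Plate.exists_semigroup_of_dissipative_bijective (Plate.plateOperator Ω ω d) ?_ ?_ ?_
  all_goals rw [Plate.graph_plateOperator]
  · exact fun x y h => Plate.re_inner_plateGraph_nonpos hd.le h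
  · exact fun x h => Plate.eq_zero_of_plateGraph hn0 hΩ_bdd h
  · exact Plate.exists_plateGraph hn0 hΩ_bdd hΩ_bdry ω d
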